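/- Let $(M^n,g)$ be a simply connected (in particular connected) smooth Riemannian manifold of dimension $n\ge 4$ with Levi-Civita connection $\nabla$, curvature tensor $R(X,Y,Z,V)=g(\nabla_X\nabla_YZ-\nabla_Y\nabla_XZ-\nabla_{[X,Y]}Z,V)$, Ricci tensor $\mathrm{Ric}(X,Y)=\mathrm{tr}(V\mapsto R_{V,X}Y)$, scalar curvature $S$, Schouten tensor $\mathfrak k=\frac1{n-2}\bigl(\mathrm{Ric}-\frac{S}{2(n-1)}g\bigr)$ and Weyl tensor $W=R-g\odot\mathfrak k$, where $$(g\odot h)(X,Y,Z,V)=g(X,V)h(Y,Z)+g(Y,Z)h(X,V)-g(X,Z)h(Y,V)-g(Y,V)h(X,Z).$$ Write $X^*=g(X,\cdot)$ and let $\delta W(X,Y,Z)=\sum_i(\nabla_{e_i}W)(X,Y,Z,e_i)$ for an orthonormal frame $(e_i)$, $\delta W_Z=\delta W(\cdot,\cdot,Z)$, and $\mathrm d^\nabla\mathfrak k(X,Y,Z)=(\nabla_X\mathfrak k)(Y,Z)-(\nabla_Y\mathfrak k)(X,Z)$. A metric has harmonic Weyl tensor if its $\delta W$ vanishes identically. Let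 $\mathcal W$ be the endomorphism of $(0,2)$-tensors with $\mathcal W(X^*\otimes Y^*)(Z,V)=W(Y,Z,V,X)$; it restricts to an endomorphism of $\Lambda^2T^*M$, and $\det\mathcal W$ denotes the determinant of that restriction. Let $\mathfrak w(\theta)=\sum_i e_i\llcorner\mathcal W^2(e_i^*\wedge\theta)$ on $T^*M$, with $\alpha\wedge\beta=\alpha\otimes\beta-\beta\otimes\alpha$, and let $\mathfrak w^\#$ be its (pointwise) Moore–Penrose inverse with respect to $g$. Let $\mathcal E_p=\{v\in T_pM: W(v,\cdot,\cdot,\cdot)=0\}$ and let $M_{\mathcal E}$ be the (open and dense) set of points at which $p\mapsto\dim\mathcal E_p$ is locally constant. On $M_{\mathcal E}$ define the vector field $\mathbb T$ and the tensor $C_{\mathbb T}$ by $$g(\mathbb T,\cdot)=\frac1{n-3}\,\mathfrak w^\#\Bigl(\sum_i e_i\llcorner\mathcal W(\delta W_{e_i})\Bigr),\qquad C_{\mathbb T}=\mathrm d^\nabla\mathfrak k-W(\cdot,\cdot,\cdot,\mathbb T).$$ Suppose that $\mathcal E_p=0$ for all $p\in M_{\mathcal E}$. Then there is a smooth function $\psi:M\to(0,\infty)$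 such that the metric $\psi^{-2}g$ has harmonic Weyl tensor if and only if $\mathrm d\mathbb T^*=0$ and $C_{\mathbb T}=0$ on $M_{\mathcal E}$ and $\mathbb T$ extends to a smooth vector field on $M$. Moreover, if $\det\mathcal W\neq0$ at every point of $M_{\mathcal E}$ and $C_{\mathbb T}=0$ on $M_{\mathcal E}$, then $\mathrm d\mathbb T^*=0$ on $M_{\mathcal E}$. -/

import Mathlib

open scoped Manifold ContDiff Topology Matrix

namespace ConfWeyl

noncomputable section

/-! ## Riemannian geometry in coordinates

A metric on an open set of `ℝⁿ` is given by its matrix of components `G y i j`. All tensors are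
given by their components in the coordinate frame `∂₀, …, ∂ₙ₋₁`. -/

/-- The coordinate space `ℝⁿ`. -/
abbrev Coord (n : ℕ) : Type := EuclideanSpace ℝ (Fin n)

/-- Partial derivative `∂ᵢ f` at `y`. -/
def pd {n : ℕ} (i : Fin n) (f : Coord n → ℝ) (y : Coord n) : ℝ :=
  fderiv ℝ f y (EuclideanSpace.single i 1)

/-- The components `gⁱʲ` of the inverse metric. -/
def invMetric {n : ℕ} (G : Coord n → Matrix (Fin n) (Fin n) ℝ) (y : Coord n) :
    Matrix (Fin n) (Fin n) ℝ :=
  (G y)⁻¹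

/-- The Christoffel symbols `Γᵏᵢⱼ` of the Levi-Civita connection, `∇_{∂ᵢ} ∂ⱼ = Γᵏᵢⱼ ∂ₖ`. -/
def christoffel {n : ℕ} (G : Coord n → Matrix (Fin n) (Fin n) ℝ) (k i j : Fin n)
    (y : Coord n) : ℝ :=
  (1 / 2) * ∑ l, invMetric G y k l *
    (pd i (fun z => G z j l) y + pd j (fun z => G z i l) y - pd l (fun z => G z i j) y)

/-- The Riemannian curvature tensor
`R(X,Y,Z,T) = g(∇_X ∇_Y Z - ∇_Y ∇_X Z - ∇_{[X,Y]} Z, T)`, evaluated on `∂ᵢ, ∂ⱼ, ∂ₖ, ∂ₗ`. -/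
def riem {n : ℕ} (G : Coord n → Matrix (Fin n) (Fin n) ℝ) (i j k l : Fin n)
    (y : Coord n) : ℝ :=
  ∑ m, G y m l *
    (pd i (christoffel G m j k) y - pd j (christoffel G m i k) y
      + ∑ s, (christoffel G s j k y * christoffel G m i s y
              - christoffel G s i k y * christoffel G m j s y))

/-- The Ricci tensor `Ric(X,Y) = trace (V ↦ R_{V,X} Y)`. -/
def ricci {n : ℕ} (G : Coord n → Matrix (Fin n) (Fin n) ℝ) (j k : Fin n) (y : Coord n) : ℝ :=
  ∑ i, ∑ l, invMetric G y i l * riem G i j k l y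

/-- The scalar curvature. -/
def scalarCurv {n : ℕ} (G : Coord n → Matrix (Fin n) (Fin n) ℝ) (y : Coord n) : ℝ :=
  ∑ j, ∑ k, invMetric G y j k * ricci G j k y

/-- The Schouten tensor `𝔨 = (n-2)⁻¹ (Ric - S g / (2 (n-1)))`. -/
def schouten {n : ℕ} (G : Coord n → Matrix (Fin n) (Fin n) ℝ) (i j : Fin n) (y : Coord n) : ℝ :=
  (1 / ((n : ℝ) - 2)) *
    (ricci G i j y - (1 / (2 * ((n : ℝ) - 1))) * scalarCurv G y * G y i j)

/-- The Weyl tensor `W = R - g ⊙ 𝔨`, where `⊙` is the Kulkarni-Nomizu product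
`(g ⊙ h)(X,Y,Z,T) = g(X,T) h(Y,Z) + g(Y,Z) h(X,T) - g(X,Z) h(Y,T) - g(Y,T) h(X,Z)`. -/
def weyl {n : ℕ} (G : Coord n → Matrix (Fin n) (Fin n) ℝ) (i j k l : Fin n)
    (y : Coord n) : ℝ :=
  riem G i j k l y -
    (G y i l * schouten G j k y + G y j k * schouten G i l y
      - G y i k * schouten G j l y - G y j l * schouten G i k y)

/-- The covariant derivative `(∇_{∂ₐ} b)(∂ᵢ, ∂ⱼ)` of a `(0,2)` tensor field. -/
def covDeriv2 {n : ℕ} (G : Coord n → Matrix (Fin n) (Fin n) ℝ)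
    (b : Fin n → Fin n → Coord n → ℝ) (a i j : Fin n) (y : Coord n) : ℝ :=
  pd a (b i j) y -
    ∑ m, (christoffel G m a i y * b m j y + christoffel G m a j y * b i m y)

/-- The covariant derivative `(∇_{∂ₐ} A)(∂ᵢ, ∂ⱼ, ∂ₖ, ∂ₗ)` of a `(0,4)` tensor field. -/
def covDeriv4 {n : ℕ} (G : Coord n → Matrix (Fin n) (Fin n) ℝ)
    (A : Fin n → Fin n → Fin n → Fin n → Coord n → ℝ) (a i j k l : Fin n) (y : Coord n) : ℝ :=
  pd a (A i j k l) y -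
    ∑ m, (christoffel G m a i y * A m j k l y + christoffel G m a j y * A i m k l y
      + christoffel G m a k y * A i j m l y + christoffel G m a l y * A i j k m y)

/-- The divergence of the Weyl tensor in its last argument,
`δW(X,Y,Z) = ∑ (∇_e W)(X,Y,Z,e)`, the sum over an orthonormal frame `e`. -/
def divWeyl {n : ℕ} (G : Coord n → Matrix (Fin n) (Fin n) ℝ) (i j k : Fin n)
    (y : Coord n) : ℝ :=
  ∑ a, ∑ l, invMetric G y a l * covDeriv4 G (weyl G) a i j k l y

/-- The exterior derivative of the Schouten tensor,
`d^∇ 𝔨 (X,Y,Z) = (∇_X 𝔨)(Y,Z) - (∇_Y 𝔨)(X,Z)`. -/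
def dSchouten {n : ℕ} (G : Coord n → Matrix (Fin n) (Fin n) ℝ) (i j k : Fin n)
    (y : Coord n) : ℝ :=
  covDeriv2 G (schouten G) i j k y - covDeriv2 G (schouten G) j i k y

/-! ## Linear algebra in one tangent space

`h` is the matrix of the inverse metric and `A` are the components of a `(0,4)` tensor. -/

/-- The action of a curvature tensor `A` on `(0,2)` tensors,
`𝒜(X^* ⊗ Y^*)(Z,T) = A(Y,Z,T,X)`, where `X^* = g(X, ·)`. -/
def curvOp {n : ℕ} (h : Matrix (Fin n) (Fin n) ℝ) (A : Fin n → Fin n → Fin n → Fin n → ℝ)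
    (b : Matrix (Fin n) (Fin n) ℝ) : Matrix (Fin n) (Fin n) ℝ :=
  Matrix.of fun k l => ∑ a, ∑ c, ∑ i, ∑ j, b a c * h a i * h c j * A j k l i

/-- `θ ∧ η = θ ⊗ η - η ⊗ θ` for covectors `θ`, `η`. -/
def wedge {n : ℕ} (θ η : Fin n → ℝ) : Matrix (Fin n) (Fin n) ℝ :=
  Matrix.vecMulVec θ η - Matrix.vecMulVec η θ

/-- The determinant of `𝒜` as an endomorphism of the two forms: the determinant of its matrix
in the basis `dxᵏ ∧ dxˡ`, `k < l` (the coefficient of a two form at `dxᵏ ∧ dxˡ` is its component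
with indices `k, l`). -/
def detCurvOp {n : ℕ} (h : Matrix (Fin n) (Fin n) ℝ)
    (A : Fin n → Fin n → Fin n → Fin n → ℝ) : ℝ :=
  Matrix.det (Matrix.of fun P Q : {q : Fin n × Fin n // q.1 < q.2} =>
    curvOp h A (wedge (Pi.single Q.1.1 1) (Pi.single Q.1.2 1)) P.1.1 P.1.2)

/-- The matrix of the negative Ricci contraction `𝔴` of `𝒜²`, an endomorphism of the covectors:
`𝔴(θ) = ∑ᵢ ∂ᵢ ⌟ 𝒜²(dxⁱ ∧ θ)`. -/
def ricSq {n : ℕ} (h : Matrix (Fin n) (Fin n) ℝ) (A : Fin n → Fin n → Fin n → Fin n → ℝ) :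
    Matrix (Fin n) (Fin n) ℝ :=
  Matrix.of fun l m =>
    ∑ i, curvOp h A (curvOp h A (wedge (Pi.single i 1) (Pi.single m 1))) i l

/-- `B` satisfies the Moore-Penrose equations for the endomorphism `A` with respect to the inner
product with matrix `h`: `A B A = A`, `B A B = B`, and `A B`, `B A` are `h`-symmetric. -/
structure IsMoorePenrose {n : ℕ} (h A B : Matrix (Fin n) (Fin n) ℝ) : Prop where
  aba : A * B * A = A
  bab : B * A * B = B
  symm_ab : (h * (A * B))ᵀ = h * (A * B)
  symm_ba : (h * (B * A))ᵀ = h * (B * A)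

/-- The Moore-Penrose inverse `A^#` with respect to the inner product with matrix `h`. -/
def moorePenrose {n : ℕ} (h A : Matrix (Fin n) (Fin n) ℝ) : Matrix (Fin n) (Fin n) ℝ :=
  Classical.epsilon (IsMoorePenrose h A)

theorem IsMoorePenrose.unique {n : ℕ} {h A B C : Matrix (Fin n) (Fin n) ℝ} (hs : hᵀ = h)
    (hu : IsUnit h.det) (hB : IsMoorePenrose h A B) (hC : IsMoorePenrose h A C) : B = C := by
  have cancel : ∀ {X Y : Matrix (Fin n) (Fin n) ℝ}, h * X = h * Y → X = Y := by
    intro X Y hXY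
    have := congrArg (fun Z => h⁻¹ * Z) hXY
    simpa [← Matrix.mul_assoc, Matrix.nonsing_inv_mul h hu] using this
  have symm : ∀ {X : Matrix (Fin n) (Fin n) ℝ}, (h * X)ᵀ = h * X → Xᵀ * h = h * X := by
    intro X hX
    rwa [Matrix.transpose_mul, hs] at hX
  have key : ∀ {X Y : Matrix (Fin n) (Fin n) ℝ}, (h * X)ᵀ = h * X → (h * Y)ᵀ = h * Y →
      (h * (X * Y))ᵀ = h * (Y * X) := by
    intro X Y hX hY
    rw [Matrix.transpose_mul, Matrix.transpose_mul, hs, Matrix.mul_assoc, symm hX,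
      ← Matrix.mul_assoc, symm hY, Matrix.mul_assoc]
  have e1 : A * B = A * C := by
    have h1 := key hC.symm_ab hB.symm_ab
    have h2 : A * C * (A * B) = A * B := by
      rw [← Matrix.mul_assoc, hC.aba]
    have h3 : A * B * (A * C) = A * C := by
      rw [← Matrix.mul_assoc, hB.aba]
    rw [h2, h3, hB.symm_ab] at h1
    exact cancel h1
  have e2 : B * A = C * A := by
    have h1 := key hB.symm_ba hC.symm_ba
    have h2 : B * A * (C * A) = B * A := by
      rw [Matrix.mul_assoc, ← Matrix.mul_assoc A, hC.aba]
    have h3 : C * A * (B * A) = C * A := by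
      rw [Matrix.mul_assoc, ← Matrix.mul_assoc A, hB.aba]
    rw [h2, h3, hB.symm_ba] at h1
    exact cancel h1
  calc B = B * A * B := hB.bab.symm
    _ = C * A * B := by rw [e2]
    _ = C * (A * C) := by rw [Matrix.mul_assoc, e1]
    _ = C := by rw [← Matrix.mul_assoc, hC.bab]

/-! ## Riemannian manifolds

Tensors at a point `p` are given by their components in the coordinate frame of the preferred
chart at `p`. -/

section Manifold

variable {n : ℕ} {M : Type*} [TopologicalSpace M] [ChartedSpace (Coord n) M]

/-- The coordinate vector field `∂ᵢ` of the chart at `p`, at the point with coordinates `y`. -/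
def coordFrame (p : M) (i : Fin n) (y : Coord n) :
    TangentSpace (𝓡 n) ((extChartAt (𝓡 n) p).symm y) :=
  mfderiv (𝓡 n) (𝓡 n) (extChartAt (𝓡 n) p).symm y (EuclideanSpace.single i 1 : Coord n)

/-- The coordinates of `p` in the chart at `p`. -/
def center (n : ℕ) {M : Type*} [TopologicalSpace M] [ChartedSpace (Coord n) M] (p : M) :
    Coord n :=
  extChartAt (𝓡 n) p p

variable [IsManifold (𝓡 n) ∞ M]

/-- Smooth Riemannian metrics on `M`. -/
abbrev Metric (n : ℕ) (M : Type*) [TopologicalSpace M] [ChartedSpace (Coord n) M]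
    [IsManifold (𝓡 n) ∞ M] : Type _ :=
  Bundle.ContMDiffRiemannianMetric (𝓡 n) ∞ (Coord n) (fun x : M => TangentSpace (𝓡 n) x)

/-- The components `gᵢⱼ` of the metric in the chart at `p`. -/
def localMetric (g : Metric n M) (p : M) (y : Coord n) : Matrix (Fin n) (Fin n) ℝ :=
  Matrix.of fun i j =>
    g.inner ((extChartAt (𝓡 n) p).symm y) (coordFrame p i y) (coordFrame p j y)

/-- The inverse metric at `p`. -/
def invMetricAt (g : Metric n M) (p : M) : Matrix (Fin n) (Fin n) ℝ :=
  invMetric (localMetric g p) (center n p)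

/-- The Weyl tensor at `p`. -/
def weylAt (g : Metric n M) (p : M) (i j k l : Fin n) : ℝ :=
  weyl (localMetric g p) i j k l (center n p)

/-- The divergence `δW` of the Weyl tensor at `p`. -/
def divWeylAt (g : Metric n M) (p : M) (i j k : Fin n) : ℝ :=
  divWeyl (localMetric g p) i j k (center n p)

/-- `(M, g)` has harmonic Weyl tensor: `δW = 0`. -/
def HarmonicWeyl (g : Metric n M) : Prop :=
  ∀ (p : M) (i j k : Fin n), divWeylAt g p i j k = 0

/-- `gbar = ψ⁻² g` for a smooth positive function `ψ` on `M`. -/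
def IsConformalTo (g gbar : Metric n M) : Prop :=
  ∃ ψ : M → ℝ, ContMDiff (𝓡 n) 𝓘(ℝ, ℝ) ∞ ψ ∧ (∀ p, 0 < ψ p) ∧
    ∀ (p : M) (v w : TangentSpace (𝓡 n) p),
      gbar.inner p v w = (ψ p ^ 2)⁻¹ * g.inner p v w

/-- The fiber `𝓔_p = {v ∈ T_pM | W(v,·,·,·) = 0}`. -/
def nullity (g : Metric n M) (p : M) : Submodule ℝ (Fin n → ℝ) where
  carrier := {v | ∀ j k l, ∑ i, v i * weylAt g p i j k l = 0}
  add_mem' := by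
    intro v w hv hw j k l
    simp only [Pi.add_apply, add_mul, Finset.sum_add_distrib, hv j k l, hw j k l, add_zero]
  zero_mem' := by
    intro j k l
    simp
  smul_mem' := by
    intro c v hv j k l
    simp only [Pi.smul_apply, smul_eq_mul, mul_assoc, ← Finset.mul_sum, hv j k l, mul_zero]

/-- The rank of `𝓔` at `p`. -/
def rankE (g : Metric n M) (p : M) : ℕ :=
  Module.finrank ℝ (nullity g p)

/-- The set `M_𝓔` of all points at which the rank of `𝓔` is locally constant. -/
def regularSet (g : Metric n M) : Set M :=
  {p | ∀ᶠ q in 𝓝 p, rankE g q = rankE g p}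

/-- The determinant of the Weyl tensor `𝒲` as an endomorphism of the two forms at `p`. -/
def detWeylAt (g : Metric n M) (p : M) : ℝ :=
  detCurvOp (invMetricAt g p) (weylAt g p)

/-- The covector `∑ e ⌟ 𝒲(δW_e)` at `p`, the sum over an orthonormal basis `e`,
where `δW_Z` is the two form `δW_Z(X,Y) = δW(X,Y,Z)`. -/
def sourceCovector (g : Metric n M) (p : M) (l : Fin n) : ℝ :=
  ∑ c, ∑ d, invMetricAt g p c d *
    curvOp (invMetricAt g p) (weylAt g p) (Matrix.of fun i j => divWeylAt g p i j c) d l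

/-- The covector `𝕋^* = (n-3)⁻¹ 𝔴^#(∑ e ⌟ 𝒲(δW_e))` at `p`. -/
def covectorT (g : Metric n M) (p : M) : Fin n → ℝ :=
  (1 / ((n : ℝ) - 3)) •
    (moorePenrose (invMetricAt g p) (ricSq (invMetricAt g p) (weylAt g p)) *ᵥ sourceCovector g p)

/-- The components of the vector `𝕋` at `p`. -/
def compT (g : Metric n M) (p : M) : Fin n → ℝ :=
  invMetricAt g p *ᵥ covectorT g p

/-- The vector `𝕋` at `p`. The coordinate frame of the chart at `p` is, at the point `p` itself,
the standard basis of the model space of `T_pM`. -/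
def vecT (g : Metric n M) (p : M) : TangentSpace (𝓡 n) p :=
  (WithLp.toLp 2 (compT g p) : Coord n)

/-- The tensor `C_𝕋 = d^∇ 𝔨 - W(·,·,·,𝕋)` at `p`. -/
def cottonT (g : Metric n M) (p : M) (i j k : Fin n) : ℝ :=
  dSchouten (localMetric g p) i j k (center n p) - ∑ l, compT g p l * weylAt g p i j k l

/-- The components of the one form `X^* = g(X,·)` in the chart at `p`. -/
def localDual (g : Metric n M) (X : ∀ q : M, TangentSpace (𝓡 n) q) (p : M) (i : Fin n)
    (y : Coord n) : ℝ :=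
  g.inner ((extChartAt (𝓡 n) p).symm y) (X ((extChartAt (𝓡 n) p).symm y)) (coordFrame p i y)

/-- The exterior derivative `dX^*` at `p`. -/
def dDual (g : Metric n M) (X : ∀ q : M, TangentSpace (𝓡 n) q) (p : M) (i j : Fin n) : ℝ :=
  pd i (localDual g X p j) (center n p) - pd j (localDual g X p i) (center n p)

/-- The vector field `X`, given on the set `U`, extends to a smooth vector field on `M`. -/
def ExtendsSmoothly (U : Set M) (X : ∀ q : M, TangentSpace (𝓡 n) q) : Prop :=
  ∃ Y : ∀ q : M, TangentSpace (𝓡 n) q,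
    ContMDiff (𝓡 n) ((𝓡 n).tangent) ∞ (fun q => (⟨q, Y q⟩ : TangentBundle (𝓡 n) M)) ∧
    ∀ q ∈ U, Y q = X q

end Manifold

end

end ConfWeyl

namespace ConfWeyl

/-! ## Calculus of partial derivatives -/

section PartialDerivatives

variable {n : ℕ} {U : Set (Coord n)} {f f' : Coord n → ℝ} {y : Coord n}

/-! Two local identities carry the equivalence. The contracted second Bianchi identity gives δW =
(n-3) d^∇𝔨 (`MetricOn.divWeyl_eq`), and under g ↦ exp(2f) g the tensor d^∇𝔨 changes exactly by
W(·,·,·,∇f) (`MetricOn.dSchouten_conformal`). With ψ = exp F, the metric ψ⁻²g therefore has harmonic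
Weyl tensor if and only if d^∇𝔨 = W(·,·,·,grad F) on all of M.

Where the nullity is zero, a vector V with d^∇𝔨 = W(·,·,·,V) is unique and can be computed. The
source covector is then (n-3) 𝔴(V^*), and ⟨𝔴(V^*), V^*⟩ is half of |W(·,·,·,V)|², so 𝔴 is injective,
its Moore-Penrose inverse is its inverse, and V = 𝕋 (`compT_eq`). Thus harmonicity forces 𝕋 = grad F
on M_𝓔, which is closed, satisfies C_𝕋 = 0 and extends smoothly as grad F.

Conversely, M_𝓔 is dense because the dimension of the kernel of W is upper semicontinuous
(`dense_regularSet`). Closedness and the equation d^∇𝔨 = W(·,·,·,X) pass by continuity to the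
extension X on M. Simple connectedness makes X^* exact (`exists_potential`), and a potential F gives
ψ = exp F.

For the last assertion, d^∇𝔨 is divergence free in its last slot (`MetricOn.div_dSchouten`).
Inserting d^∇𝔨 = W(·,·,·,𝕋), the terms with ∇W become W(·,·,𝕋,𝕋) = 0, and what remains is 𝒲(d𝕋^*) =
0 (`MetricOn.weyl_exterior_eq_zero`). If det 𝒲 ≠ 0, this gives d𝕋^* = 0.

The pointwise quantities are evaluated at the center of the preferred chart of each point, whereas
derivatives need one fixed chart. The bridge is that transition maps are isometries of the
coordinate metrics (`isLocalIsom_transition`), together with the transformation laws of W, d^∇𝔨 and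
one forms. -/

theorem differentiableAt_of_smooth (hU : IsOpen U) (hf : ContDiffOn ℝ ∞ f U) (hy : y ∈ U) :
    DifferentiableAt ℝ f y :=
  (hf.contDiffAt (hU.mem_nhds hy)).differentiableAt (by simp)

theorem pd_congr (hU : IsOpen U) (h : ∀ z ∈ U, f z = f' z) (hy : y ∈ U) (i : Fin n) :
    pd i f y = pd i f' y := by
  have : f =ᶠ[𝓝 y] f' := Filter.eventuallyEq_of_mem (hU.mem_nhds hy) h
  simp only [pd, this.fderiv_eq]

theorem pd_const (i : Fin n) (c : ℝ) : pd i (fun _ => c) y = 0 := by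
  simp [pd]

theorem pd_add (hU : IsOpen U) (hf : ContDiffOn ℝ ∞ f U) (hf' : ContDiffOn ℝ ∞ f' U)
    (hy : y ∈ U) (i : Fin n) : pd i (fun z => f z + f' z) y = pd i f y + pd i f' y := by
  simp only [pd]
  rw [fderiv_fun_add (differentiableAt_of_smooth hU hf hy) (differentiableAt_of_smooth hU hf' hy)]
  simp

theorem pd_sub (hU : IsOpen U) (hf : ContDiffOn ℝ ∞ f U) (hf' : ContDiffOn ℝ ∞ f' U)
    (hy : y ∈ U) (i : Fin n) : pd i (fun z => f z - f' z) y = pd i f y - pd i f' y := by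
  simp only [pd]
  rw [fderiv_fun_sub (differentiableAt_of_smooth hU hf hy) (differentiableAt_of_smooth hU hf' hy)]
  simp

theorem pd_neg (i : Fin n) : pd i (fun z => -f z) y = -pd i f y := by
  simp only [pd]
  rw [fderiv_fun_neg]
  simp

theorem pd_mul (hU : IsOpen U) (hf : ContDiffOn ℝ ∞ f U) (hf' : ContDiffOn ℝ ∞ f' U)
    (hy : y ∈ U) (i : Fin n) :
    pd i (fun z => f z * f' z) y = pd i f y * f' y + f y * pd i f' y := by
  simp only [pd]
  rw [fderiv_fun_mul (differentiableAt_of_smooth hU hf hy) (differentiableAt_of_smooth hU hf' hy)]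
  simp
  ring

theorem pd_const_mul (hU : IsOpen U) (c : ℝ) (hf : ContDiffOn ℝ ∞ f U) (hy : y ∈ U) (i : Fin n) :
    pd i (fun z => c * f z) y = c * pd i f y := by
  rw [pd_mul hU contDiffOn_const hf hy, pd_const]
  ring

theorem pd_sum (hU : IsOpen U) {ι : Type*} (s : Finset ι) {F : ι → Coord n → ℝ}
    (hF : ∀ a ∈ s, ContDiffOn ℝ ∞ (F a) U) (hy : y ∈ U) (i : Fin n) :
    pd i (fun z => ∑ a ∈ s, F a z) y = ∑ a ∈ s, pd i (F a) y := by
  simp only [pd]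
  rw [fderiv_fun_sum (fun a ha => differentiableAt_of_smooth hU (hF a ha) hy)]
  simp

theorem smooth_sum {ι : Type*} (s : Finset ι) {F : ι → Coord n → ℝ}
    (hF : ∀ a, ContDiffOn ℝ ∞ (F a) U) : ContDiffOn ℝ ∞ (fun z => ∑ a ∈ s, F a z) U :=
  ContDiffOn.sum fun a _ => hF a

theorem smooth_pd (hU : IsOpen U) (hf : ContDiffOn ℝ ∞ f U) (i : Fin n) :
    ContDiffOn ℝ ∞ (pd i f) U := by
  have : ContDiffOn ℝ ∞ (fderiv ℝ f) U := hf.fderiv_of_isOpen hU (by simp)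
  exact this.clm_apply contDiffOn_const

theorem pd_comm (hU : IsOpen U) (hf : ContDiffOn ℝ ∞ f U) (hy : y ∈ U) (i j : Fin n) :
    pd i (pd j f) y = pd j (pd i f) y := by
  have hc : ContDiffAt ℝ ∞ f y := hf.contDiffAt (hU.mem_nhds hy)
  have hs : IsSymmSndFDerivAt ℝ f y := by
    apply hc.isSymmSndFDerivAt
    simp only [minSmoothness_of_isRCLikeNormedField]
    exact ENat.LEInfty.out
  have hd : DifferentiableAt ℝ (fderiv ℝ f) y :=
    (hc.fderiv_right (m := ∞) (by simp)).differentiableAt (by simp)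
  have key : ∀ k l : Fin n, pd k (pd l f) y =
      fderiv ℝ (fderiv ℝ f) y (EuclideanSpace.single k 1) (EuclideanSpace.single l 1) := by
    intro k l
    show fderiv ℝ (fun z => fderiv ℝ f z (EuclideanSpace.single l 1)) y _ = _
    rw [fderiv_clm_apply hd (differentiableAt_const _)]
    simp
  rw [key, key, hs.eq]

theorem fderiv_apply_eq_sum (v : Coord n) :
    fderiv ℝ f y v = ∑ a, v a * pd a f y := by
  have hv : v = ∑ a, v a • (EuclideanSpace.single a (1 : ℝ) : Coord n) := by
    ext b
    simp [Finset.sum_apply, Pi.single_apply]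
  conv_lhs => rw [hv]
  simp [pd]

theorem pd_comp {V : Set (Coord n)} (hU : IsOpen U) (hV : IsOpen V) {Φ : Coord n → Coord n}
    (hΦ : ContDiffOn ℝ ∞ Φ U) (hm : ∀ z ∈ U, Φ z ∈ V) (hf : ContDiffOn ℝ ∞ f V) (hy : y ∈ U)
    (i : Fin n) :
    pd i (fun z => f (Φ z)) y = ∑ a, pd i (fun z => Φ z a) y * pd a f (Φ y) := by
  have hd : DifferentiableAt ℝ Φ y := (hΦ.contDiffAt (hU.mem_nhds hy)).differentiableAt (by simp)
  have hd' := differentiableAt_of_smooth hV hf (hm y hy)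
  have h1 : fderiv ℝ (fun z => f (Φ z)) y = (fderiv ℝ f (Φ y)).comp (fderiv ℝ Φ y) :=
    fderiv_comp y hd' hd
  have h2 : ∀ a, pd i (fun z => Φ z a) y = fderiv ℝ Φ y (EuclideanSpace.single i 1) a := by
    intro a
    have := ((EuclideanSpace.proj (𝕜 := ℝ) a).hasFDerivAt.comp y hd.hasFDerivAt).fderiv
    have h3 : (fun z => Φ z a) = (EuclideanSpace.proj (𝕜 := ℝ) a) ∘ Φ := rfl
    simp only [pd]
    rw [h3, this]
    rfl
  show fderiv ℝ (fun z => f (Φ z)) y _ = _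
  rw [h1, ContinuousLinearMap.comp_apply, fderiv_apply_eq_sum]
  simp only [h2]

end PartialDerivatives

/-! ### Matrix valued functions -/

section MatrixCalculus

variable {n : ℕ} {U : Set (Coord n)} {F H : Coord n → Matrix (Fin n) (Fin n) ℝ} {y : Coord n}

/-- A matrix valued function with smooth entries. -/
def SmoothMat (U : Set (Coord n)) (F : Coord n → Matrix (Fin n) (Fin n) ℝ) : Prop :=
  ∀ i j, ContDiffOn ℝ ∞ (fun z => F z i j) U

/-- The entrywise partial derivative of a matrix valued function. -/
noncomputable def mpd (a : Fin n) (F : Coord n → Matrix (Fin n) (Fin n) ℝ) (y : Coord n) :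
    Matrix (Fin n) (Fin n) ℝ :=
  Matrix.of fun i j => pd a (fun z => F z i j) y

theorem SmoothMat.mul (hF : SmoothMat U F) (hH : SmoothMat U H) :
    SmoothMat U (fun z => F z * H z) := by
  intro i j
  simp only [Matrix.mul_apply]
  exact smooth_sum _ fun a => (hF i a).mul (hH a j)

theorem SmoothMat.transpose (hF : SmoothMat U F) : SmoothMat U (fun z => (F z)ᵀ) :=
  fun i j => hF j i

theorem SmoothMat.add (hF : SmoothMat U F) (hH : SmoothMat U H) :
    SmoothMat U (fun z => F z + H z) := fun i j => (hF i j).add (hH i j)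

theorem SmoothMat.sub (hF : SmoothMat U F) (hH : SmoothMat U H) :
    SmoothMat U (fun z => F z - H z) := fun i j => (hF i j).sub (hH i j)

theorem SmoothMat.mpd (hU : IsOpen U) (hF : SmoothMat U F) (a : Fin n) :
    SmoothMat U (mpd a F) := fun i j => smooth_pd hU (hF i j) a

theorem SmoothMat.sum {ι : Type*} (s : Finset ι) {F : ι → Coord n → Matrix (Fin n) (Fin n) ℝ}
    (hF : ∀ a, SmoothMat U (F a)) : SmoothMat U (fun z => ∑ a ∈ s, F a z) := by
  intro i j
  simp only [Matrix.sum_apply]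
  exact smooth_sum _ fun a => hF a i j

theorem SmoothMat.smul {f : Coord n → ℝ} (hf : ContDiffOn ℝ ∞ f U) (hF : SmoothMat U F) :
    SmoothMat U (fun z => f z • F z) := fun i j => hf.mul (hF i j)

theorem SmoothMat.det (hF : SmoothMat U F) : ContDiffOn ℝ ∞ (fun z => (F z).det) U := by
  simp only [Matrix.det_apply]
  refine smooth_sum _ fun σ => ?_
  exact (contDiffOn_prod (fun i _ => hF _ _)).const_smul _

/-- Cramer's rule: the entries of the adjugate are themselves determinants of matrices with smooth
entries, and the determinant does not vanish. -/
theorem SmoothMat.inv (hF : SmoothMat U F) (hd : ∀ z ∈ U, IsUnit (F z).det) :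
    SmoothMat U (fun z => (F z)⁻¹) := by
  intro i j
  simp only [Matrix.inv_def, Matrix.smul_apply, smul_eq_mul, Ring.inverse_eq_inv,
    Matrix.adjugate_apply]
  refine (hF.det.inv fun z hz => (hd z hz).ne_zero).mul ?_
  refine SmoothMat.det (F := fun z => (F z).updateRow j (Pi.single i 1)) fun k l => ?_
  by_cases h : k = j
  · subst h
    simp only [Matrix.updateRow_self]
    exact contDiffOn_const
  · simp only [ne_eq, h, not_false_eq_true, Matrix.updateRow_ne]
    exact hF k l

theorem mpd_congr (hU : IsOpen U) (h : ∀ z ∈ U, F z = H z) (hy : y ∈ U) (a : Fin n) :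
    mpd a F y = mpd a H y := by
  ext i j
  exact pd_congr hU (fun z hz => by rw [h z hz]) hy a

theorem mpd_mul (hU : IsOpen U) (hF : SmoothMat U F) (hH : SmoothMat U H) (hy : y ∈ U)
    (a : Fin n) : mpd a (fun z => F z * H z) y = mpd a F y * H y + F y * mpd a H y := by
  ext i j
  simp only [mpd, Matrix.of_apply, Matrix.mul_apply, Matrix.add_apply]
  rw [pd_sum hU _ (fun b _ => (hF i b).mul (hH b j)) hy, ← Finset.sum_add_distrib]
  exact Finset.sum_congr rfl fun b _ => pd_mul hU (hF i b) (hH b j) hy a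

theorem mpd_add (hU : IsOpen U) (hF : SmoothMat U F) (hH : SmoothMat U H) (hy : y ∈ U)
    (a : Fin n) : mpd a (fun z => F z + H z) y = mpd a F y + mpd a H y := by
  ext i j
  exact pd_add hU (hF i j) (hH i j) hy a

theorem mpd_sub (hU : IsOpen U) (hF : SmoothMat U F) (hH : SmoothMat U H) (hy : y ∈ U)
    (a : Fin n) : mpd a (fun z => F z - H z) y = mpd a F y - mpd a H y := by
  ext i j
  exact pd_sub hU (hF i j) (hH i j) hy a

theorem mpd_transpose (a : Fin n) : mpd a (fun z => (F z)ᵀ) y = (mpd a F y)ᵀ := rfl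

theorem mpd_smul (hU : IsOpen U) {f : Coord n → ℝ} (hf : ContDiffOn ℝ ∞ f U) (hF : SmoothMat U F)
    (hy : y ∈ U) (a : Fin n) : mpd a (fun z => f z • F z) y = pd a f y • F y + f y • mpd a F y := by
  ext i j
  exact pd_mul hU hf (hF i j) hy a

theorem mpd_sum (hU : IsOpen U) {ι : Type*} (s : Finset ι)
    {F : ι → Coord n → Matrix (Fin n) (Fin n) ℝ} (hF : ∀ a, SmoothMat U (F a)) (hy : y ∈ U)
    (a : Fin n) : mpd a (fun z => ∑ b ∈ s, F b z) y = ∑ b ∈ s, mpd a (F b) y := by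
  ext i j
  simp only [mpd, Matrix.of_apply, Matrix.sum_apply]
  exact pd_sum hU _ (fun b _ => hF b i j) hy a

theorem mpd_comm (hU : IsOpen U) (hF : SmoothMat U F) (hy : y ∈ U) (a b : Fin n) :
    mpd a (mpd b F) y = mpd b (mpd a F) y := by
  ext i j
  exact pd_comm hU (hF i j) hy a b

end MatrixCalculus

/-! ## The Levi-Civita connection -/

section LeviCivita

variable {n : ℕ} {U : Set (Coord n)} {G : Coord n → Matrix (Fin n) (Fin n) ℝ} {y : Coord n}

/-- `G` is a smooth field of nondegenerate symmetric matrices on the open set `U`. -/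
structure MetricOn (U : Set (Coord n)) (G : Coord n → Matrix (Fin n) (Fin n) ℝ) : Prop where
  isOpen : IsOpen U
  smooth : SmoothMat U G
  symm : ∀ y, (G y)ᵀ = G y
  det : ∀ y ∈ U, IsUnit (G y).det

theorem MetricOn.apply_comm (h : MetricOn U G) (y : Coord n) (i j : Fin n) : G y i j = G y j i :=
  congrFun (congrFun (h.symm y) j) i

theorem MetricOn.mul_inv (h : MetricOn U G) (hy : y ∈ U) : G y * invMetric G y = 1 :=
  Matrix.mul_nonsing_inv _ (h.det y hy)

theorem MetricOn.inv_mul (h : MetricOn U G) (hy : y ∈ U) : invMetric G y * G y = 1 :=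
  Matrix.nonsing_inv_mul _ (h.det y hy)

theorem MetricOn.inv_transpose (h : MetricOn U G) (y : Coord n) :
    (invMetric G y)ᵀ = invMetric G y := by
  rw [invMetric, Matrix.transpose_nonsing_inv, h.symm]

theorem MetricOn.smooth_inv (h : MetricOn U G) : SmoothMat U (invMetric G) :=
  h.smooth.inv h.det

theorem MetricOn.pd_metric_comm (h : MetricOn U G) (a i j : Fin n) (y : Coord n) :
    pd a (fun z => G z i j) y = pd a (fun z => G z j i) y := by
  simp only [h.apply_comm _ i j]

theorem MetricOn.smooth_christoffel (h : MetricOn U G) (k i j : Fin n) :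
    ContDiffOn ℝ ∞ (christoffel G k i j) U := by
  unfold christoffel
  refine contDiffOn_const.mul (smooth_sum _ fun l => (h.smooth_inv k l).mul ?_)
  exact ((smooth_pd h.isOpen (h.smooth _ _) _).add (smooth_pd h.isOpen (h.smooth _ _) _)).sub
    (smooth_pd h.isOpen (h.smooth _ _) _)

/-- The connection matrix `(Γₐ)ᵐₖ = Γᵐₐₖ`. -/
noncomputable def gam (G : Coord n → Matrix (Fin n) (Fin n) ℝ) (a : Fin n) (y : Coord n) :
    Matrix (Fin n) (Fin n) ℝ :=
  Matrix.of fun m k => christoffel G m a k y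

theorem MetricOn.smooth_gam (h : MetricOn U G) (a : Fin n) : SmoothMat U (gam G a) :=
  fun m k => h.smooth_christoffel m a k

theorem MetricOn.christoffel_comm (h : MetricOn U G) (k i j : Fin n) (y : Coord n) :
    christoffel G k i j y = christoffel G k j i y := by
  simp only [christoffel, h.pd_metric_comm _ i j]
  congr 1
  exact Finset.sum_congr rfl fun l _ => by ring

/-- Multiplication by the metric cancels the inverse metric and leaves the Christoffel symbols of
the first kind, which are linear in ∂g. -/
theorem MetricOn.lower_gam (h : MetricOn U G) (hy : y ∈ U) (a l j : Fin n) :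
    (G y * gam G a y) l j = (1 / 2) *
      (pd a (fun z => G z j l) y + pd j (fun z => G z a l) y - pd l (fun z => G z a j) y) := by
  set v : Fin n → ℝ := fun l => (1 / 2) *
      (pd a (fun z => G z j l) y + pd j (fun z => G z a l) y - pd l (fun z => G z a j) y) with hv
  have h1 : (fun m => gam G a y m j) = invMetric G y *ᵥ v := by
    ext m
    simp only [gam, Matrix.of_apply, christoffel, Matrix.mulVec, dotProduct, hv, Finset.mul_sum]
    exact Finset.sum_congr rfl fun l _ => by ring
  have h2 : (fun l => (G y * gam G a y) l j) = G y *ᵥ (fun m => gam G a y m j) := by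
    ext l
    simp [Matrix.mul_apply, Matrix.mulVec, dotProduct]
  have := congrFun h2 l
  rw [h1, Matrix.mulVec_mulVec, h.mul_inv hy, Matrix.one_mulVec] at this
  exact this

/-- Metric compatibility of the Levi-Civita connection. -/
theorem MetricOn.mpd_metric (h : MetricOn U G) (hy : y ∈ U) (a : Fin n) :
    mpd a G y = (gam G a y)ᵀ * G y + G y * gam G a y := by
  have h1 : (gam G a y)ᵀ * G y = (G y * gam G a y)ᵀ := by
    rw [Matrix.transpose_mul, h.symm]
  rw [h1]
  ext i j
  rw [Matrix.add_apply, Matrix.transpose_apply, h.lower_gam hy, h.lower_gam hy]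
  simp only [mpd, Matrix.of_apply]
  rw [h.pd_metric_comm a i j]
  ring

/-- Uniqueness of the Levi-Civita connection. -/
theorem MetricOn.gam_unique (h : MetricOn U G) (hy : y ∈ U)
    {C : Fin n → Matrix (Fin n) (Fin n) ℝ} (hs : ∀ a m k, C a m k = C k m a)
    (hc : ∀ a, mpd a G y = (C a)ᵀ * G y + G y * C a) (a : Fin n) : C a = gam G a y := by
  have hK : ∀ a l j, (G y * C a) l j = (G y * C j) l a := by
    intro a l j
    simp only [Matrix.mul_apply, hs a _ j]
  have hp : ∀ a i j, pd a (fun z => G z i j) y = (G y * C a) j i + (G y * C a) i j := by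
    intro a i j
    have h1 : (C a)ᵀ * G y = (G y * C a)ᵀ := by
      rw [Matrix.transpose_mul, h.symm]
    have := congrFun (congrFun (hc a) i) j
    rwa [h1] at this
  -- Koszul's argument: the alternating sum of three permuted compatibility equations isolates the
  -- lowered symbol, by the symmetry `hK`.
  have key : G y * C a = G y * gam G a y := by
    ext l j
    rw [h.lower_gam hy, hp, hp, hp, hK l a j, hK a l j, hK l j a]
    ring
  have := congrArg (fun X => invMetric G y * X) key
  simpa only [← Matrix.mul_assoc, h.inv_mul hy, Matrix.one_mul] using this

/-- Differentiate g⁻¹g = 1: the inverse metric is parallel as well. -/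
theorem MetricOn.mpd_inv (h : MetricOn U G) (hy : y ∈ U) (a : Fin n) :
    mpd a (invMetric G) y = -(gam G a y * invMetric G y + invMetric G y * (gam G a y)ᵀ) := by
  have h1 : mpd a (fun z => invMetric G z * G z) y = 0 := by
    rw [mpd_congr h.isOpen (H := fun _ => 1) (fun z hz => h.inv_mul hz) hy]
    ext i j
    exact pd_const a _
  rw [mpd_mul h.isOpen h.smooth_inv h.smooth hy, h.mpd_metric hy] at h1
  have h2 := congrArg (fun X => X * invMetric G y) h1
  simp only [Matrix.add_mul, Matrix.mul_add, Matrix.mul_assoc, h.mul_inv hy, Matrix.mul_one,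
    Matrix.zero_mul] at h2
  rw [← Matrix.mul_assoc (invMetric G y) (G y), h.inv_mul hy, Matrix.one_mul] at h2
  rw [eq_neg_iff_add_eq_zero, ← h2]
  abel

/-! ### Curvature -/

/-- The curvature endomorphism `(R_{∂ᵢ ∂ⱼ})ᵐₖ`. -/
noncomputable def curv (G : Coord n → Matrix (Fin n) (Fin n) ℝ) (i j : Fin n) (y : Coord n) :
    Matrix (Fin n) (Fin n) ℝ :=
  mpd i (gam G j) y - mpd j (gam G i) y + (gam G i y * gam G j y - gam G j y * gam G i y)

/-- The matrix form of the curvature turns most index computations below into identities in a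
noncommutative ring. -/
theorem riem_eq (i j k l : Fin n) : riem G i j k l y = ((curv G i j y)ᵀ * G y) k l := by
  simp only [riem, Matrix.mul_apply, Matrix.transpose_apply, curv, Matrix.add_apply,
    Matrix.sub_apply, mpd, gam, Matrix.of_apply, Finset.sum_sub_distrib]
  refine Finset.sum_congr rfl fun m _ => ?_
  simp only [mul_comm (christoffel G _ _ k y)]
  rw [mul_comm]

theorem MetricOn.smooth_curv (h : MetricOn U G) (i j : Fin n) : SmoothMat U (curv G i j) :=
  (((h.smooth_gam j).mpd h.isOpen i).sub ((h.smooth_gam i).mpd h.isOpen j)).add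
    (((h.smooth_gam i).mul (h.smooth_gam j)).sub ((h.smooth_gam j).mul (h.smooth_gam i)))

theorem MetricOn.smooth_riem (h : MetricOn U G) (i j k l : Fin n) :
    ContDiffOn ℝ ∞ (riem G i j k l) U := by
  have : riem G i j k l = fun z => ((curv G i j z)ᵀ * G z) k l := funext fun z => riem_eq i j k l
  rw [this]
  exact (h.smooth_curv i j).transpose.mul h.smooth k l

theorem curv_swap (i j : Fin n) : curv G j i y = -curv G i j y := by
  simp only [curv]
  abel

/-- Metric compatibility is differentiated once more. The symmetry of ∂ᵢ∂ⱼg then says that the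
curvature endomorphisms are skew with respect to g. -/
theorem MetricOn.curv_metric (h : MetricOn U G) (hy : y ∈ U) (i j : Fin n) :
    (curv G i j y)ᵀ * G y + G y * curv G i j y = 0 := by
  have key : ∀ a b, mpd b (mpd a G) y =
      (mpd b (gam G a) y)ᵀ * G y + (gam G a y)ᵀ * ((gam G b y)ᵀ * G y + G y * gam G b y)
      + (((gam G b y)ᵀ * G y + G y * gam G b y) * gam G a y + G y * mpd b (gam G a) y) := by
    intro a b
    rw [mpd_congr h.isOpen (H := fun z => (gam G a z)ᵀ * G z + G z * gam G a z)
      (fun z hz => h.mpd_metric hz a) hy]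
    rw [mpd_add h.isOpen ((h.smooth_gam a).transpose.mul h.smooth)
      (h.smooth.mul (h.smooth_gam a)) hy,
      mpd_mul h.isOpen (h.smooth_gam a).transpose h.smooth hy,
      mpd_mul h.isOpen h.smooth (h.smooth_gam a) hy, mpd_transpose, h.mpd_metric hy]
  have hc := mpd_comm h.isOpen h.smooth hy i j
  rw [key, key] at hc
  rw [← sub_eq_zero] at hc
  rw [← hc]
  simp only [curv, Matrix.transpose_add, Matrix.transpose_sub, Matrix.transpose_mul]
  noncomm_ring

/-- The algebraic symmetries of a curvature tensor. -/
structure IsCurvTensor (A : Fin n → Fin n → Fin n → Fin n → ℝ) : Prop where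
  swap12 : ∀ i j k l, A j i k l = -A i j k l
  swap34 : ∀ i j k l, A i j l k = -A i j k l
  bianchi : ∀ i j k l, A i j k l + A j k i l + A k i j l = 0

/-- The octahedron argument: the four cyclic identities on i, j, k, l are combined, and skewness
cancels all but the two terms of interest. -/
theorem IsCurvTensor.pair {A : Fin n → Fin n → Fin n → Fin n → ℝ} (h : IsCurvTensor A)
    (i j k l : Fin n) : A k l i j = A i j k l := by
  have b1 := h.bianchi i j k l
  have b2 := h.bianchi j k l i
  have b3 := h.bianchi k l i j
  have b4 := h.bianchi l i j k
  have := h.swap12 k l i j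
  have e1 := h.swap34 j k i l
  have e2 := h.swap34 k i j l
  have e3 := h.swap34 i j k l
  have e4 := h.swap34 k l i j
  have e5 := h.swap34 l i j k
  have e6 := h.swap34 l j k i
  have e7 := h.swap12 j l k i
  have e8 := h.swap12 l i k j
  have e9 := h.swap12 l j i k
  have e10 := h.swap34 j l i k
  have e11 := h.swap12 i k l j
  have e12 := h.swap34 i k j l
  linarith

/-- Skewness in the last pair comes from metric compatibility, the cyclic identity from the symmetry
of Γ in its lower indices. -/
theorem MetricOn.isCurvTensor_riem (h : MetricOn U G) (hy : y ∈ U) :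
    IsCurvTensor (fun i j k l => riem G i j k l y) where
  swap12 i j k l := by
    simp only [riem_eq, curv_swap i j, Matrix.transpose_neg, Matrix.neg_mul, Matrix.neg_apply]
  swap34 i j k l := by
    simp only [riem_eq]
    have h1 := h.curv_metric hy i j
    have h2 : ((curv G i j y)ᵀ * G y) l k = (G y * curv G i j y) k l := by
      rw [← Matrix.transpose_apply ((curv G i j y)ᵀ * G y), Matrix.transpose_mul, h.symm,
        Matrix.transpose_transpose]
    rw [h2, eq_neg_iff_add_eq_zero, add_comm, ← Matrix.add_apply, h1, Matrix.zero_apply]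
  bianchi i j k l := by
    have hc : ∀ m, curv G i j y m k + curv G j k y m i + curv G k i y m j = 0 := by
      intro m
      have hp : ∀ a b c, mpd a (gam G b) y m c = mpd a (gam G c) y m b := by
        intro a b c
        simp only [mpd, gam, Matrix.of_apply, h.christoffel_comm m b c]
      have hg : ∀ a b c, (gam G a y * gam G b y) m c = (gam G a y * gam G c y) m b := by
        intro a b c
        simp only [gam, Matrix.mul_apply, Matrix.of_apply, h.christoffel_comm _ b c]
      simp only [curv, Matrix.add_apply, Matrix.sub_apply]
      rw [hp i j k, hp j i k, hp k i j, hg i j k, hg j i k, hg k i j]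
      ring
    simp only [riem_eq, Matrix.mul_apply, Matrix.transpose_apply, ← Finset.sum_add_distrib,
      ← add_mul, hc, zero_mul, Finset.sum_const_zero]

/-- The second Bianchi identity for the curvature endomorphisms. -/
theorem MetricOn.bianchi_curv (h : MetricOn U G) (hy : y ∈ U) (a i j : Fin n) :
    (mpd a (curv G i j) y + (gam G a y * curv G i j y - curv G i j y * gam G a y))
    + (mpd i (curv G j a) y + (gam G i y * curv G j a y - curv G j a y * gam G i y))
    + (mpd j (curv G a i) y + (gam G j y * curv G a i y - curv G a i y * gam G j y)) = 0 := by
  -- In the cyclic sum the second derivatives of Γ cancel by symmetry. What is left is an identity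
  -- of the Jacobi type. The Christoffel terms of the form indices are absent here; they cancel
  -- separately in `MetricOn.bianchi_riem`.
  have key : ∀ a i j, mpd a (curv G i j) y = mpd a (mpd i (gam G j)) y - mpd a (mpd j (gam G i)) y
      + ((mpd a (gam G i) y * gam G j y + gam G i y * mpd a (gam G j) y)
        - (mpd a (gam G j) y * gam G i y + gam G j y * mpd a (gam G i) y)) := by
    intro a i j
    have sg := h.smooth_gam
    have so := h.isOpen
    show mpd a (fun z => (mpd i (gam G j) z - mpd j (gam G i) z)
      + (gam G i z * gam G j z - gam G j z * gam G i z)) y = _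
    rw [mpd_add so (((sg j).mpd so i).sub ((sg i).mpd so j))
      (((sg i).mul (sg j)).sub ((sg j).mul (sg i))) hy,
      mpd_sub so ((sg j).mpd so i) ((sg i).mpd so j) hy,
      mpd_sub so ((sg i).mul (sg j)) ((sg j).mul (sg i)) hy,
      mpd_mul so (sg i) (sg j) hy, mpd_mul so (sg j) (sg i) hy]
  rw [key, key, key, mpd_comm h.isOpen (h.smooth_gam j) hy a i,
    mpd_comm h.isOpen (h.smooth_gam i) hy a j, mpd_comm h.isOpen (h.smooth_gam a) hy i j]
  simp only [curv]
  noncomm_ring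

end LeviCivita

/-! ## Contractions, the Schouten tensor and the Weyl tensor -/

section Contraction

variable {n : ℕ}

/-- The contraction `∑ hⁱˡ qᵢₗ`. -/
noncomputable def contr (h q : Matrix (Fin n) (Fin n) ℝ) : ℝ := ∑ i, ∑ l, h i l * q i l

theorem contr_eq_trace (h q : Matrix (Fin n) (Fin n) ℝ) : contr h q = (h * qᵀ).trace := by
  simp [contr, Matrix.trace, Matrix.mul_apply]

theorem contr_add (h p q : Matrix (Fin n) (Fin n) ℝ) : contr h (p + q) = contr h p + contr h q := by
  simp [contr_eq_trace, Matrix.mul_add]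

theorem contr_sub (h p q : Matrix (Fin n) (Fin n) ℝ) : contr h (p - q) = contr h p - contr h q := by
  simp [contr_eq_trace, Matrix.mul_sub]

theorem contr_neg (h q : Matrix (Fin n) (Fin n) ℝ) : contr h (-q) = -contr h q := by
  simp [contr_eq_trace]

theorem contr_smul (h q : Matrix (Fin n) (Fin n) ℝ) (c : ℝ) :
    contr h (c • q) = c * contr h q := by
  simp [contr_eq_trace]

theorem contr_sum {ι : Type*} (s : Finset ι) (h : Matrix (Fin n) (Fin n) ℝ)
    (q : ι → Matrix (Fin n) (Fin n) ℝ) : contr h (∑ a ∈ s, q a) = ∑ a ∈ s, contr h (q a) := by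
  simp [contr_eq_trace, Matrix.transpose_sum, Matrix.mul_sum, Matrix.trace_sum]

theorem contr_transpose {h : Matrix (Fin n) (Fin n) ℝ} (hh : hᵀ = h)
    (q : Matrix (Fin n) (Fin n) ℝ) : contr h qᵀ = contr h q := by
  rw [contr_eq_trace, contr_eq_trace, Matrix.transpose_transpose, ← Matrix.trace_transpose,
    Matrix.transpose_mul, hh, Matrix.trace_mul_comm]

theorem contr_metric {g h : Matrix (Fin n) (Fin n) ℝ} (hs : gᵀ = g) (hg : h * g = 1) :
    contr h g = n := by
  rw [contr_eq_trace, hs, hg]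
  simp

/-- Contraction of `gᵢⱼ xₗ`. -/
theorem contr_vecMulVec_left {g h : Matrix (Fin n) (Fin n) ℝ} (hh : hᵀ = h)
    (hg : h * g = 1) (x : Fin n → ℝ) (j : Fin n) :
    contr h (Matrix.of fun i l => g i j * x l) = x j := by
  have h1 : contr h (Matrix.of fun i l => g i j * x l) = ∑ l, (h * g) l j * x l := by
    simp only [contr, Matrix.of_apply, Matrix.mul_apply, Finset.sum_mul]
    rw [Finset.sum_comm]
    refine Finset.sum_congr rfl fun l _ => Finset.sum_congr rfl fun i _ => ?_
    rw [← congrFun (congrFun hh i) l, Matrix.transpose_apply]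
    ring
  rw [h1, hg]
  simp [Matrix.one_apply]

theorem contr_vecMulVec_right {g h : Matrix (Fin n) (Fin n) ℝ} (hs : gᵀ = g) (hh : hᵀ = h)
    (hg : h * g = 1) (x : Fin n → ℝ) (j : Fin n) :
    contr h (Matrix.of fun i l => x i * g j l) = x j := by
  rw [← contr_transpose hh, ← contr_vecMulVec_left hh hg x j]
  congr 1
  ext i l
  simp only [Matrix.transpose_apply, Matrix.of_apply]
  rw [← congrFun (congrFun hs i) j, Matrix.transpose_apply]
  ring

/-- The Kulkarni-Nomizu product. -/
def kn (g q : Matrix (Fin n) (Fin n) ℝ) (i j k l : Fin n) : ℝ :=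
  g i l * q j k + g j k * q i l - g i k * q j l - g j l * q i k

theorem isCurvTensor_kn {g q : Matrix (Fin n) (Fin n) ℝ} (hg : gᵀ = g) (hq : qᵀ = q) :
    IsCurvTensor (kn g q) where
  swap12 i j k l := by simp only [kn]; ring
  swap34 i j k l := by simp only [kn]; ring
  bianchi i j k l := by
    have e : ∀ {p : Matrix (Fin n) (Fin n) ℝ}, pᵀ = p → ∀ a b, p a b = p b a :=
      fun hp a b => congrFun (congrFun hp b) a
    simp only [kn]
    rw [e hg j i, e hg k i, e hg k j, e hq j i, e hq k i, e hq k j]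
    ring

theorem contr_kn {g h q : Matrix (Fin n) (Fin n) ℝ} (hs : gᵀ = g) (hh : hᵀ = h) (hg : h * g = 1)
    (j k : Fin n) : contr h (Matrix.of fun i l => kn g q i j k l) =
      ((n : ℝ) - 2) * q j k + contr h q * g j k := by
  have h1 : (Matrix.of fun i l => kn g q i j k l) = q j k • g + g j k • q
      - (Matrix.of fun i l => g i k * q j l) - (Matrix.of fun i l => q i k * g j l) := by
    ext i l
    simp only [kn, Matrix.of_apply, Matrix.sub_apply, Matrix.add_apply, Matrix.smul_apply,
      smul_eq_mul]
    ring
  rw [h1, contr_sub, contr_sub, contr_add, contr_smul, contr_smul, contr_metric hs hg,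
    contr_vecMulVec_left hh hg (fun l => q j l), contr_vecMulVec_right hs hh hg (fun i => q i k)]
  ring

theorem IsCurvTensor.sub {A B : Fin n → Fin n → Fin n → Fin n → ℝ} (hA : IsCurvTensor A)
    (hB : IsCurvTensor B) : IsCurvTensor (fun i j k l => A i j k l - B i j k l) where
  swap12 i j k l := by rw [hA.swap12, hB.swap12]; ring
  swap34 i j k l := by rw [hA.swap34, hB.swap34]; ring
  bianchi i j k l := by linarith [hA.bianchi i j k l, hB.bianchi i j k l]

/-- A Ricci tensor of the form `(n-2) q + (tr q) g` determines `q`. -/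
theorem eq_schouten_of_ricci_eq (hn : 4 ≤ n) {g h q ric : Matrix (Fin n) (Fin n) ℝ} (hs : gᵀ = g)
    (hg : h * g = 1) (hr : ric = ((n : ℝ) - 2) • q + contr h q • g) :
    q = (1 / ((n : ℝ) - 2)) • (ric - ((1 / (2 * ((n : ℝ) - 1))) * contr h ric) • g) := by
  have hn' : (4 : ℝ) ≤ n := by exact_mod_cast hn
  have h1 : contr h ric = 2 * ((n : ℝ) - 1) * contr h q := by
    rw [hr, contr_add, contr_smul, contr_smul, contr_metric hs hg]
    ring
  have h2 : (1 / (2 * ((n : ℝ) - 1))) * contr h ric = contr h q := by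
    rw [h1]
    have : (n : ℝ) - 1 ≠ 0 := by linarith
    field_simp
  rw [h2, hr, add_sub_cancel_right, smul_smul]
  have : (n : ℝ) - 2 ≠ 0 := by linarith
  rw [one_div_mul_cancel this, one_smul]

end Contraction

/-! ### Schouten and Weyl tensors, covariant derivatives and the Bianchi identities -/

section Weyl

variable {n : ℕ} {U : Set (Coord n)} {G : Coord n → Matrix (Fin n) (Fin n) ℝ} {y : Coord n}

/-- The Ricci tensor as a matrix. -/
noncomputable def ricM (G : Coord n → Matrix (Fin n) (Fin n) ℝ) (y : Coord n) :
    Matrix (Fin n) (Fin n) ℝ := Matrix.of fun j k => ricci G j k y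

/-- The Schouten tensor as a matrix. -/
noncomputable def schM (G : Coord n → Matrix (Fin n) (Fin n) ℝ) (y : Coord n) :
    Matrix (Fin n) (Fin n) ℝ := Matrix.of fun j k => schouten G j k y

theorem ricci_eq (j k : Fin n) :
    ricci G j k y = contr (invMetric G y) (Matrix.of fun i l => riem G i j k l y) := rfl

theorem scalarCurv_eq : scalarCurv G y = contr (invMetric G y) (ricM G y) := rfl

theorem weyl_eq (i j k l : Fin n) :
    weyl G i j k l y = riem G i j k l y - kn (G y) (schM G y) i j k l := rfl

theorem schM_eq : schM G y = (1 / ((n : ℝ) - 2)) •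
    (ricM G y - ((1 / (2 * ((n : ℝ) - 1))) * contr (invMetric G y) (ricM G y)) • G y) := by
  ext i j
  simp [schM, ricM, schouten, scalarCurv_eq]

theorem smooth_contr {H F : Coord n → Matrix (Fin n) (Fin n) ℝ} (hH : SmoothMat U H)
    (hF : SmoothMat U F) : ContDiffOn ℝ ∞ (fun z => contr (H z) (F z)) U :=
  smooth_sum _ fun i => smooth_sum _ fun l => (hH i l).mul (hF i l)

theorem MetricOn.smooth_ricM (h : MetricOn U G) : SmoothMat U (ricM G) := fun j k =>
  smooth_contr (F := fun z => Matrix.of fun i l => riem G i j k l z) h.smooth_inv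
    fun i l => h.smooth_riem i j k l

theorem MetricOn.smooth_schM (h : MetricOn U G) : SmoothMat U (schM G) := by
  intro i j
  have := ((h.smooth_ricM i j).sub
    ((contDiffOn_const (c := 1 / (2 * ((n : ℝ) - 1)))).mul
      (smooth_contr h.smooth_inv h.smooth_ricM) |>.mul (h.smooth i j)))
  exact (contDiffOn_const (c := 1 / ((n : ℝ) - 2))).mul this

theorem MetricOn.smooth_kn (h : MetricOn U G) {q : Coord n → Matrix (Fin n) (Fin n) ℝ}
    (hq : SmoothMat U q) (i j k l : Fin n) :
    ContDiffOn ℝ ∞ (fun z => kn (G z) (q z) i j k l) U :=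
  ((((h.smooth i l).mul (hq j k)).add ((h.smooth j k).mul (hq i l))).sub
    ((h.smooth i k).mul (hq j l))).sub ((h.smooth j l).mul (hq i k))

theorem MetricOn.smooth_weyl (h : MetricOn U G) (i j k l : Fin n) :
    ContDiffOn ℝ ∞ (weyl G i j k l) U :=
  (h.smooth_riem i j k l).sub (h.smooth_kn h.smooth_schM i j k l)

theorem MetricOn.ricM_symm (h : MetricOn U G) (hy : y ∈ U) : (ricM G y)ᵀ = ricM G y := by
  ext j k
  simp only [Matrix.transpose_apply, ricM, Matrix.of_apply, ricci_eq]
  rw [← contr_transpose (h.inv_transpose y)]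
  congr 1
  ext i l
  have hR := h.isCurvTensor_riem hy
  have e1 := hR.pair i j k l
  have e2 := hR.swap12 l k i j
  have e3 := hR.swap34 l k j i
  simp only [Matrix.transpose_apply, Matrix.of_apply]
  linarith

theorem MetricOn.schM_symm (h : MetricOn U G) (hy : y ∈ U) : (schM G y)ᵀ = schM G y := by
  rw [schM_eq, Matrix.transpose_smul, Matrix.transpose_sub, Matrix.transpose_smul,
    h.ricM_symm hy, h.symm]

theorem MetricOn.isCurvTensor_weyl (h : MetricOn U G) (hy : y ∈ U) :
    IsCurvTensor (fun i j k l => weyl G i j k l y) :=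
  (h.isCurvTensor_riem hy).sub (isCurvTensor_kn (h.symm y) (h.schM_symm hy))

/-- The definition of 𝔨 solved for Ric, after expressing S through tr 𝔨. -/
theorem MetricOn.ricM_eq (hn : 4 ≤ n) (h : MetricOn U G) (hy : y ∈ U) :
    ricM G y = ((n : ℝ) - 2) • schM G y + contr (invMetric G y) (schM G y) • G y := by
  have hn' : (4 : ℝ) ≤ n := by exact_mod_cast hn
  have n2 : (n : ℝ) - 2 ≠ 0 := by linarith
  have n1 : (n : ℝ) - 1 ≠ 0 := by linarith
  have hk := schM_eq (G := G) (y := y)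
  have hc : contr (invMetric G y) (schM G y) =
      (1 / (2 * ((n : ℝ) - 1))) * contr (invMetric G y) (ricM G y) := by
    conv_lhs => rw [hk]
    rw [contr_smul, contr_sub, contr_smul, contr_metric (h.symm y) (h.inv_mul hy)]
    field_simp
    ring
  rw [hc, hk, smul_smul, mul_one_div_cancel n2, one_smul, sub_add_cancel]

/-- The Schouten tensor is the only tensor `q` for which `R - g ⊙ q` is trace free. -/
theorem MetricOn.eq_schM (hn : 4 ≤ n) (h : MetricOn U G) (hy : y ∈ U)
    {q : Matrix (Fin n) (Fin n) ℝ}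
    (hq : ∀ j k, contr (invMetric G y)
      (Matrix.of fun i l => riem G i j k l y - kn (G y) q i j k l) = 0) :
    q = schM G y := by
  rw [schM_eq]
  apply eq_schouten_of_ricci_eq hn (h.symm y) (h.inv_mul hy)
  ext j k
  have h1 := hq j k
  have h2 : (Matrix.of fun i l => riem G i j k l y - kn (G y) q i j k l) =
      (Matrix.of fun i l => riem G i j k l y) - Matrix.of fun i l => kn (G y) q i j k l := rfl
  rw [h2, contr_sub, contr_kn (h.symm y) (h.inv_transpose y) (h.inv_mul hy), ← ricci_eq] at h1
  simp only [ricM, Matrix.of_apply, Matrix.add_apply, Matrix.smul_apply, smul_eq_mul]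
  linarith

theorem MetricOn.contr_weyl (hn : 4 ≤ n) (h : MetricOn U G) (hy : y ∈ U) (j k : Fin n) :
    contr (invMetric G y) (Matrix.of fun i l => weyl G i j k l y) = 0 := by
  have h2 : (Matrix.of fun i l => weyl G i j k l y) = (Matrix.of fun i l => riem G i j k l y) -
      Matrix.of fun i l => kn (G y) (schM G y) i j k l := rfl
  rw [h2, contr_sub, contr_kn (h.symm y) (h.inv_transpose y) (h.inv_mul hy), ← ricci_eq]
  have := congrFun (congrFun (h.ricM_eq hn hy) j) k
  simp only [ricM, Matrix.of_apply, Matrix.add_apply, Matrix.smul_apply, smul_eq_mul] at this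
  linarith

/-! ### Covariant derivatives -/

/-- The covariant derivative of a `(0,2)` tensor field given by a matrix. -/
noncomputable def cov2 (G B : Coord n → Matrix (Fin n) (Fin n) ℝ) (a : Fin n) (y : Coord n) :
    Matrix (Fin n) (Fin n) ℝ :=
  mpd a B y - ((gam G a y)ᵀ * B y + B y * gam G a y)

theorem covDeriv2_eq (B : Coord n → Matrix (Fin n) (Fin n) ℝ) (a i j : Fin n) :
    covDeriv2 G (fun i j z => B z i j) a i j y = cov2 G B a y i j := by
  simp only [covDeriv2, cov2, Matrix.sub_apply, Matrix.add_apply, Matrix.mul_apply,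
    Matrix.transpose_apply, Finset.sum_add_distrib, mpd, gam, Matrix.of_apply,
    mul_comm (B y i _)]

theorem dSchouten_eq (i j k : Fin n) :
    dSchouten G i j k y = cov2 G (schM G) i y j k - cov2 G (schM G) j y i k := by
  rw [← covDeriv2_eq, ← covDeriv2_eq]
  rfl

theorem MetricOn.cov2_smul_metric (h : MetricOn U G) (hy : y ∈ U) {f : Coord n → ℝ}
    (hf : ContDiffOn ℝ ∞ f U) (a : Fin n) : cov2 G (fun z => f z • G z) a y = pd a f y • G y := by
  rw [cov2, mpd_smul h.isOpen hf h.smooth hy, h.mpd_metric hy]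
  simp only [Matrix.mul_smul, Matrix.smul_mul, smul_add]
  abel

/-- Contraction commutes with covariant differentiation. -/
theorem MetricOn.pd_contr (h : MetricOn U G) (hy : y ∈ U)
    {B : Coord n → Matrix (Fin n) (Fin n) ℝ} (hB : SmoothMat U B) (a : Fin n) :
    pd a (fun z => contr (invMetric G z) (B z)) y = contr (invMetric G y) (cov2 G B a y) := by
  have h1 : pd a (fun z => contr (invMetric G z) (B z)) y =
      (mpd a (fun z => invMetric G z * (B z)ᵀ) y).trace := by
    have : (fun z => contr (invMetric G z) (B z)) =
        fun z => ∑ i, (invMetric G z * (B z)ᵀ) i i := by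
      funext z
      rw [contr_eq_trace]
      rfl
    rw [this, pd_sum h.isOpen _ (fun i _ => h.smooth_inv.mul hB.transpose i i) hy]
    rfl
  rw [h1, mpd_mul h.isOpen h.smooth_inv hB.transpose hy, mpd_transpose, h.mpd_inv hy,
    contr_eq_trace, cov2]
  simp only [Matrix.transpose_sub, Matrix.transpose_add, Matrix.transpose_mul,
    Matrix.transpose_transpose, Matrix.mul_sub, Matrix.mul_add, Matrix.add_mul, Matrix.neg_mul,
    Matrix.trace_add, Matrix.trace_sub, Matrix.trace_neg, Matrix.mul_assoc]
  rw [Matrix.trace_mul_comm (gam G a y), Matrix.mul_assoc]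
  ring

/-- Since g is parallel, the last two slots contribute the commutator of Γ with the curvature
endomorphism. Only the corrections in the form slots i, j stay explicit. -/
theorem MetricOn.covDeriv4_riem (h : MetricOn U G) (hy : y ∈ U) (a i j k l : Fin n) :
    covDeriv4 G (riem G) a i j k l y =
      ((mpd a (curv G i j) y
        + (gam G a y * curv G i j y - curv G i j y * gam G a y))ᵀ * G y) k l
      - ∑ m, (christoffel G m a i y * riem G m j k l y
        + christoffel G m a j y * riem G i m k l y) := by
  have h1 : pd a (riem G i j k l) y = mpd a (fun z => (curv G i j z)ᵀ * G z) y k l := by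
    simp only [mpd, Matrix.of_apply, ← riem_eq]
  have h2 : ∑ m, (christoffel G m a k y * riem G i j m l y) =
      ((gam G a y)ᵀ * ((curv G i j y)ᵀ * G y)) k l := by
    simp only [Matrix.mul_apply (M := (gam G a y)ᵀ), ← riem_eq]
    rfl
  have h3 : ∑ m, (christoffel G m a l y * riem G i j k m y) =
      (((curv G i j y)ᵀ * G y) * gam G a y) k l := by
    simp only [Matrix.mul_apply (N := gam G a y), ← riem_eq]
    exact Finset.sum_congr rfl fun m _ => mul_comm _ _
  rw [covDeriv4, h1, mpd_mul h.isOpen (h.smooth_curv i j).transpose h.smooth hy,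
    mpd_transpose, h.mpd_metric hy]
  simp only [Finset.sum_add_distrib, h2, h3]
  simp only [Matrix.transpose_add, Matrix.transpose_sub, Matrix.transpose_mul, Matrix.add_mul,
    Matrix.sub_mul, Matrix.mul_add, Matrix.add_apply, Matrix.sub_apply, Matrix.mul_assoc]
  ring

/-- The second Bianchi identity. -/
theorem MetricOn.bianchi_riem (h : MetricOn U G) (hy : y ∈ U) (a i j k l : Fin n) :
    covDeriv4 G (riem G) a i j k l y + covDeriv4 G (riem G) i j a k l y
      + covDeriv4 G (riem G) j a i k l y = 0 := by
  rw [h.covDeriv4_riem hy, h.covDeriv4_riem hy, h.covDeriv4_riem hy]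
  have hR := h.isCurvTensor_riem hy
  -- The corrections in the form slots cancel in the cyclic sum because the connection has no
  -- torsion.
  have e : ∑ m, (christoffel G m a i y * riem G m j k l y
        + christoffel G m a j y * riem G i m k l y)
      + ∑ m, (christoffel G m i j y * riem G m a k l y
        + christoffel G m i a y * riem G j m k l y)
      + ∑ m, (christoffel G m j a y * riem G m i k l y
        + christoffel G m j i y * riem G a m k l y) = 0 := by
    rw [← Finset.sum_add_distrib, ← Finset.sum_add_distrib]
    refine Finset.sum_eq_zero fun m _ => ?_
    have e1 := hR.swap12 m j k l
    have e2 := hR.swap12 m a k l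
    have e3 := hR.swap12 m i k l
    rw [h.christoffel_comm m i a, h.christoffel_comm m j a, h.christoffel_comm m j i, e1, e2, e3]
    ring
  have b := congrArg (fun X => (Xᵀ * G y) k l) (h.bianchi_curv hy a i j)
  simp only [Matrix.transpose_add, Matrix.add_mul, Matrix.add_apply, Matrix.transpose_zero,
    Matrix.zero_mul, Matrix.zero_apply] at b
  simp only [Matrix.transpose_add, Matrix.add_mul, Matrix.add_apply]
  linarith

theorem MetricOn.covDeriv4_riem_swap12 (h : MetricOn U G) (hy : y ∈ U) (a i j k l : Fin n) :
    covDeriv4 G (riem G) a j i k l y = -covDeriv4 G (riem G) a i j k l y := by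
  have s : ∀ z ∈ U, ∀ i j k l, riem G j i k l z = -riem G i j k l z :=
    fun z hz => (h.isCurvTensor_riem hz).swap12
  have e : ∑ m, (christoffel G m a j y * riem G m i k l y + christoffel G m a i y * riem G j m k l y
      + christoffel G m a k y * riem G j i m l y + christoffel G m a l y * riem G j i k m y) =
      -∑ m, (christoffel G m a i y * riem G m j k l y + christoffel G m a j y * riem G i m k l y
      + christoffel G m a k y * riem G i j m l y + christoffel G m a l y * riem G i j k m y) := by
    rw [← Finset.sum_neg_distrib]
    refine Finset.sum_congr rfl fun m _ => ?_
    rw [s y hy i m k l, s y hy m j k l, s y hy i j m l, s y hy i j k m]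
    ring
  rw [covDeriv4, covDeriv4, pd_congr h.isOpen (fun z hz => s z hz i j k l) hy, pd_neg, e]
  ring

theorem MetricOn.covDeriv4_riem_swap34 (h : MetricOn U G) (hy : y ∈ U) (a i j k l : Fin n) :
    covDeriv4 G (riem G) a i j l k y = -covDeriv4 G (riem G) a i j k l y := by
  have s : ∀ z ∈ U, ∀ i j k l, riem G i j l k z = -riem G i j k l z :=
    fun z hz => (h.isCurvTensor_riem hz).swap34
  have e : ∑ m, (christoffel G m a i y * riem G m j l k y + christoffel G m a j y * riem G i m l k y
      + christoffel G m a l y * riem G i j m k y + christoffel G m a k y * riem G i j l m y) =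
      -∑ m, (christoffel G m a i y * riem G m j k l y + christoffel G m a j y * riem G i m k l y
      + christoffel G m a k y * riem G i j m l y + christoffel G m a l y * riem G i j k m y) := by
    rw [← Finset.sum_neg_distrib]
    refine Finset.sum_congr rfl fun m _ => ?_
    rw [s y hy m j k l, s y hy i m k l, s y hy i j k m, s y hy i j m l]
    ring
  rw [covDeriv4, covDeriv4, pd_congr h.isOpen (fun z hz => s z hz i j k l) hy, pd_neg, e]
  ring

theorem MetricOn.cov2_ricM (h : MetricOn U G) (hy : y ∈ U) (a j k : Fin n) :
    cov2 G (ricM G) a y j k =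
      contr (invMetric G y) (Matrix.of fun i l => covDeriv4 G (riem G) a i j k l y) := by
  have h1 : pd a (fun z => ricM G z j k) y =
      contr (invMetric G y) (cov2 G (fun z => Matrix.of fun i l => riem G i j k l z) a y) :=
    h.pd_contr hy (B := fun z => Matrix.of fun i l => riem G i j k l z)
      (fun i l => h.smooth_riem i j k l) a
  rw [← covDeriv2_eq, covDeriv2, h1]
  have h2 : ∀ m, christoffel G m a j y * ricM G y m k + christoffel G m a k y * ricM G y j m =
      contr (invMetric G y) (Matrix.of fun i l => christoffel G m a j y * riem G i m k l y
        + christoffel G m a k y * riem G i j m l y) := by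
    intro m
    simp only [ricM, Matrix.of_apply, ricci_eq]
    rw [← contr_smul, ← contr_smul, ← contr_add]
    rfl
  simp only [h2]
  rw [← contr_sum, ← contr_sub]
  congr 1
  ext i l
  rw [Matrix.sub_apply, ← covDeriv2_eq]
  simp only [covDeriv2, covDeriv4, Matrix.of_apply, Matrix.sum_apply, sub_sub,
    ← Finset.sum_add_distrib]
  congr 1
  exact Finset.sum_congr rfl fun m _ => by ring

/-- The contracted second Bianchi identity `δR = d^∇ Ric`. -/
theorem MetricOn.div_riem (h : MetricOn U G) (hy : y ∈ U) (i j k : Fin n) :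
    contr (invMetric G y) (Matrix.of fun a l => covDeriv4 G (riem G) a i j k l y) =
      cov2 G (ricM G) i y j k - cov2 G (ricM G) j y i k := by
  rw [h.cov2_ricM hy, h.cov2_ricM hy, ← contr_sub]
  congr 1
  ext a l
  have b := h.bianchi_riem hy a i j k l
  have s := h.covDeriv4_riem_swap12 hy i a j k l
  simp only [Matrix.of_apply, Matrix.sub_apply]
  linarith

/-- The twice contracted second Bianchi identity. -/
theorem MetricOn.div_ricM (h : MetricOn U G) (hy : y ∈ U) (i : Fin n) :
    2 * contr (invMetric G y) (Matrix.of fun a l => cov2 G (ricM G) a y i l) =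
      pd i (scalarCurv G) y := by
  have e1 : pd i (scalarCurv G) y = contr (invMetric G y) (cov2 G (ricM G) i y) :=
    h.pd_contr hy h.smooth_ricM i
  -- The double trace of ∇R is evaluated in both orders: tracing j, k first gives the divergence of
  -- Ric (`e2`), tracing a, l first gives dS minus that divergence (`e3`).
  have e2 : contr (invMetric G y) (Matrix.of fun j k => contr (invMetric G y)
      (Matrix.of fun a l => covDeriv4 G (riem G) a i j k l y)) =
      contr (invMetric G y) (Matrix.of fun a l => cov2 G (ricM G) a y i l) := by
    have : ∀ a l, cov2 G (ricM G) a y i l = contr (invMetric G y)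
        (Matrix.of fun j k => covDeriv4 G (riem G) a i j k l y) := by
      intro a l
      rw [h.cov2_ricM hy]
      congr 1
      ext j k
      simp only [Matrix.of_apply]
      rw [h.covDeriv4_riem_swap12 hy, h.covDeriv4_riem_swap34 hy, neg_neg]
    simp only [this, contr, Matrix.of_apply, Finset.mul_sum]
    rw [Finset.sum_comm]
    have sw : ∀ F : Fin n → Fin n → Fin n → Fin n → ℝ,
        ∑ k, ∑ j, ∑ a, ∑ l, F j k a l = ∑ a, ∑ l, ∑ j, ∑ k, F j k a l := by
      intro F
      rw [Finset.sum_comm]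
      calc ∑ j, ∑ k, ∑ a, ∑ l, F j k a l = ∑ j, ∑ a, ∑ k, ∑ l, F j k a l :=
            Finset.sum_congr rfl fun j _ => Finset.sum_comm
        _ = ∑ a, ∑ j, ∑ l, ∑ k, F j k a l := by
            rw [Finset.sum_comm]
            exact Finset.sum_congr rfl fun a _ => Finset.sum_congr rfl fun j _ => Finset.sum_comm
        _ = _ := Finset.sum_congr rfl fun a _ => Finset.sum_comm
    rw [sw]
    refine Finset.sum_congr rfl fun a _ => Finset.sum_congr rfl fun l _ =>
      Finset.sum_congr rfl fun j _ => Finset.sum_congr rfl fun k _ => by ring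
  have e3 : contr (invMetric G y) (Matrix.of fun j k => contr (invMetric G y)
      (Matrix.of fun a l => covDeriv4 G (riem G) a i j k l y)) =
      contr (invMetric G y) (cov2 G (ricM G) i y)
      - contr (invMetric G y) (Matrix.of fun a l => cov2 G (ricM G) a y i l) := by
    rw [← contr_sub]
    congr 1
    ext j k
    simp only [Matrix.of_apply, Matrix.sub_apply, h.div_riem hy]
  rw [e1]
  linarith

/-- The metric is parallel, so differentiating g ⊙ 𝔨 only differentiates 𝔨. -/
theorem MetricOn.covDeriv4_weyl (h : MetricOn U G) (hy : y ∈ U) (a i j k l : Fin n) :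
    covDeriv4 G (weyl G) a i j k l y =
      covDeriv4 G (riem G) a i j k l y - kn (G y) (cov2 G (schM G) a y) i j k l := by
  have hp : ∀ i j, pd a (fun z => G z i j) y =
      ∑ m, (christoffel G m a i y * G y m j + christoffel G m a j y * G y i m) := by
    intro i j
    have := congrFun (congrFun (h.mpd_metric hy a) i) j
    simp only [Matrix.add_apply, Matrix.mul_apply, ← Finset.sum_add_distrib] at this
    refine this.trans (Finset.sum_congr rfl fun m _ => ?_)
    simp only [Matrix.transpose_apply, gam, Matrix.of_apply]
    ring
  have hk : ∀ i j, pd a (fun z => schM G z i j) y = cov2 G (schM G) a y i j +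
      ∑ m, (christoffel G m a i y * schM G y m j + christoffel G m a j y * schM G y i m) := by
    intro i j
    rw [← covDeriv2_eq, covDeriv2]
    ring
  have hm : ∀ i j k l, pd a (fun z => G z i j * schM G z k l) y =
      pd a (fun z => G z i j) y * schM G y k l + G y i j * pd a (fun z => schM G z k l) y :=
    fun i j k l => pd_mul h.isOpen (h.smooth i j) (h.smooth_schM k l) hy a
  have hs : ∀ i j k l, ContDiffOn ℝ ∞ (fun z => G z i j * schM G z k l) U :=
    fun i j k l => (h.smooth i j).mul (h.smooth_schM k l)
  have hw : pd a (weyl G i j k l) y = pd a (riem G i j k l) y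
      - pd a (fun z => kn (G z) (schM G z) i j k l) y :=
    pd_sub h.isOpen (h.smooth_riem i j k l) (h.smooth_kn h.smooth_schM i j k l) hy a
  have hkn : pd a (fun z => kn (G z) (schM G z) i j k l) y =
      kn (G y) (cov2 G (schM G) a y) i j k l +
      ∑ m, (christoffel G m a i y * kn (G y) (schM G y) m j k l
        + christoffel G m a j y * kn (G y) (schM G y) i m k l
        + christoffel G m a k y * kn (G y) (schM G y) i j m l
        + christoffel G m a l y * kn (G y) (schM G y) i j k m) := by
    simp only [kn]
    rw [pd_sub h.isOpen (((hs _ _ _ _).add (hs _ _ _ _)).sub (hs _ _ _ _)) (hs _ _ _ _) hy,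
      pd_sub h.isOpen ((hs _ _ _ _).add (hs _ _ _ _)) (hs _ _ _ _) hy,
      pd_add h.isOpen (hs _ _ _ _) (hs _ _ _ _) hy, hm, hm, hm, hm]
    simp only [hk, hp, mul_add, Finset.sum_mul]
    -- This separates the four terms of g ⊙ ∇𝔨 from the eight Christoffel sums, which are then
    -- compared summand by summand.
    have : ∀ A B C D X Y : ℝ, ∀ s1 s2 s3 s4 s5 s6 s7 s8 S : ℝ,
        s1 + s2 + s3 + s4 - s5 - s6 - s7 - s8 = S →
        s1 + (A + s2) + (s3 + (B + s4)) - (s5 + (C + s6)) - (s7 + (D + s8))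
          = A + B - C - D + S := by
      intros
      linarith
    apply this _ _ _ _ 0 0
    simp only [Finset.mul_sum, ← Finset.sum_add_distrib, ← Finset.sum_sub_distrib]
    exact Finset.sum_congr rfl fun m _ => by ring
  have hW : ∑ m, (christoffel G m a i y * weyl G m j k l y + christoffel G m a j y * weyl G i m k l y
      + christoffel G m a k y * weyl G i j m l y + christoffel G m a l y * weyl G i j k m y) =
      ∑ m, (christoffel G m a i y * riem G m j k l y + christoffel G m a j y * riem G i m k l y
      + christoffel G m a k y * riem G i j m l y + christoffel G m a l y * riem G i j k m y)
      - ∑ m, (christoffel G m a i y * kn (G y) (schM G y) m j k l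
        + christoffel G m a j y * kn (G y) (schM G y) i m k l
        + christoffel G m a k y * kn (G y) (schM G y) i j m l
        + christoffel G m a l y * kn (G y) (schM G y) i j k m) := by
    rw [← Finset.sum_sub_distrib]
    refine Finset.sum_congr rfl fun m _ => ?_
    simp only [weyl_eq]
    ring
  rw [covDeriv4, hw, hkn, covDeriv4, hW]
  ring

/-- `∇ 𝔨` in terms of `∇ Ric` and `dS`. -/
theorem MetricOn.cov2_schM (h : MetricOn U G) (hy : y ∈ U) (a : Fin n) :
    cov2 G (schM G) a y = (1 / ((n : ℝ) - 2)) • (cov2 G (ricM G) a y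
      - ((1 / (2 * ((n : ℝ) - 1))) * pd a (scalarCurv G) y) • G y) := by
  have hS : ContDiffOn ℝ ∞ (scalarCurv G) U := smooth_contr h.smooth_inv h.smooth_ricM
  have hS' : ContDiffOn ℝ ∞ (fun z => (1 / (2 * ((n : ℝ) - 1))) * scalarCurv G z) U :=
    contDiffOn_const.mul hS
  have h1 : schM G = fun z => (1 / ((n : ℝ) - 2)) •
      (ricM G z - ((1 / (2 * ((n : ℝ) - 1))) * scalarCurv G z) • G z) := funext fun z => schM_eq
  have h2 := h.cov2_smul_metric hy hS' a
  rw [pd_const_mul h.isOpen _ hS hy, cov2] at h2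
  rw [h1, cov2, mpd_smul h.isOpen contDiffOn_const (h.smooth_ricM.sub (h.smooth.smul hS')) hy,
    pd_const, mpd_sub h.isOpen h.smooth_ricM (h.smooth.smul hS') hy, ← h2, cov2]
  simp only [Matrix.mul_smul, Matrix.smul_mul, zero_smul, zero_add, Matrix.mul_sub, Matrix.sub_mul]
  module

/-- `tr_g` of the divergence: `∇ˡ 𝔨ᵢₗ = ∂ᵢ tr 𝔨`. -/
theorem MetricOn.div_schM (hn : 4 ≤ n) (h : MetricOn U G) (hy : y ∈ U) (i : Fin n) :
    contr (invMetric G y) (Matrix.of fun a l => cov2 G (schM G) a y i l) =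
      contr (invMetric G y) (cov2 G (schM G) i y) := by
  have hn' : (4 : ℝ) ≤ n := by exact_mod_cast hn
  have n2 : (n : ℝ) - 2 ≠ 0 := by linarith
  have n1 : (n : ℝ) - 1 ≠ 0 := by linarith
  set c := 1 / (2 * ((n : ℝ) - 1)) with hc
  have e1 : pd i (scalarCurv G) y = contr (invMetric G y) (cov2 G (ricM G) i y) :=
    h.pd_contr hy h.smooth_ricM i
  have e2 := h.div_ricM hy i
  have e3 : (Matrix.of fun a l => cov2 G (schM G) a y i l) =
      (1 / ((n : ℝ) - 2)) • ((Matrix.of fun a l => cov2 G (ricM G) a y i l)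
        - c • Matrix.of fun a l => pd a (scalarCurv G) y * G y i l) := by
    ext a l
    rw [Matrix.of_apply, h.cov2_schM hy]
    simp only [Matrix.smul_apply, Matrix.sub_apply, Matrix.of_apply, smul_eq_mul, ← hc]
    ring
  rw [e3, h.cov2_schM hy, contr_smul, contr_smul, contr_sub, contr_sub, contr_smul, contr_smul,
    contr_vecMulVec_right (h.symm y) (h.inv_transpose y) (h.inv_mul hy)
      (fun a => pd a (scalarCurv G) y), contr_metric (h.symm y) (h.inv_mul hy), ← e1]
  have e4 : contr (invMetric G y) (Matrix.of fun a l => cov2 G (ricM G) a y i l) =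
      (1 / 2) * pd i (scalarCurv G) y := by linarith
  rw [e4, ← hc]
  congr 1
  rw [hc]
  field_simp
  ring

/-- The divergence of the Weyl tensor is `(n - 3) d^∇ 𝔨`. -/
theorem MetricOn.divWeyl_eq (hn : 4 ≤ n) (h : MetricOn U G) (hy : y ∈ U) (i j k : Fin n) :
    divWeyl G i j k y = ((n : ℝ) - 3) * dSchouten G i j k y := by
  have hn' : (4 : ℝ) ≤ n := by exact_mod_cast hn
  have n2 : (n : ℝ) - 2 ≠ 0 := by linarith
  set K := fun a => cov2 G (schM G) a y with hK
  have e1 : divWeyl G i j k y = contr (invMetric G y)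
      ((Matrix.of fun a l => covDeriv4 G (riem G) a i j k l y)
        - Matrix.of fun a l => kn (G y) (K a) i j k l) := by
    simp only [divWeyl, contr, h.covDeriv4_weyl hy]
    rfl
  have e2 : (Matrix.of fun a l => kn (G y) (K a) i j k l) =
      (Matrix.of fun a l => K a j k * G y i l) + G y j k • (Matrix.of fun a l => K a i l)
      - G y i k • (Matrix.of fun a l => K a j l) - Matrix.of fun a l => K a i k * G y j l := by
    ext a l
    simp only [kn, Matrix.of_apply, Matrix.sub_apply, Matrix.add_apply, Matrix.smul_apply,
      smul_eq_mul]
    ring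
  have hs := h.symm y
  have ht := h.inv_transpose y
  have hi := h.inv_mul hy
  -- The covariant derivative of Ric = (n-2)𝔨 + (tr 𝔨)g. In the final sum, δR contributes n-2 copies
  -- of d^∇𝔨 and g ⊙ ∇𝔨 removes one; the trace terms cancel against div 𝔨 = d(tr 𝔨).
  have e3 : ∀ a j k, cov2 G (ricM G) a y j k = ((n : ℝ) - 2) * K a j k
      + contr (invMetric G y) (K a) * G y j k := by
    intro a j k
    have c1 := h.cov2_schM hy a
    have := congrFun (congrFun (eq_schouten_of_ricci_eq (ric := ((n : ℝ) - 2) • K a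
      + contr (invMetric G y) (K a) • G y) hn hs hi rfl) j) k
    have n1 : (n : ℝ) - 1 ≠ 0 := by linarith
    have c2 : contr (invMetric G y) (K a) =
        (1 / (2 * ((n : ℝ) - 1))) * pd a (scalarCurv G) y := by
      have e1 : pd a (scalarCurv G) y = contr (invMetric G y) (cov2 G (ricM G) a y) :=
        h.pd_contr hy h.smooth_ricM a
      rw [hK]
      simp only
      rw [c1, contr_smul, contr_sub, contr_smul, contr_metric hs hi, ← e1]
      field_simp
      ring
    rw [c2]
    have c3 := congrFun (congrFun c1 j) k
    simp only [Matrix.smul_apply, Matrix.sub_apply, smul_eq_mul] at c3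
    simp only [hK]
    rw [c3]
    field_simp
    ring
  rw [e1, contr_sub, h.div_riem hy, e2, contr_sub, contr_sub, contr_add, contr_smul, contr_smul,
    contr_vecMulVec_right hs ht hi (fun a => K a j k),
    contr_vecMulVec_right hs ht hi (fun a => K a i k), h.div_schM hn hy, h.div_schM hn hy,
    e3, e3, dSchouten_eq]
  simp only [hK]
  ring

end Weyl

/-! ## Conformal change of the metric -/

section Conformal

variable {n : ℕ} {U : Set (Coord n)} {G G' : Coord n → Matrix (Fin n) (Fin n) ℝ}
  {f : Coord n → ℝ} {y : Coord n}

/-- The components of the gradient of `f`. -/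
noncomputable def gradComp (G : Coord n → Matrix (Fin n) (Fin n) ℝ) (f : Coord n → ℝ)
    (y : Coord n) : Fin n → ℝ :=
  invMetric G y *ᵥ fun i => pd i f y

/-- The squared norm of the gradient of `f`. -/
noncomputable def gradSq (G : Coord n → Matrix (Fin n) (Fin n) ℝ) (f : Coord n → ℝ)
    (y : Coord n) : ℝ :=
  contr (invMetric G y) (Matrix.of fun i j => pd i f y * pd j f y)

/-- The Hessian `∇df`. -/
noncomputable def hess (G : Coord n → Matrix (Fin n) (Fin n) ℝ) (f : Coord n → ℝ) (y : Coord n) :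
    Matrix (Fin n) (Fin n) ℝ :=
  Matrix.of fun i j => pd i (pd j f) y - ∑ m, christoffel G m i j y * pd m f y

/-- The change of the Schouten tensor under `g ↦ exp(2f) g`. -/
noncomputable def schChange (G : Coord n → Matrix (Fin n) (Fin n) ℝ) (f : Coord n → ℝ)
    (y : Coord n) : Matrix (Fin n) (Fin n) ℝ :=
  (Matrix.of fun i j => pd i f y * pd j f y) - hess G f y - ((1 / 2) * gradSq G f y) • G y

/-- The change of the connection matrices under `g ↦ exp(2f) g`. -/
noncomputable def gamChange (G : Coord n → Matrix (Fin n) (Fin n) ℝ) (f : Coord n → ℝ) (a : Fin n)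
    (y : Coord n) : Matrix (Fin n) (Fin n) ℝ :=
  Matrix.of fun m k => (if m = k then pd a f y else 0) + (if m = a then pd k f y else 0)
    - gradComp G f y m * G y a k

theorem sum_mul_gamChange (p : Fin n → ℝ) (a k : Fin n) :
    ∑ m, p m * gamChange G f a y m k = p k * pd a f y + p a * pd k f y
      - (∑ m, p m * gradComp G f y m) * G y a k := by
  simp only [gamChange, Matrix.of_apply, mul_sub, mul_add, Finset.sum_sub_distrib,
    Finset.sum_add_distrib, mul_ite, mul_zero, Finset.sum_ite_eq', Finset.mem_univ, if_true,
    Finset.sum_mul, mul_assoc]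

theorem MetricOn.metric_mul_gradComp (h : MetricOn U G) (hy : y ∈ U) (i : Fin n) :
    ∑ m, G y i m * gradComp G f y m = pd i f y := by
  have : G y *ᵥ gradComp G f y = fun i => pd i f y := by
    rw [gradComp, Matrix.mulVec_mulVec, h.mul_inv hy, Matrix.one_mulVec]
  exact congrFun this i

theorem contr_vecMulVec_inv (p : Fin n → ℝ) :
    contr (invMetric G y) (Matrix.of fun i j => p i * pd j f y) =
      ∑ m, p m * gradComp G f y m := by
  simp only [contr, gradComp, Matrix.mulVec, dotProduct, Matrix.of_apply, Finset.mul_sum]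
  exact Finset.sum_congr rfl fun i _ => Finset.sum_congr rfl fun j _ => by ring

theorem gradSq_eq : gradSq G f y = ∑ m, pd m f y * gradComp G f y m :=
  contr_vecMulVec_inv fun i => pd i f y

theorem MetricOn.metric_mul_gamChange (h : MetricOn U G) (hy : y ∈ U) (a l k : Fin n) :
    (G y * gamChange G f a y) l k =
      G y l k * pd a f y + G y l a * pd k f y - pd l f y * G y a k := by
  rw [Matrix.mul_apply, sum_mul_gamChange, h.metric_mul_gradComp hy]

/-- By uniqueness of the Levi-Civita connection it is enough that the changed connection is
symmetric and compatible with exp(2f) g. -/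
theorem MetricOn.gam_conformal (h : MetricOn U G) (h' : MetricOn U G') (hf : ContDiffOn ℝ ∞ f U)
    (hG : ∀ z ∈ U, G' z = Real.exp (2 * f z) • G z) (hy : y ∈ U) (a : Fin n) :
    gam G' a y = gam G a y + gamChange G f a y := by
  symm
  refine h'.gam_unique hy (C := fun a => gam G a y + gamChange G f a y) ?_ ?_ a
  · intro a m k
    simp only [Matrix.add_apply, gam, gamChange, Matrix.of_apply, h.christoffel_comm m a k,
      h.apply_comm y a k]
    ring
  · intro a
    have hE : ContDiffOn ℝ ∞ (fun z => Real.exp (2 * f z)) U :=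
      Real.contDiff_exp.comp_contDiffOn (contDiffOn_const.mul hf)
    have hpE : pd a (fun z => Real.exp (2 * f z)) y = Real.exp (2 * f y) * (2 * pd a f y) := by
      have hd := (differentiableAt_of_smooth h.isOpen hf hy).hasFDerivAt
      have := (hd.const_mul 2).exp
      simp only [pd]
      rw [this.fderiv]
      simp
    rw [mpd_congr h.isOpen hG hy, mpd_smul h.isOpen hE h.smooth hy, hpE, h.mpd_metric hy, hG y hy]
    have h1 : (gam G a y + gamChange G f a y)ᵀ * G y = (G y * (gam G a y + gamChange G f a y))ᵀ := by
      rw [Matrix.transpose_mul, h.symm]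
    have h2 : (gam G a y)ᵀ * G y = (G y * gam G a y)ᵀ := by
      rw [Matrix.transpose_mul, h.symm]
    rw [Matrix.mul_smul, Matrix.smul_mul, h1, h2, Matrix.mul_add]
    ext i j
    simp only [Matrix.add_apply, Matrix.smul_apply, Matrix.transpose_apply, smul_eq_mul,
      h.metric_mul_gamChange hy, h.apply_comm y j i, h.apply_comm y j a, h.apply_comm y i a]
    ring

theorem MetricOn.smooth_gradComp (h : MetricOn U G) (hf : ContDiffOn ℝ ∞ f U) (m : Fin n) :
    ContDiffOn ℝ ∞ (fun z => gradComp G f z m) U := by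
  simp only [gradComp, Matrix.mulVec, dotProduct]
  exact smooth_sum _ fun j => (h.smooth_inv m j).mul (smooth_pd h.isOpen hf j)

theorem MetricOn.smooth_gamChange (h : MetricOn U G) (hf : ContDiffOn ℝ ∞ f U) (a : Fin n) :
    SmoothMat U (gamChange G f a) := by
  intro m k
  refine ContDiffOn.sub (ContDiffOn.add ?_ ?_) ((h.smooth_gradComp hf m).mul (h.smooth a k))
  · by_cases hm : m = k
    · simpa only [hm, if_true] using smooth_pd h.isOpen hf a
    · simpa only [hm, if_false] using contDiffOn_const
  · by_cases hm : m = a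
    · simpa only [hm, if_true] using smooth_pd h.isOpen hf k
    · simpa only [hm, if_false] using contDiffOn_const

/-- Lowering an index commutes with ∇, so the derivative of the difference endomorphism can be
computed on the (0,2) tensor g·A, where A denotes `gamChange`; its entries are linear in df. -/
theorem MetricOn.metric_mul_curvChange (h : MetricOn U G) (hf : ContDiffOn ℝ ∞ f U) (hy : y ∈ U)
    (i j : Fin n) :
    G y * (mpd i (gamChange G f j) y + (gam G i y * gamChange G f j y
      - gamChange G f j y * gam G i y)) = cov2 G (fun z => G z * gamChange G f j z) i y := by
  rw [cov2, mpd_mul h.isOpen h.smooth (h.smooth_gamChange hf j) hy, h.mpd_metric hy]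
  noncomm_ring

/-- The direction j is held fixed and not differentiated covariantly. The Christoffel terms that
remain for this reason are symmetric in i, j and disappear from the curvature. -/
theorem MetricOn.cov2_gamChange (h : MetricOn U G) (hf : ContDiffOn ℝ ∞ f U) (hy : y ∈ U)
    (i j l k : Fin n) :
    cov2 G (fun z => G z * gamChange G f j z) i y l k =
      pd i (pd j f) y * G y l k + (G y * gam G i y) l j * pd k f y + G y l j * hess G f y i k
      - hess G f y i l * G y j k - pd l f y * (G y * gam G i y) k j := by
  have so := h.isOpen
  have hp : ∀ k, ContDiffOn ℝ ∞ (pd k f) U := smooth_pd so hf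
  have hm : pd i (fun z => (G z * gamChange G f j z) l k) y =
      (pd i (fun z => G z l k) y * pd j f y + G y l k * pd i (pd j f) y)
      + (pd i (fun z => G z l j) y * pd k f y + G y l j * pd i (pd k f) y)
      - (pd i (pd l f) y * G y j k + pd l f y * pd i (fun z => G z j k) y) := by
    rw [pd_congr so (fun z hz => h.metric_mul_gamChange hz j l k) hy,
      pd_sub so (((h.smooth l k).mul (hp j)).add ((h.smooth l j).mul (hp k)))
        ((hp l).mul (h.smooth j k)) hy,
      pd_add so ((h.smooth l k).mul (hp j)) ((h.smooth l j).mul (hp k)) hy,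
      pd_mul so (h.smooth l k) (hp j) hy, pd_mul so (h.smooth l j) (hp k) hy,
      pd_mul so (hp l) (h.smooth j k) hy]
  have hG : ∀ a b, pd i (fun z => G z a b) y = (G y * gam G i y) b a + (G y * gam G i y) a b := by
    intro a b
    have := congrFun (congrFun (h.mpd_metric hy i) a) b
    have h1 : (gam G i y)ᵀ * G y = (G y * gam G i y)ᵀ := by
      rw [Matrix.transpose_mul, h.symm]
    rwa [h1] at this
  have hc1 : ∀ b, ∑ m, christoffel G m i l y * G y m b = (G y * gam G i y) b l := by
    intro b
    rw [Matrix.mul_apply]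
    refine Finset.sum_congr rfl fun m _ => ?_
    rw [h.apply_comm y m b]
    exact mul_comm _ _
  have hc2 : ∀ b, ∑ m, christoffel G m i k y * G y b m = (G y * gam G i y) b k := by
    intro b
    rw [Matrix.mul_apply]
    exact Finset.sum_congr rfl fun m _ => mul_comm _ _
  have hs : ∑ m, (christoffel G m i l y * (G y * gamChange G f j y) m k
      + christoffel G m i k y * (G y * gamChange G f j y) l m) =
      ((G y * gam G i y) k l * pd j f y + (G y * gam G i y) j l * pd k f y
        - (∑ m, christoffel G m i l y * pd m f y) * G y j k)
      + ((G y * gam G i y) l k * pd j f y + G y l j * (∑ m, christoffel G m i k y * pd m f y)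
        - pd l f y * (G y * gam G i y) j k) := by
    simp only [h.metric_mul_gamChange hy, ← hc1, ← hc2, Finset.sum_mul, Finset.mul_sum,
      ← Finset.sum_add_distrib, ← Finset.sum_sub_distrib]
    exact Finset.sum_congr rfl fun m _ => by ring
  rw [← covDeriv2_eq, covDeriv2, hm, hs, hG, hG, hG]
  simp only [hess, Matrix.of_apply]
  ring

theorem MetricOn.metric_mul_gamChange_mul (h : MetricOn U G) (hy : y ∈ U) (i j l k : Fin n) :
    (G y * (gamChange G f i y * gamChange G f j y)) l k =
      (G y * gamChange G f i y) l k * pd j f y + (G y * gamChange G f i y) l j * pd k f y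
        - gradSq G f y * G y l i * G y j k := by
  have e : ∑ m, (G y * gamChange G f i y) l m * gradComp G f y m = gradSq G f y * G y l i := by
    have h1 := h.metric_mul_gradComp (f := f) hy l
    have h2 := h.metric_mul_gradComp (f := f) hy i
    have : ∑ m, (G y * gamChange G f i y) l m * gradComp G f y m =
        (∑ m, G y l m * gradComp G f y m) * pd i f y
        + G y l i * (∑ m, pd m f y * gradComp G f y m)
        - pd l f y * ∑ m, G y i m * gradComp G f y m := by
      simp only [h.metric_mul_gamChange hy, Finset.sum_mul, Finset.mul_sum,
        ← Finset.sum_add_distrib, ← Finset.sum_sub_distrib]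
      exact Finset.sum_congr rfl fun m _ => by ring
    rw [this, h1, h2, gradSq_eq]
    ring
  rw [← Matrix.mul_assoc, Matrix.mul_apply, sum_mul_gamChange, e]

/-- The curvature tensor of `exp(2f) g`. -/
theorem MetricOn.riem_conformal (h : MetricOn U G) (h' : MetricOn U G') (hf : ContDiffOn ℝ ∞ f U)
    (hG : ∀ z ∈ U, G' z = Real.exp (2 * f z) • G z) (hy : y ∈ U) (i j k l : Fin n) :
    riem G' i j k l y =
      Real.exp (2 * f y) * (riem G i j k l y + kn (G y) (schChange G f y) i j k l) := by
  have so := h.isOpen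
  have hp : ∀ a b, mpd a (gam G' b) y = mpd a (gam G b) y + mpd a (gamChange G f b) y := by
    intro a b
    rw [mpd_congr so (fun z hz => h.gam_conformal h' hf hG hz b) hy,
      mpd_add so (h.smooth_gam b) (h.smooth_gamChange hf b) hy]
  -- For a connection Γ + A the curvature is R plus the covariant exterior derivative of A plus the
  -- commutator of A with itself.
  have hc : curv G' i j y = curv G i j y
      + (mpd i (gamChange G f j) y + (gam G i y * gamChange G f j y
        - gamChange G f j y * gam G i y))
      - (mpd j (gamChange G f i) y + (gam G j y * gamChange G f i y
        - gamChange G f i y * gam G j y))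
      + (gamChange G f i y * gamChange G f j y - gamChange G f j y * gamChange G f i y) := by
    rw [curv, hp, hp, h.gam_conformal h' hf hG hy, h.gam_conformal h' hf hG hy, curv]
    noncomm_ring
  have e : ∀ X : Matrix (Fin n) (Fin n) ℝ, Xᵀ * G y = (G y * X)ᵀ := by
    intro X
    rw [Matrix.transpose_mul, h.symm]
  have hl : (G y * gam G i y) l j = (G y * gam G j y) l i := by
    simp only [Matrix.mul_apply, gam, Matrix.of_apply, h.christoffel_comm _ i j]
  have hk : (G y * gam G i y) k j = (G y * gam G j y) k i := by
    simp only [Matrix.mul_apply, gam, Matrix.of_apply, h.christoffel_comm _ i j]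
  rw [riem_eq, riem_eq, hG y hy, Matrix.mul_smul, Matrix.smul_apply, smul_eq_mul, e, e, hc]
  congr 1
  rw [Matrix.mul_add, Matrix.mul_sub, Matrix.mul_add, h.metric_mul_curvChange hf hy,
    h.metric_mul_curvChange hf hy, Matrix.mul_sub]
  simp only [Matrix.transpose_apply, Matrix.add_apply, Matrix.sub_apply, h.cov2_gamChange hf hy,
    h.metric_mul_gamChange_mul hy, h.metric_mul_gamChange hy, hl, hk]
  simp only [kn, schChange, Matrix.sub_apply, Matrix.smul_apply, Matrix.of_apply, smul_eq_mul,
    pd_comm so hf hy i j, h.apply_comm y j l, h.apply_comm y i l, h.apply_comm y j i]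
  ring

theorem MetricOn.inv_conformal (h : MetricOn U G)
    (hG : ∀ z ∈ U, G' z = Real.exp (2 * f z) • G z) (hy : y ∈ U) :
    invMetric G' y = (Real.exp (2 * f y))⁻¹ • invMetric G y := by
  rw [invMetric, hG y hy]
  apply Matrix.inv_eq_right_inv
  rw [Matrix.smul_mul, Matrix.mul_smul, h.mul_inv hy, smul_smul,
    mul_inv_cancel₀ (Real.exp_pos _).ne', one_smul]

theorem contr_smul_left (c : ℝ) (p q : Matrix (Fin n) (Fin n) ℝ) :
    contr (c • p) q = c * contr p q := by
  simp [contr_eq_trace]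

theorem kn_add (g p q : Matrix (Fin n) (Fin n) ℝ) (i j k l : Fin n) :
    kn g (p + q) i j k l = kn g p i j k l + kn g q i j k l := by
  simp only [kn, Matrix.add_apply]
  ring

theorem kn_smul_left (c : ℝ) (p q : Matrix (Fin n) (Fin n) ℝ) (i j k l : Fin n) :
    kn (c • p) q i j k l = c * kn p q i j k l := by
  simp only [kn, Matrix.smul_apply, smul_eq_mul]
  ring

/-- By `MetricOn.eq_schM` the candidate only has to leave a trace free remainder, and by
`MetricOn.riem_conformal` the remainder is exp(2f) W. -/
theorem MetricOn.schM_conformal (hn : 4 ≤ n) (h : MetricOn U G) (h' : MetricOn U G')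
    (hf : ContDiffOn ℝ ∞ f U) (hG : ∀ z ∈ U, G' z = Real.exp (2 * f z) • G z) (hy : y ∈ U) :
    schM G' y = schM G y + schChange G f y := by
  symm
  refine h'.eq_schM hn hy fun j k => ?_
  have e : (Matrix.of fun i l => riem G' i j k l y
      - kn (G' y) (schM G y + schChange G f y) i j k l) =
      Real.exp (2 * f y) • Matrix.of fun i l => weyl G i j k l y := by
    ext i l
    simp only [Matrix.of_apply, Matrix.smul_apply, smul_eq_mul, h.riem_conformal h' hf hG hy,
      hG y hy, kn_smul_left, kn_add, weyl_eq]
    ring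
  rw [e, contr_smul, h.inv_conformal hG hy, contr_smul_left, h.contr_weyl hn hy]
  ring

theorem MetricOn.smooth_hess (h : MetricOn U G) (hf : ContDiffOn ℝ ∞ f U) :
    SmoothMat U (hess G f) := fun i j =>
  (smooth_pd h.isOpen (smooth_pd h.isOpen hf j) i).sub
    (smooth_sum _ fun m => (h.smooth_christoffel m i j).mul (smooth_pd h.isOpen hf m))

theorem smooth_dfdf (hU : IsOpen U) (hf : ContDiffOn ℝ ∞ f U) :
    SmoothMat U (fun z => Matrix.of fun i j : Fin n => pd i f z * pd j f z) :=
  fun i j => (smooth_pd hU hf i).mul (smooth_pd hU hf j)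

theorem MetricOn.smooth_gradSq (h : MetricOn U G) (hf : ContDiffOn ℝ ∞ f U) :
    ContDiffOn ℝ ∞ (gradSq G f) U :=
  smooth_contr h.smooth_inv (smooth_dfdf h.isOpen hf)

theorem cov2_dfdf (hU : IsOpen U) (hf : ContDiffOn ℝ ∞ f U) (hy : y ∈ U) (i j k : Fin n) :
    cov2 G (fun z => Matrix.of fun i j => pd i f z * pd j f z) i y j k =
      hess G f y i j * pd k f y + pd j f y * hess G f y i k := by
  have hm : pd i (fun z => pd j f z * pd k f z) y =
      pd i (pd j f) y * pd k f y + pd j f y * pd i (pd k f) y :=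
    pd_mul hU (smooth_pd hU hf j) (smooth_pd hU hf k) hy i
  rw [← covDeriv2_eq]
  simp only [covDeriv2, Matrix.of_apply]
  rw [hm]
  simp only [hess, Matrix.of_apply]
  have : ∑ m, (christoffel G m i j y * (pd m f y * pd k f y)
      + christoffel G m i k y * (pd j f y * pd m f y)) =
      (∑ m, christoffel G m i j y * pd m f y) * pd k f y
      + pd j f y * ∑ m, christoffel G m i k y * pd m f y := by
    rw [Finset.sum_mul, Finset.mul_sum, ← Finset.sum_add_distrib]
    exact Finset.sum_congr rfl fun m _ => by ring
  rw [this]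
  ring

theorem MetricOn.pd_gradSq (h : MetricOn U G) (hf : ContDiffOn ℝ ∞ f U) (hy : y ∈ U)
    (i : Fin n) : pd i (gradSq G f) y = 2 * ∑ m, hess G f y i m * gradComp G f y m := by
  have h1 : pd i (gradSq G f) y = contr (invMetric G y)
      (cov2 G (fun z => Matrix.of fun i j => pd i f z * pd j f z) i y) :=
    h.pd_contr hy (smooth_dfdf h.isOpen hf) i
  have h2 : cov2 G (fun z => Matrix.of fun i j => pd i f z * pd j f z) i y =
      (Matrix.of fun j k => hess G f y i j * pd k f y)
      + (Matrix.of fun j k => hess G f y i j * pd k f y)ᵀ := by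
    ext j k
    rw [cov2_dfdf h.isOpen hf hy]
    simp only [Matrix.add_apply, Matrix.transpose_apply, Matrix.of_apply]
    ring
  rw [h1, h2, contr_add, contr_transpose (h.inv_transpose y),
    contr_vecMulVec_inv (fun j => hess G f y i j)]
  ring

/-- The Ricci identity for `df`. -/
theorem MetricOn.cov2_hess (h : MetricOn U G) (hf : ContDiffOn ℝ ∞ f U) (hy : y ∈ U)
    (i j k : Fin n) :
    cov2 G (hess G f) i y j k - cov2 G (hess G f) j y i k =
      -∑ l, gradComp G f y l * riem G i j k l y := by
  have so := h.isOpen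
  have hp : ∀ k, ContDiffOn ℝ ∞ (pd k f) U := smooth_pd so hf
  have hm : ∀ i j, pd i (fun z => hess G f z j k) y = pd i (pd j (pd k f)) y
      - ∑ m, (pd i (christoffel G m j k) y * pd m f y
        + christoffel G m j k y * pd i (pd m f) y) := by
    intro i j
    have hs := fun m => (h.smooth_christoffel m j k).mul (hp m)
    show pd i (fun z => pd j (pd k f) z - ∑ m, christoffel G m j k z * pd m f z) y = _
    rw [pd_sub so (smooth_pd so (hp k) j) (smooth_sum _ hs) hy, pd_sum so _ (fun m _ => hs m) hy]
    congr 1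
    exact Finset.sum_congr rfl fun m _ => pd_mul so (h.smooth_christoffel m j k) (hp m) hy i
  have hR : ∑ l, gradComp G f y l * riem G i j k l y = ∑ m, curv G i j y m k * pd m f y := by
    simp only [riem_eq, Matrix.mul_apply, Matrix.transpose_apply,
      ← h.metric_mul_gradComp (f := f) hy, Finset.mul_sum]
    rw [Finset.sum_comm]
    exact Finset.sum_congr rfl fun m _ => Finset.sum_congr rfl fun l _ => by ring
  have hq : ∀ i j, ∑ m, christoffel G m i k y * hess G f y j m =
      ∑ m, christoffel G m i k y * pd j (pd m f) y
        - ∑ s, (gam G j y * gam G i y) s k * pd s f y := by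
    intro i j
    simp only [hess, Matrix.of_apply, mul_sub, Finset.sum_sub_distrib, Finset.mul_sum,
      Matrix.mul_apply, Finset.sum_mul, gam]
    congr 1
    rw [Finset.sum_comm]
    exact Finset.sum_congr rfl fun m _ => Finset.sum_congr rfl fun l _ => by ring
  rw [hR, ← covDeriv2_eq, ← covDeriv2_eq, covDeriv2, covDeriv2, hm, hm,
    pd_comm so (hp k) hy i j]
  simp only [Finset.sum_add_distrib, hq, curv, Matrix.add_apply, Matrix.sub_apply, mpd, add_mul,
    sub_mul, Finset.sum_sub_distrib, gam, Matrix.of_apply, h.christoffel_comm _ j i]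
  ring

theorem MetricOn.cov2_schChange (h : MetricOn U G) (hf : ContDiffOn ℝ ∞ f U) (hy : y ∈ U)
    (i j k : Fin n) :
    cov2 G (schChange G f) i y j k = hess G f y i j * pd k f y + pd j f y * hess G f y i k
      - cov2 G (hess G f) i y j k - (∑ m, hess G f y i m * gradComp G f y m) * G y j k := by
  have so := h.isOpen
  have hN : ContDiffOn ℝ ∞ (fun z => (1 / 2) * gradSq G f z) U :=
    contDiffOn_const.mul (h.smooth_gradSq hf)
  have e : cov2 G (schChange G f) i y = cov2 G (fun z => Matrix.of fun i j => pd i f z * pd j f z) i y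
      - cov2 G (hess G f) i y - cov2 G (fun z => ((1 / 2) * gradSq G f z) • G z) i y := by
    have : mpd i (schChange G f) y = mpd i (fun z => Matrix.of fun i j => pd i f z * pd j f z) y
        - mpd i (hess G f) y - mpd i (fun z => ((1 / 2) * gradSq G f z) • G z) y := by
      show mpd i (fun z => (Matrix.of fun i j => pd i f z * pd j f z) - hess G f z
        - ((1 / 2) * gradSq G f z) • G z) y = _
      rw [mpd_sub so ((smooth_dfdf so hf).sub (h.smooth_hess hf)) (h.smooth.smul hN) hy,
        mpd_sub so (smooth_dfdf so hf) (h.smooth_hess hf) hy]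
    simp only [cov2, this, schChange, Matrix.mul_sub, Matrix.sub_mul]
    abel
  rw [e, h.cov2_smul_metric hy hN, pd_const_mul so _ (h.smooth_gradSq hf) hy, h.pd_gradSq hf hy]
  simp only [Matrix.sub_apply, cov2_dfdf so hf hy, Matrix.smul_apply, smul_eq_mul]
  ring

theorem MetricOn.smooth_schChange (h : MetricOn U G) (hf : ContDiffOn ℝ ∞ f U) :
    SmoothMat U (schChange G f) :=
  ((smooth_dfdf h.isOpen hf).sub (h.smooth_hess hf)).sub
    (h.smooth.smul (contDiffOn_const.mul (h.smooth_gradSq hf)))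

theorem MetricOn.hess_symm (h : MetricOn U G) (hf : ContDiffOn ℝ ∞ f U) (hy : y ∈ U) (i j : Fin n) :
    hess G f y i j = hess G f y j i := by
  simp only [hess, Matrix.of_apply, h.christoffel_comm _ i j, pd_comm h.isOpen hf hy i j]

/-- The exterior derivative of the Schouten tensor of `exp(2f) g`. -/
theorem MetricOn.dSchouten_conformal (hn : 4 ≤ n) (h : MetricOn U G) (h' : MetricOn U G')
    (hf : ContDiffOn ℝ ∞ f U) (hG : ∀ z ∈ U, G' z = Real.exp (2 * f z) • G z) (hy : y ∈ U)
    (i j k : Fin n) :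
    dSchouten G' i j k y = dSchouten G i j k y + ∑ l, gradComp G f y l * weyl G i j k l y := by
  have so := h.isOpen
  set Q := schM G y + schChange G f y with hQ
  have hs : ∀ i j, schM G y i j = schM G y j i := fun i j =>
    congrFun (congrFun (h.schM_symm hy) j) i
  have hQs : ∀ i j, Q i j = Q j i := by
    intro i j
    simp only [hQ, Matrix.add_apply, schChange, Matrix.sub_apply, Matrix.of_apply,
      Matrix.smul_apply, hs i j, h.hess_symm hf hy i j, h.apply_comm y i j,
      mul_comm (pd i f y)]
  have hc : ∀ a b c, cov2 G' (schM G') a y b c = cov2 G (schM G) a y b c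
      + cov2 G (schChange G f) a y b c
      - (Q c b * pd a f y + Q c a * pd b f y - (∑ m, Q c m * gradComp G f y m) * G y a b)
      - (Q b c * pd a f y + Q b a * pd c f y - (∑ m, Q b m * gradComp G f y m) * G y a c) := by
    intro a b c
    have e1 : mpd a (schM G') y = mpd a (schM G) y + mpd a (schChange G f) y := by
      rw [mpd_congr so (fun z hz => h.schM_conformal hn h' hf hG hz) hy,
        mpd_add so h.smooth_schM (h.smooth_schChange hf) hy]
    have e2 : cov2 G' (schM G') a y = cov2 G (schM G) a y + cov2 G (schChange G f) a y
        - ((gamChange G f a y)ᵀ * Q + Q * gamChange G f a y) := by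
      simp only [cov2]
      rw [e1, h.schM_conformal hn h' hf hG hy, h.gam_conformal h' hf hG hy, hQ]
      simp only [Matrix.transpose_add, Matrix.add_mul, Matrix.mul_add]
      abel
    have e3 : ((gamChange G f a y)ᵀ * Q) b c = ∑ m, Q c m * gamChange G f a y m b := by
      rw [Matrix.mul_apply]
      refine Finset.sum_congr rfl fun m _ => ?_
      rw [Matrix.transpose_apply, hQs m c, mul_comm]
    rw [e2]
    simp only [Matrix.sub_apply, Matrix.add_apply]
    rw [e3, Matrix.mul_apply, sum_mul_gamChange, sum_mul_gamChange]
    ring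
  -- After antisymmetrization in i, j, the Hessian derivatives give R(·,·,·,∇f) by the Ricci
  -- identity, and the products of 𝔨 with df give -(g ⊙ 𝔨)(·,·,·,∇f). Their sum is W(·,·,·,∇f), and
  -- all other terms cancel.
  have hW : ∑ l, gradComp G f y l * weyl G i j k l y =
      ∑ l, gradComp G f y l * riem G i j k l y
      - (pd i f y * schM G y j k + G y j k * (∑ m, schM G y i m * gradComp G f y m)
        - G y i k * (∑ m, schM G y j m * gradComp G f y m) - pd j f y * schM G y i k) := by
    rw [← h.metric_mul_gradComp hy i, ← h.metric_mul_gradComp hy j]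
    simp only [weyl_eq, Finset.sum_mul, Finset.mul_sum, ← Finset.sum_add_distrib,
      ← Finset.sum_sub_distrib, kn]
    exact Finset.sum_congr rfl fun m _ => by ring
  have hQF : ∀ b, ∑ m, Q b m * gradComp G f y m = ∑ m, schM G y b m * gradComp G f y m
      + (1 / 2) * gradSq G f y * pd b f y - ∑ m, hess G f y b m * gradComp G f y m := by
    intro b
    have e1 : ∑ m, Q b m * gradComp G f y m = ∑ m, schM G y b m * gradComp G f y m
        + pd b f y * (∑ m, pd m f y * gradComp G f y m)
        - (∑ m, hess G f y b m * gradComp G f y m)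
        - (1 / 2) * gradSq G f y * ∑ m, G y b m * gradComp G f y m := by
      simp only [hQ, Matrix.add_apply, schChange, Matrix.sub_apply, Matrix.of_apply,
        Matrix.smul_apply, smul_eq_mul, Finset.mul_sum, ← Finset.sum_add_distrib,
        ← Finset.sum_sub_distrib]
      exact Finset.sum_congr rfl fun m _ => by ring
    rw [e1, h.metric_mul_gradComp hy, ← gradSq_eq]
    ring
  have hH := h.cov2_hess hf hy i j k
  have hQa : ∀ a b, Q a b = schM G y a b + (pd a f y * pd b f y - hess G f y a b
      - (1 / 2) * gradSq G f y * G y a b) := by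
    intro a b
    simp only [hQ, Matrix.add_apply, schChange, Matrix.sub_apply, Matrix.of_apply,
      Matrix.smul_apply, smul_eq_mul]
  rw [dSchouten_eq, dSchouten_eq, hc, hc, h.cov2_schChange hf hy, h.cov2_schChange hf hy, hW, hQF,
    hQF, hQF, h.apply_comm y j i, hQs k j, hQs k i, hQs j i, hQa, hQa, h.hess_symm hf hy j i]
  have e : ∑ l, gradComp G f y l * riem G i j k l y =
    cov2 G (hess G f) j y i k - cov2 G (hess G f) i y j k := by linarith
  rw [e]
  ring

end Conformal

/-! ## Change of coordinates -/

section CoordinateChange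

variable {n : ℕ} {U V : Set (Coord n)} {Φ : Coord n → Coord n}
  {G G' : Coord n → Matrix (Fin n) (Fin n) ℝ} {y : Coord n}

/-- The Jacobian matrix of `Φ`. -/
noncomputable def jac (Φ : Coord n → Coord n) (y : Coord n) : Matrix (Fin n) (Fin n) ℝ :=
  Matrix.of fun a i => pd i (fun z => Φ z a) y

/-- `Φ` is an isometry of `(U, G)` into `(V, G')`. -/
structure IsLocalIsom (U V : Set (Coord n)) (Φ : Coord n → Coord n)
    (G G' : Coord n → Matrix (Fin n) (Fin n) ℝ) : Prop where
  left : MetricOn U G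
  right : MetricOn V G'
  smooth : ContDiffOn ℝ ∞ Φ U
  mapsTo : ∀ z ∈ U, Φ z ∈ V
  pullback : ∀ z ∈ U, G z = (jac Φ z)ᵀ * G' (Φ z) * jac Φ z

theorem smooth_jac (hU : IsOpen U) (hΦ : ContDiffOn ℝ ∞ Φ U) : SmoothMat U (jac Φ) := by
  intro a i
  refine smooth_pd hU ?_ i
  exact (EuclideanSpace.proj (𝕜 := ℝ) a).contDiff.comp_contDiffOn hΦ

theorem smooth_coord (hΦ : ContDiffOn ℝ ∞ Φ U) (a : Fin n) :
    ContDiffOn ℝ ∞ (fun z => Φ z a) U :=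
  (EuclideanSpace.proj (𝕜 := ℝ) a).contDiff.comp_contDiffOn hΦ

theorem SmoothMat.comp {F : Coord n → Matrix (Fin n) (Fin n) ℝ} (hF : SmoothMat V F)
    (hΦ : ContDiffOn ℝ ∞ Φ U) (hm : ∀ z ∈ U, Φ z ∈ V) : SmoothMat U (fun z => F (Φ z)) :=
  fun i j => (hF i j).comp hΦ hm

theorem mpd_comp (hU : IsOpen U) (hV : IsOpen V) (hΦ : ContDiffOn ℝ ∞ Φ U)
    (hm : ∀ z ∈ U, Φ z ∈ V) {F : Coord n → Matrix (Fin n) (Fin n) ℝ} (hF : SmoothMat V F)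
    (hy : y ∈ U) (i : Fin n) :
    mpd i (fun z => F (Φ z)) y = ∑ b, jac Φ y b i • mpd b F (Φ y) := by
  ext k l
  simp only [Matrix.sum_apply, Matrix.smul_apply, smul_eq_mul]
  exact pd_comp hU hV hΦ hm (hF k l) hy i

theorem pd_jac (hU : IsOpen U) (hΦ : ContDiffOn ℝ ∞ Φ U) (hy : y ∈ U) (i j b : Fin n) :
    pd i (fun z => jac Φ z b j) y = pd j (fun z => jac Φ z b i) y :=
  pd_comm hU (smooth_coord hΦ b) hy i j

theorem IsLocalIsom.smooth_jac (h : IsLocalIsom U V Φ G G') : SmoothMat U (jac Φ) :=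
  ConfWeyl.smooth_jac h.left.isOpen h.smooth

/-- A nondegenerate pullback metric JᵀG'J forces J to be invertible, so no local invertibility of Φ
has to be assumed. -/
theorem IsLocalIsom.det_jac (h : IsLocalIsom U V Φ G G') (hy : y ∈ U) :
    IsUnit (jac Φ y).det := by
  have := h.left.det y hy
  rw [h.pullback y hy, Matrix.det_mul] at this
  exact isUnit_of_mul_isUnit_right this

/-- The connection of `G'` pulled back to `U`, in the frame of the target. -/
noncomputable def pullGam (Φ : Coord n → Coord n) (G' : Coord n → Matrix (Fin n) (Fin n) ℝ)
    (i : Fin n) (y : Coord n) : Matrix (Fin n) (Fin n) ℝ :=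
  ∑ b, jac Φ y b i • gam G' b (Φ y)

theorem sum_transpose_add_smul (J : Fin n → ℝ) (A : Fin n → Matrix (Fin n) (Fin n) ℝ)
    (g : Matrix (Fin n) (Fin n) ℝ) :
    ∑ b, J b • ((A b)ᵀ * g + g * A b) = (∑ b, J b • A b)ᵀ * g + g * ∑ b, J b • A b := by
  simp only [Matrix.transpose_sum, Matrix.transpose_smul, Matrix.sum_mul, Matrix.mul_sum,
    Matrix.smul_mul, Matrix.mul_smul, smul_add, Finset.sum_add_distrib]

/-- The transformation law of the Levi-Civita connection. -/
theorem IsLocalIsom.jac_mul_gam (h : IsLocalIsom U V Φ G G') (hy : y ∈ U) (i : Fin n) :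
    jac Φ y * gam G i y = pullGam Φ G' i y * jac Φ y + mpd i (jac Φ) y := by
  set J := jac Φ y with hJ
  have hJi : J * J⁻¹ = 1 := Matrix.mul_nonsing_inv _ (h.det_jac hy)
  have so := h.left.isOpen
  -- The transformed connection is identified by `MetricOn.gam_unique`: it is symmetric, because
  -- second derivatives of Φ are, and it is compatible with G.
  have hc : ∀ i, J⁻¹ * (pullGam Φ G' i y * J + mpd i (jac Φ) y) = gam G i y := by
    refine h.left.gam_unique hy ?_ ?_
    · intro a m k
      have hs : ∀ c, (pullGam Φ G' a y * J + mpd a (jac Φ) y) c k =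
          (pullGam Φ G' k y * J + mpd k (jac Φ) y) c a := by
        intro c
        have e : ∀ a k, (pullGam Φ G' a y * J) c k =
            ∑ b, ∑ d, J b a * J d k * gam G' b (Φ y) c d := by
          intro a k
          rw [pullGam, Matrix.sum_mul, Matrix.sum_apply]
          refine Finset.sum_congr rfl fun b _ => ?_
          rw [Matrix.smul_mul, Matrix.smul_apply, Matrix.mul_apply, smul_eq_mul, Finset.mul_sum]
          exact Finset.sum_congr rfl fun d _ => by ring
        rw [Matrix.add_apply, Matrix.add_apply, e, e, Finset.sum_comm]
        congr 1
        · refine Finset.sum_congr rfl fun b _ => Finset.sum_congr rfl fun d _ => ?_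
          simp only [gam, Matrix.of_apply, h.right.christoffel_comm c b d]
          ring
        · exact pd_jac so h.smooth hy a k c
      simp only [Matrix.mul_apply (M := J⁻¹), hs]
    · intro a
      have sG := h.right.smooth.comp h.smooth h.mapsTo
      have hC : G y * (J⁻¹ * (pullGam Φ G' a y * J + mpd a (jac Φ) y)) =
          Jᵀ * G' (Φ y) * (pullGam Φ G' a y * J + mpd a (jac Φ) y) := by
        rw [h.pullback y hy, ← Matrix.mul_assoc, Matrix.mul_assoc _ J, hJi, Matrix.mul_one]
      have hC' : (J⁻¹ * (pullGam Φ G' a y * J + mpd a (jac Φ) y))ᵀ * G y =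
          (pullGam Φ G' a y * J + mpd a (jac Φ) y)ᵀ * (G' (Φ y) * J) := by
        have := congrArg Matrix.transpose hC
        rw [Matrix.transpose_mul, h.left.symm] at this
        rw [this]
        simp only [Matrix.transpose_mul, Matrix.transpose_transpose, h.right.symm]
      rw [hC, hC', mpd_congr so h.pullback hy,
        mpd_mul so (h.smooth_jac.transpose.mul sG) h.smooth_jac hy,
        mpd_mul so h.smooth_jac.transpose sG hy, mpd_transpose,
        mpd_comp so h.right.isOpen h.smooth h.mapsTo h.right.smooth hy]
      have e : ∑ b, jac Φ y b a • mpd b G' (Φ y) =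
          (pullGam Φ G' a y)ᵀ * G' (Φ y) + G' (Φ y) * pullGam Φ G' a y := by
        simp only [h.right.mpd_metric (h.mapsTo y hy)]
        exact sum_transpose_add_smul _ _ _
      rw [e]
      simp only [Matrix.transpose_add, Matrix.transpose_mul]
      noncomm_ring
  rw [← hc i, ← Matrix.mul_assoc, hJi, Matrix.one_mul]

theorem sum_sum_smul_mul (x z : Fin n → ℝ) (A B : Fin n → Matrix (Fin n) (Fin n) ℝ) :
    (∑ b, x b • A b) * (∑ c, z c • B c) = ∑ b, ∑ c, (x b * z c) • (A b * B c) := by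
  rw [Matrix.sum_mul]
  refine Finset.sum_congr rfl fun b _ => ?_
  rw [Matrix.mul_sum]
  refine Finset.sum_congr rfl fun c _ => ?_
  rw [Matrix.smul_mul, Matrix.mul_smul, smul_smul]

/-- The transformation law of the curvature endomorphisms. -/
theorem IsLocalIsom.jac_mul_curv (h : IsLocalIsom U V Φ G G') (hy : y ∈ U) (i j : Fin n) :
    jac Φ y * curv G i j y =
      (∑ b, ∑ c, (jac Φ y b i * jac Φ y c j) • curv G' b c (Φ y)) * jac Φ y := by
  have so := h.left.isOpen
  have sJ := h.smooth_jac
  have sg := h.left.smooth_gam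
  have sg' : ∀ b, SmoothMat U (fun z => gam G' b (Φ z)) := fun b =>
    (h.right.smooth_gam b).comp h.smooth h.mapsTo
  have sP : ∀ i, SmoothMat U (pullGam Φ G' i) := fun i =>
    SmoothMat.sum _ fun b => SmoothMat.smul (sJ b i) (sg' b)
  -- The derivative of the transformation law of Γ. After antisymmetrization its second derivatives
  -- of J drop out, and its first derivatives of J cancel against the products of Γ.
  have key : ∀ i j, mpd j (jac Φ) y * gam G i y + jac Φ y * mpd j (gam G i) y =
      mpd j (pullGam Φ G' i) y * jac Φ y + pullGam Φ G' i y * mpd j (jac Φ) y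
        + mpd j (mpd i (jac Φ)) y := by
    intro i j
    rw [← mpd_mul so sJ (sg i) hy, mpd_congr so (fun z hz => h.jac_mul_gam hz i) hy,
      mpd_add so ((sP i).mul sJ) (sJ.mpd so i) hy, mpd_mul so (sP i) sJ hy]
  have hP : ∀ i j, mpd j (pullGam Φ G' i) y =
      (∑ b, pd j (fun z => jac Φ z b i) y • gam G' b (Φ y))
      + ∑ b, ∑ c, (jac Φ y b i * jac Φ y c j) • mpd c (gam G' b) (Φ y) := by
    intro i j
    show mpd j (fun z => ∑ b, jac Φ z b i • gam G' b (Φ z)) y = _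
    rw [mpd_sum so _ (fun b => SmoothMat.smul (sJ b i) (sg' b)) hy, ← Finset.sum_add_distrib]
    refine Finset.sum_congr rfl fun b _ => ?_
    rw [mpd_smul so (sJ b i) (sg' b) hy,
      mpd_comp so h.right.isOpen h.smooth h.mapsTo (h.right.smooth_gam b) hy]
    simp only [Finset.smul_sum, smul_smul]
  have hC : mpd i (pullGam Φ G' j) y - mpd j (pullGam Φ G' i) y
      + (pullGam Φ G' i y * pullGam Φ G' j y - pullGam Φ G' j y * pullGam Φ G' i y) =
      ∑ b, ∑ c, (jac Φ y b i * jac Φ y c j) • curv G' b c (Φ y) := by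
    rw [hP, hP]
    simp only [pd_jac so h.smooth hy i j]
    simp only [pullGam, sum_sum_smul_mul]
    rw [Finset.sum_comm (f := fun b c => (jac Φ y b j * jac Φ y c i) • mpd c (gam G' b) (Φ y)),
      Finset.sum_comm (f := fun b c => (jac Φ y b j * jac Φ y c i) • (gam G' b (Φ y) * gam G' c (Φ y))),
      add_sub_add_left_eq_sub]
    simp only [← Finset.sum_sub_distrib, ← Finset.sum_add_distrib, curv]
    refine Finset.sum_congr rfl fun b _ => Finset.sum_congr rfl fun c _ => ?_
    module
  rw [← hC, curv]
  have k1 := key j i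
  have k2 := key i j
  have g1 := h.jac_mul_gam hy i
  have g2 := h.jac_mul_gam hy j
  have c := mpd_comm so sJ hy i j
  have e1 : jac Φ y * mpd i (gam G j) y = mpd i (pullGam Φ G' j) y * jac Φ y
      + pullGam Φ G' j y * mpd i (jac Φ) y + mpd i (mpd j (jac Φ)) y
      - mpd i (jac Φ) y * gam G j y := by
    rw [← k1]
    abel
  have e2 : jac Φ y * mpd j (gam G i) y = mpd j (pullGam Φ G' i) y * jac Φ y
      + pullGam Φ G' i y * mpd j (jac Φ) y + mpd i (mpd j (jac Φ)) y
      - mpd j (jac Φ) y * gam G i y := by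
    rw [c, ← k2]
    abel
  rw [Matrix.mul_add, Matrix.mul_sub, Matrix.mul_sub, e1, e2, ← Matrix.mul_assoc,
    ← Matrix.mul_assoc, g1, g2]
  simp only [Matrix.add_mul, Matrix.mul_assoc, g1, g2]
  noncomm_ring

theorem transpose_mul_mul_apply (J p : Matrix (Fin n) (Fin n) ℝ) (i l : Fin n) :
    (Jᵀ * p * J) i l = ∑ a, ∑ d, J a i * J d l * p a d := by
  simp only [Matrix.mul_apply, Matrix.transpose_apply, Finset.sum_mul]
  rw [Finset.sum_comm]
  exact Finset.sum_congr rfl fun a _ => Finset.sum_congr rfl fun d _ => by ring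

/-- The pullback of a `(0,4)` tensor by a linear map with matrix `J`. -/
noncomputable def pull4 (J : Matrix (Fin n) (Fin n) ℝ) (A : Fin n → Fin n → Fin n → Fin n → ℝ)
    (i j k l : Fin n) : ℝ :=
  ∑ b, ∑ c, J b j * J c k * (Jᵀ * (Matrix.of fun a d => A a b c d) * J) i l

theorem pull4_eq (J : Matrix (Fin n) (Fin n) ℝ) (A : Fin n → Fin n → Fin n → Fin n → ℝ)
    (i j k l : Fin n) : pull4 J A i j k l =
      ∑ a, ∑ b, ∑ c, ∑ d, J a i * J b j * J c k * J d l * A a b c d := by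
  simp only [pull4, transpose_mul_mul_apply, Matrix.of_apply, Finset.mul_sum]
  calc ∑ b, ∑ c, ∑ a, ∑ d, J b j * J c k * (J a i * J d l * A a b c d)
      = ∑ b, ∑ a, ∑ c, ∑ d, J b j * J c k * (J a i * J d l * A a b c d) :=
        Finset.sum_congr rfl fun b _ => Finset.sum_comm
    _ = ∑ a, ∑ b, ∑ c, ∑ d, J b j * J c k * (J a i * J d l * A a b c d) := Finset.sum_comm
    _ = _ := Finset.sum_congr rfl fun a _ => Finset.sum_congr rfl fun b _ =>
        Finset.sum_congr rfl fun c _ => Finset.sum_congr rfl fun d _ => by ring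

theorem pull4_sub (J : Matrix (Fin n) (Fin n) ℝ) (A B : Fin n → Fin n → Fin n → Fin n → ℝ)
    (i j k l : Fin n) : pull4 J (fun a b c d => A a b c d - B a b c d) i j k l =
      pull4 J A i j k l - pull4 J B i j k l := by
  simp only [pull4_eq, mul_sub, Finset.sum_sub_distrib]

theorem pull4_kn (J g q : Matrix (Fin n) (Fin n) ℝ) (i j k l : Fin n) :
    kn (Jᵀ * g * J) (Jᵀ * q * J) i j k l = pull4 J (kn g q) i j k l := by
  have e : ∀ (p r : Matrix (Fin n) (Fin n) ℝ) (k l : Fin n),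
      (Jᵀ * p * J) i l * (Jᵀ * r * J) j k =
        ∑ a, ∑ b, ∑ c, ∑ d, (J a i * J d l * p a d) * (J b j * J c k * r b c) := by
    intro p r k l
    rw [transpose_mul_mul_apply, transpose_mul_mul_apply, Finset.sum_mul]
    refine Finset.sum_congr rfl fun a _ => ?_
    rw [Finset.mul_sum]
    refine Finset.sum_congr rfl fun b _ => ?_
    rw [Finset.mul_sum]
    refine Finset.sum_congr rfl fun c _ => ?_
    rw [Finset.sum_mul]
  have e' : ∀ p r : Matrix (Fin n) (Fin n) ℝ,
      (Jᵀ * p * J) i k * (Jᵀ * r * J) j l =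
        ∑ a, ∑ b, ∑ c, ∑ d, (J a i * J c k * p a c) * (J b j * J d l * r b d) := by
    intro p r
    rw [e]
    exact Finset.sum_congr rfl fun a _ => Finset.sum_congr rfl fun b _ => Finset.sum_comm
  have h2 : (Jᵀ * g * J) j k * (Jᵀ * q * J) i l = _ := (mul_comm _ _).trans (e q g k l)
  have h4 : (Jᵀ * g * J) j l * (Jᵀ * q * J) i k = _ := (mul_comm _ _).trans (e' q g)
  rw [kn, e g q k l, h2, e' g q, h4, pull4_eq]
  simp only [← Finset.sum_add_distrib, ← Finset.sum_sub_distrib]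
  refine Finset.sum_congr rfl fun a _ => Finset.sum_congr rfl fun b _ =>
    Finset.sum_congr rfl fun c _ => Finset.sum_congr rfl fun d _ => ?_
  simp only [kn]
  ring

theorem IsLocalIsom.riem_eq (h : IsLocalIsom U V Φ G G') (hy : y ∈ U) (i j k l : Fin n) :
    riem G i j k l y = pull4 (jac Φ y) (fun a b c d => riem G' a b c d (Φ y)) i j k l := by
  set J := jac Φ y with hJ
  have e : (curv G i j y)ᵀ * G y =
      ∑ a, ∑ b, (J a i * J b j) • (Jᵀ * ((curv G' a b (Φ y))ᵀ * G' (Φ y)) * J) := by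
    rw [h.pullback y hy, ← Matrix.mul_assoc, ← Matrix.mul_assoc, ← Matrix.transpose_mul,
      h.jac_mul_curv hy, Matrix.transpose_mul]
    simp only [Matrix.transpose_sum, Matrix.transpose_smul, Matrix.mul_sum, Matrix.sum_mul,
      Matrix.smul_mul, Matrix.mul_smul, Matrix.mul_assoc, ← hJ]
  rw [ConfWeyl.riem_eq, e, pull4_eq]
  simp only [Matrix.sum_apply, Matrix.smul_apply, smul_eq_mul]
  refine Finset.sum_congr rfl fun a _ => Finset.sum_congr rfl fun b _ => ?_
  simp only [transpose_mul_mul_apply, ← ConfWeyl.riem_eq, Finset.mul_sum]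
  exact Finset.sum_congr rfl fun c _ => Finset.sum_congr rfl fun d _ => by ring

/-- Inverse metrics are related by J G⁻¹ Jᵀ = G'⁻¹, so the Jacobians cancel under the trace. -/
theorem IsLocalIsom.contr_pullback (h : IsLocalIsom U V Φ G G') (hy : y ∈ U)
    (Q : Matrix (Fin n) (Fin n) ℝ) :
    contr (invMetric G y) ((jac Φ y)ᵀ * Q * jac Φ y) = contr (invMetric G' (Φ y)) Q := by
  set J := jac Φ y with hJ
  have hJi : J * J⁻¹ = 1 := Matrix.mul_nonsing_inv _ (h.det_jac hy)
  have hJt : (J⁻¹)ᵀ * Jᵀ = 1 := by rw [← Matrix.transpose_mul, hJi, Matrix.transpose_one]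
  have hH : J * invMetric G y * Jᵀ = invMetric G' (Φ y) := by
    have h1 : invMetric G y = J⁻¹ * invMetric G' (Φ y) * (J⁻¹)ᵀ := by
      rw [invMetric, h.pullback y hy, Matrix.mul_inv_rev, Matrix.mul_inv_rev, invMetric,
        Matrix.transpose_nonsing_inv, Matrix.mul_assoc]
    rw [h1, ← Matrix.mul_assoc, ← Matrix.mul_assoc, hJi, Matrix.one_mul, Matrix.mul_assoc, hJt,
      Matrix.mul_one]
  rw [contr_eq_trace, contr_eq_trace, ← hH]
  simp only [Matrix.transpose_mul, Matrix.transpose_transpose, Matrix.mul_assoc]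
  rw [Matrix.trace_mul_comm J]
  simp only [Matrix.mul_assoc]

/-- The traced slots i, l enter `pull4` as a congruence JᵀQJ, to which `IsLocalIsom.contr_pullback`
applies. -/
theorem IsLocalIsom.contr_pull4 (h : IsLocalIsom U V Φ G G') (hy : y ∈ U)
    (A : Fin n → Fin n → Fin n → Fin n → ℝ) (j k : Fin n) :
    contr (invMetric G y) (Matrix.of fun i l => pull4 (jac Φ y) A i j k l) =
      ∑ b, ∑ c, jac Φ y b j * jac Φ y c k *
        contr (invMetric G' (Φ y)) (Matrix.of fun a d => A a b c d) := by
  have e : (Matrix.of fun i l => pull4 (jac Φ y) A i j k l) = ∑ b, ∑ c,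
      (jac Φ y b j * jac Φ y c k) •
        ((jac Φ y)ᵀ * (Matrix.of fun a d => A a b c d) * jac Φ y) := by
    ext i l
    simp only [Matrix.of_apply, pull4, Matrix.sum_apply, Matrix.smul_apply, smul_eq_mul]
  rw [e]
  simp only [contr_sum, contr_smul, h.contr_pullback hy]

/-- Again the characterization of 𝔨 by a trace free remainder: subtracting the Kulkarni-Nomizu
product with the pullback of 𝔨' leaves the pullback of W'. -/
theorem IsLocalIsom.schM_eq (hn : 4 ≤ n) (h : IsLocalIsom U V Φ G G') (hy : y ∈ U) :
    schM G y = (jac Φ y)ᵀ * schM G' (Φ y) * jac Φ y := by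
  symm
  refine h.left.eq_schM hn hy fun j k => ?_
  simp only [h.riem_eq hy, h.pullback y hy, pull4_kn, ← pull4_sub]
  rw [h.contr_pull4 hy]
  simp only [← weyl_eq, h.right.contr_weyl hn (h.mapsTo y hy), mul_zero, Finset.sum_const_zero]

/-- The transformation law of the Weyl tensor. -/
theorem IsLocalIsom.weyl_eq (hn : 4 ≤ n) (h : IsLocalIsom U V Φ G G') (hy : y ∈ U)
    (i j k l : Fin n) :
    weyl G i j k l y = pull4 (jac Φ y) (fun a b c d => weyl G' a b c d (Φ y)) i j k l := by
  simp only [ConfWeyl.weyl_eq, pull4_sub]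
  rw [h.riem_eq hy, h.schM_eq hn hy, h.pullback y hy, pull4_kn]

/-- The derivatives of J that come from B = JᵀB'J are exactly the inhomogeneous terms in the
transformation law of Γ. -/
theorem IsLocalIsom.cov2_eq (h : IsLocalIsom U V Φ G G') (hy : y ∈ U)
    {B B' : Coord n → Matrix (Fin n) (Fin n) ℝ} (hB' : SmoothMat V B')
    (hB : ∀ z ∈ U, B z = (jac Φ z)ᵀ * B' (Φ z) * jac Φ z) (i : Fin n) :
    cov2 G B i y =
      ∑ a, jac Φ y a i • ((jac Φ y)ᵀ * cov2 G' B' a (Φ y) * jac Φ y) := by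
  have so := h.left.isOpen
  have sB := hB'.comp h.smooth h.mapsTo
  have e1 : (gam G i y)ᵀ * (jac Φ y)ᵀ =
      (jac Φ y)ᵀ * (pullGam Φ G' i y)ᵀ + (mpd i (jac Φ) y)ᵀ := by
    rw [← Matrix.transpose_mul, h.jac_mul_gam hy, Matrix.transpose_add, Matrix.transpose_mul]
  have e2 : ∑ a, jac Φ y a i • ((jac Φ y)ᵀ * cov2 G' B' a (Φ y) * jac Φ y) =
      (jac Φ y)ᵀ * (∑ a, jac Φ y a i • mpd a B' (Φ y)) * jac Φ y
      - (jac Φ y)ᵀ * ((pullGam Φ G' i y)ᵀ * B' (Φ y) + B' (Φ y) * pullGam Φ G' i y)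
        * jac Φ y := by
    rw [pullGam, ← sum_transpose_add_smul]
    simp only [cov2, Matrix.mul_sum, Matrix.sum_mul, Matrix.mul_smul, Matrix.smul_mul,
      ← Finset.sum_sub_distrib, ← smul_sub, Matrix.mul_sub, Matrix.sub_mul]
  rw [e2, cov2, mpd_congr so hB hy, mpd_mul so (h.smooth_jac.transpose.mul sB) h.smooth_jac hy,
    mpd_mul so h.smooth_jac.transpose sB hy, mpd_transpose,
    mpd_comp so h.right.isOpen h.smooth h.mapsTo hB' hy, hB y hy]
  simp only [Matrix.mul_assoc, h.jac_mul_gam hy]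
  simp only [← Matrix.mul_assoc, e1]
  noncomm_ring

/-- The transformation law of `d^∇ 𝔨`. -/
theorem IsLocalIsom.dSchouten_eq (hn : 4 ≤ n) (h : IsLocalIsom U V Φ G G') (hy : y ∈ U)
    (i j k : Fin n) :
    dSchouten G i j k y = ∑ a, ∑ b, ∑ c,
      jac Φ y a i * jac Φ y b j * jac Φ y c k * dSchouten G' a b c (Φ y) := by
  have e : ∀ i j k, cov2 G (schM G) i y j k = ∑ a, ∑ b, ∑ c,
      jac Φ y a i * jac Φ y b j * jac Φ y c k * cov2 G' (schM G') a (Φ y) b c := by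
    intro i j k
    rw [h.cov2_eq hy h.right.smooth_schM (fun z hz => h.schM_eq hn hz)]
    simp only [Matrix.sum_apply, Matrix.smul_apply, smul_eq_mul]
    refine Finset.sum_congr rfl fun a _ => ?_
    simp only [Matrix.mul_apply, Matrix.transpose_apply, Finset.sum_mul, Finset.mul_sum]
    rw [Finset.sum_comm]
    exact Finset.sum_congr rfl fun c _ => Finset.sum_congr rfl fun d _ => by ring
  simp only [ConfWeyl.dSchouten_eq, e, mul_sub, Finset.sum_sub_distrib]
  congr 1
  rw [Finset.sum_comm]
  exact Finset.sum_congr rfl fun a _ => Finset.sum_congr rfl fun b _ =>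
    Finset.sum_congr rfl fun c _ => by ring

/-- If `C' = W'(·,·,·,t')` and `t' = dΦ(t)`, then `C = W(·,·,·,t)`. -/
theorem IsLocalIsom.dSchouten_eq_weyl (hn : 4 ≤ n) (h : IsLocalIsom U V Φ G G') (hy : y ∈ U)
    {t t' : Fin n → ℝ} (ht : t' = jac Φ y *ᵥ t)
    (hC : ∀ i j k, dSchouten G' i j k (Φ y) = ∑ l, t' l * weyl G' i j k l (Φ y)) (i j k : Fin n) :
    dSchouten G i j k y = ∑ l, t l * weyl G i j k l y := by
  rw [h.dSchouten_eq hn hy]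
  simp only [hC, h.weyl_eq hn hy, pull4_eq, ht, Matrix.mulVec, dotProduct, Finset.mul_sum,
    Finset.sum_mul]
  have c5 : ∀ F : Fin n → Fin n → Fin n → Fin n → Fin n → ℝ,
      ∑ l, ∑ a, ∑ b, ∑ c, ∑ d, F l a b c d = ∑ a, ∑ b, ∑ c, ∑ d, ∑ l, F l a b c d := by
    intro F
    rw [Finset.sum_comm]
    refine Finset.sum_congr rfl fun a _ => ?_
    rw [Finset.sum_comm]
    refine Finset.sum_congr rfl fun b _ => ?_
    rw [Finset.sum_comm]
    exact Finset.sum_congr rfl fun c _ => Finset.sum_comm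
  refine Eq.trans ?_ (c5 _).symm
  refine Finset.sum_congr rfl fun a _ => Finset.sum_congr rfl fun b _ =>
    Finset.sum_congr rfl fun c _ => Finset.sum_congr rfl fun d _ =>
    Finset.sum_congr rfl fun l _ => by ring

/-- This form is for comparing kernels: v lies in the kernel of W as soon as Jv lies in that of W'.
-/
theorem IsLocalIsom.weyl_contract (hn : 4 ≤ n) (h : IsLocalIsom U V Φ G G') (hy : y ∈ U)
    (v : Fin n → ℝ) (j k l : Fin n) :
    ∑ i, v i * weyl G i j k l y = ∑ b, ∑ c, ∑ d, jac Φ y b j * jac Φ y c k * jac Φ y d l *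
      ∑ a, (jac Φ y *ᵥ v) a * weyl G' a b c d (Φ y) := by
  simp only [h.weyl_eq hn hy, pull4_eq, Matrix.mulVec, dotProduct, Finset.mul_sum, Finset.sum_mul]
  have c4 : ∀ F : Fin n → Fin n → Fin n → Fin n → ℝ,
      ∑ a, ∑ b, ∑ c, ∑ d, F a b c d = ∑ b, ∑ c, ∑ d, ∑ a, F a b c d := by
    intro F
    rw [Finset.sum_comm]
    refine Finset.sum_congr rfl fun b _ => ?_
    rw [Finset.sum_comm]
    exact Finset.sum_congr rfl fun c _ => Finset.sum_comm
  have c5 : ∀ F : Fin n → Fin n → Fin n → Fin n → Fin n → ℝ,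
      ∑ i, ∑ a, ∑ b, ∑ c, ∑ d, F i a b c d = ∑ b, ∑ c, ∑ d, ∑ a, ∑ i, F i a b c d := by
    intro F
    rw [Finset.sum_congr rfl fun i _ => c4 _, c4]
    exact Finset.sum_congr rfl fun b _ => Finset.sum_congr rfl fun c _ =>
      Finset.sum_congr rfl fun d _ => Finset.sum_comm
  rw [c5]
  refine Finset.sum_congr rfl fun b _ => Finset.sum_congr rfl fun c _ =>
    Finset.sum_congr rfl fun d _ => Finset.sum_congr rfl fun a _ =>
    Finset.sum_congr rfl fun i _ => by ring

/-- The transformation law of the exterior derivative of a one form. -/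
theorem pd_pullback_sub (hU : IsOpen U) (hV : IsOpen V) (hΦ : ContDiffOn ℝ ∞ Φ U)
    (hm : ∀ z ∈ U, Φ z ∈ V) (hy : y ∈ U) {θ θ' : Fin n → Coord n → ℝ}
    (hθ' : ∀ a, ContDiffOn ℝ ∞ (θ' a) V)
    (hθ : ∀ z ∈ U, ∀ i, θ i z = ∑ a, jac Φ z a i * θ' a (Φ z)) (i j : Fin n) :
    pd i (θ j) y - pd j (θ i) y = ∑ a, ∑ b, jac Φ y a i * jac Φ y b j *
      (pd a (θ' b) (Φ y) - pd b (θ' a) (Φ y)) := by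
  have sJ := smooth_jac hU hΦ
  have sθ : ∀ a, ContDiffOn ℝ ∞ (fun z => θ' a (Φ z)) U := fun a => (hθ' a).comp hΦ hm
  have e : ∀ i j, pd i (θ j) y = ∑ a, pd i (fun z => jac Φ z a j) y * θ' a (Φ y)
      + ∑ a, ∑ b, jac Φ y a j * (jac Φ y b i * pd b (θ' a) (Φ y)) := by
    intro i j
    rw [pd_congr hU (fun z hz => hθ z hz j) hy, pd_sum hU _ (fun a _ => (sJ a j).mul (sθ a)) hy,
      ← Finset.sum_add_distrib]
    refine Finset.sum_congr rfl fun a _ => ?_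
    rw [pd_mul hU (sJ a j) (sθ a) hy, pd_comp hU hV hΦ hm (hθ' a) hy, Finset.mul_sum]
    rfl
  rw [e, e]
  simp only [pd_jac hU hΦ hy i j, mul_sub, Finset.sum_sub_distrib]
  rw [add_sub_add_left_eq_sub]
  congr 1
  · rw [Finset.sum_comm]
    exact Finset.sum_congr rfl fun a _ => Finset.sum_congr rfl fun b _ => by ring
  · exact Finset.sum_congr rfl fun a _ => Finset.sum_congr rfl fun b _ => by ring

end CoordinateChange

/-! ## The divergence of `d^∇ 𝔨` -/

section CottonDivergence

variable {n : ℕ} {U : Set (Coord n)} {G : Coord n → Matrix (Fin n) (Fin n) ℝ} {y : Coord n}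

theorem MetricOn.smooth_cov2 (h : MetricOn U G) {B : Coord n → Matrix (Fin n) (Fin n) ℝ}
    (hB : SmoothMat U B) (a : Fin n) : SmoothMat U (cov2 G B a) :=
  (hB.mpd h.isOpen a).sub (((h.smooth_gam a).transpose.mul hB).add (hB.mul (h.smooth_gam a)))

/-- The second covariant derivative `(∇²B)(∂ₐ, ∂ᵢ)` of a `(0,2)` tensor field. -/
noncomputable def cov22 (G B : Coord n → Matrix (Fin n) (Fin n) ℝ) (a i : Fin n) (y : Coord n) :
    Matrix (Fin n) (Fin n) ℝ :=
  cov2 G (cov2 G B i) a y - ∑ m, christoffel G m a i y • cov2 G B m y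

/-- The Ricci identity for `(0,2)` tensor fields. -/
theorem MetricOn.cov22_sub (h : MetricOn U G) (hy : y ∈ U)
    {B : Coord n → Matrix (Fin n) (Fin n) ℝ} (hB : SmoothMat U B) (a i : Fin n) :
    cov22 G B a i y = cov22 G B i a y - ((curv G a i y)ᵀ * B y + B y * curv G a i y) := by
  have so := h.isOpen
  have sg := h.smooth_gam
  have e : ∀ a i, mpd a (cov2 G B i) y = mpd a (mpd i B) y
      - (((mpd a (gam G i) y)ᵀ * B y + (gam G i y)ᵀ * mpd a B y)
        + (mpd a B y * gam G i y + B y * mpd a (gam G i) y)) := by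
    intro a i
    show mpd a (fun z => mpd i B z - ((gam G i z)ᵀ * B z + B z * gam G i z)) y = _
    rw [mpd_sub so (hB.mpd so i) (((sg i).transpose.mul hB).add (hB.mul (sg i))) hy,
      mpd_add so ((sg i).transpose.mul hB) (hB.mul (sg i)) hy,
      mpd_mul so (sg i).transpose hB hy, mpd_mul so hB (sg i) hy, mpd_transpose]
  have c := mpd_comm so hB hy a i
  have t : ∑ m, christoffel G m a i y • cov2 G B m y = ∑ m, christoffel G m i a y • cov2 G B m y := by
    simp only [h.christoffel_comm _ a i]
  rw [cov22, cov22, t]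
  generalize ∑ m, christoffel G m i a y • cov2 G B m y = S
  simp only [cov2, curv] at e ⊢
  rw [e, e, c]
  simp only [Matrix.transpose_add, Matrix.transpose_sub, Matrix.transpose_mul]
  noncomm_ring

/-- The covariant derivative of a `(0,3)` tensor field. -/
noncomputable def covDeriv3 (G : Coord n → Matrix (Fin n) (Fin n) ℝ)
    (A : Fin n → Fin n → Fin n → Coord n → ℝ) (a i j k : Fin n) (y : Coord n) : ℝ :=
  pd a (A i j k) y - ∑ m, (christoffel G m a i y * A m j k y + christoffel G m a j y * A i m k y
    + christoffel G m a k y * A i j m y)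

theorem cov22_apply (B : Coord n → Matrix (Fin n) (Fin n) ℝ) (a i j k : Fin n) :
    cov22 G B a i y j k = pd a (fun z => cov2 G B i z j k) y
      - ∑ m, (christoffel G m a i y * cov2 G B m y j k + christoffel G m a j y * cov2 G B i y m k
        + christoffel G m a k y * cov2 G B i y j m) := by
  rw [cov22, Matrix.sub_apply, ← covDeriv2_eq, covDeriv2, sub_sub]
  congr 1
  simp only [Matrix.sum_apply, Matrix.smul_apply, smul_eq_mul, ← Finset.sum_add_distrib]
  exact Finset.sum_congr rfl fun m _ => by ring

theorem MetricOn.covDeriv3_dSchouten (h : MetricOn U G) (hy : y ∈ U) (a i j k : Fin n) :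
    covDeriv3 G (dSchouten G) a i j k y =
      cov22 G (schM G) a i y j k - cov22 G (schM G) a j y i k := by
  have sK := h.smooth_cov2 h.smooth_schM
  have e : pd a (dSchouten G i j k) y = pd a (fun z => cov2 G (schM G) i z j k) y
      - pd a (fun z => cov2 G (schM G) j z i k) y := by
    rw [← pd_sub h.isOpen (sK i j k) (sK j i k) hy]
    exact pd_congr h.isOpen (fun z _ => dSchouten_eq i j k) hy a
  rw [covDeriv3, e, cov22_apply, cov22_apply, sub_sub_sub_comm]
  congr 1
  rw [← Finset.sum_sub_distrib]
  refine Finset.sum_congr rfl fun m _ => ?_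
  simp only [dSchouten_eq]
  ring

/-- These are the curvature terms from commuting ∇ᵃ past ∇ᵢ. One is the contraction of R with 𝔨,
symmetric by pair symmetry. The other is Ric composed with 𝔨, symmetric because Ric is a combination
of 𝔨 and g. -/
theorem MetricOn.contr_schM_curv_comm (hn : 4 ≤ n) (h : MetricOn U G) (hy : y ∈ U) (i j : Fin n) :
    contr (invMetric G y) (Matrix.of fun a k =>
      ((curv G a i y)ᵀ * schM G y + schM G y * curv G a i y) j k) =
    contr (invMetric G y) (Matrix.of fun a k =>
      ((curv G a j y)ᵀ * schM G y + schM G y * curv G a j y) i k) := by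
  set H := invMetric G y with hH
  set K := schM G y with hK
  have hKs : Kᵀ = K := h.schM_symm hy
  have hHs : Hᵀ = H := h.inv_transpose y
  have hR := h.isCurvTensor_riem hy
  have hc : ∀ a i, (curv G a i y)ᵀ * K = (curv G a i y)ᵀ * G y * (H * K) := by
    intro a i
    rw [Matrix.mul_assoc, ← Matrix.mul_assoc (G y), h.mul_inv hy, Matrix.one_mul]
  have hc1 : ∀ a i p q, ((curv G a i y)ᵀ * K) p q = ∑ l, riem G a i p l y * (H * K) l q := by
    intro a i p q
    rw [hc, Matrix.mul_apply]
    simp only [← riem_eq]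
  have hc2 : ∀ a i p q, (K * curv G a i y) p q = ∑ l, riem G a i q l y * (H * K) l p := by
    intro a i p q
    rw [← hc1]
    have : K * curv G a i y = ((curv G a i y)ᵀ * K)ᵀ := by
      rw [Matrix.transpose_mul, hKs, Matrix.transpose_transpose]
    rw [this, Matrix.transpose_apply]
  have hX : (H * K * H)ᵀ = H * K * H := by
    simp only [Matrix.transpose_mul, hHs, hKs, Matrix.mul_assoc]
  have p1 : ∀ i j, contr H (Matrix.of fun a k => ((curv G a i y)ᵀ * K) j k) =
      contr (H * K * H) (Matrix.of fun a l => riem G a i j l y) := by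
    intro i j
    simp only [contr, Matrix.of_apply, hc1, Finset.mul_sum]
    refine Finset.sum_congr rfl fun a _ => ?_
    rw [Finset.sum_comm]
    refine Finset.sum_congr rfl fun l _ => ?_
    rw [← congrFun (congrFun hX a) l, Matrix.transpose_apply, Matrix.mul_apply (M := H * K),
      Finset.sum_mul]
    refine Finset.sum_congr rfl fun k _ => ?_
    rw [← congrFun (congrFun hHs a) k, Matrix.transpose_apply]
    ring
  have p2 : ∀ i j, contr H (Matrix.of fun a k => (K * curv G a i y) j k) =
      -(ricM G y * (H * K)) i j := by
    intro i j
    have hr : ∀ l, contr H (Matrix.of fun a k => riem G a i k l y) = -ricM G y i l := by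
      intro l
      have : (Matrix.of fun a k => riem G a i k l y) = -(Matrix.of fun a k => riem G a i l k y) := by
        ext a k
        exact hR.swap34 a i l k
      rw [this, contr_neg]
      rfl
    rw [Matrix.mul_apply, ← Finset.sum_neg_distrib]
    simp only [← neg_mul, ← hr, contr, Matrix.of_apply, hc2, Finset.mul_sum, Finset.sum_mul]
    rw [Finset.sum_congr rfl fun a _ => Finset.sum_comm, Finset.sum_comm]
    exact Finset.sum_congr rfl fun a _ => Finset.sum_congr rfl fun b _ =>
      Finset.sum_congr rfl fun c _ => by ring
  have s1 : contr (H * K * H) (Matrix.of fun a l => riem G a i j l y) =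
      contr (H * K * H) (Matrix.of fun a l => riem G a j i l y) := by
    rw [← contr_transpose hX]
    congr 1
    ext a l
    have e1 := hR.pair l i j a
    have e2 := hR.swap12 a j l i
    have e3 := hR.swap34 a j i l
    simp only [Matrix.transpose_apply, Matrix.of_apply] at *
    linarith [hR.swap12 j a l i]
  have s2 : (ricM G y * (H * K))ᵀ = ricM G y * (H * K) := by
    rw [h.ricM_eq hn hy, Matrix.add_mul, Matrix.smul_mul, Matrix.smul_mul, ← Matrix.mul_assoc (G y),
      h.mul_inv hy, Matrix.one_mul, ← hK]
    simp only [Matrix.transpose_add, Matrix.transpose_smul, Matrix.transpose_mul, hKs, hHs,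
      Matrix.mul_assoc]
  have sp : ∀ i j, (Matrix.of fun a k => ((curv G a i y)ᵀ * K + K * curv G a i y) j k) =
      (Matrix.of fun a k => ((curv G a i y)ᵀ * K) j k)
      + Matrix.of fun a k => (K * curv G a i y) j k := fun i j => rfl
  rw [sp, sp, contr_add, contr_add, p1, p1, p2, p2, s1, ← congrFun (congrFun s2 i) j,
    Matrix.transpose_apply]

/-- The contraction commutes with the outer derivative, and div 𝔨 = d(tr 𝔨). The result is a
Hessian, hence symmetric in i, j. -/
theorem MetricOn.contr_cov22_schM (hn : 4 ≤ n) (h : MetricOn U G) (hy : y ∈ U) (i j : Fin n) :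
    contr (invMetric G y) (Matrix.of fun a k => cov22 G (schM G) i a y j k) =
      hess G (fun z => contr (invMetric G z) (schM G z)) y i j := by
  have so := h.isOpen
  have sK := h.smooth_cov2 h.smooth_schM
  have e1 : ∀ z ∈ U, ∀ j, contr (invMetric G z) (Matrix.of fun a k => cov2 G (schM G) a z j k) =
      pd j (fun z => contr (invMetric G z) (schM G z)) z := by
    intro z hz j
    rw [h.div_schM hn hz, h.pd_contr hz h.smooth_schM]
  have e2 := h.pd_contr hy (B := fun z => Matrix.of fun a k => cov2 G (schM G) a z j k)
    (fun a k => sK a j k) i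
  rw [pd_congr so (fun z hz => e1 z hz j) hy] at e2
  simp only [hess, Matrix.of_apply, e2, ← e1 y hy, ← contr_smul]
  rw [← contr_sum, ← contr_sub]
  congr 1
  ext a k
  rw [Matrix.of_apply, cov22_apply, Matrix.sub_apply, ← covDeriv2_eq]
  simp only [covDeriv2, Matrix.sum_apply, Matrix.smul_apply, Matrix.of_apply, smul_eq_mul, sub_sub,
    ← Finset.sum_add_distrib]
  congr 1
  exact Finset.sum_congr rfl fun m _ => by ring

/-- `d^∇ 𝔨` is divergence free. -/
theorem MetricOn.div_dSchouten (hn : 4 ≤ n) (h : MetricOn U G) (hy : y ∈ U) (i j : Fin n) :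
    contr (invMetric G y) (Matrix.of fun a k => covDeriv3 G (dSchouten G) a i j k y) = 0 := by
  have e : (Matrix.of fun a k => covDeriv3 G (dSchouten G) a i j k y) =
      ((Matrix.of fun a k => cov22 G (schM G) i a y j k) - Matrix.of fun a k =>
        ((curv G a i y)ᵀ * schM G y + schM G y * curv G a i y) j k)
      - ((Matrix.of fun a k => cov22 G (schM G) j a y i k) - Matrix.of fun a k =>
        ((curv G a j y)ᵀ * schM G y + schM G y * curv G a j y) i k) := by
    ext a k
    rw [Matrix.of_apply, h.covDeriv3_dSchouten hy, h.cov22_sub hy h.smooth_schM a i,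
      h.cov22_sub hy h.smooth_schM a j]
    rfl
  rw [e, contr_sub, contr_sub, contr_sub, h.contr_schM_curv_comm hn hy i j,
    h.contr_cov22_schM hn hy, h.contr_cov22_schM hn hy,
    h.hess_symm (smooth_contr h.smooth_inv h.smooth_schM) hy i j]
  ring

theorem MetricOn.covDeriv4_weyl_swap34 (h : MetricOn U G) (hy : y ∈ U) (a i j k l : Fin n) :
    covDeriv4 G (weyl G) a i j l k y = -covDeriv4 G (weyl G) a i j k l y := by
  rw [h.covDeriv4_weyl hy, h.covDeriv4_weyl hy, h.covDeriv4_riem_swap34 hy]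
  simp only [kn]
  ring

theorem contr_left_transpose (p q : Matrix (Fin n) (Fin n) ℝ) : contr pᵀ qᵀ = contr p q := by
  rw [contr, contr, Finset.sum_comm]
  rfl

/-- If `d^∇ 𝔨 = W(·,·,·,T)`, then the Weyl tensor annihilates `dT^*`. -/
theorem MetricOn.weyl_exterior_eq_zero (hn : 4 ≤ n) (h : MetricOn U G) {T τ : Fin n → Coord n → ℝ}
    (hT : ∀ l, ContDiffOn ℝ ∞ (T l) U)
    (hC : ∀ z ∈ U, ∀ i j k, dSchouten G i j k z = ∑ l, T l z * weyl G i j k l z)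
    (hτ : ∀ z ∈ U, ∀ b, τ b z = ∑ l, G z b l * T l z) (hy : y ∈ U) (i j : Fin n) :
    contr (invMetric G y * (Matrix.of fun a b => pd a (τ b) y - pd b (τ a) y) * invMetric G y)
      (Matrix.of fun k l => weyl G i j k l y) = 0 := by
  have so := h.isOpen
  have hW := h.isCurvTensor_weyl hy
  set H := invMetric G y with hH
  set w : Matrix (Fin n) (Fin n) ℝ := Matrix.of fun k l => weyl G i j k l y with hw
  -- `N` holds the components of ∇T and `Y` those of ∇τ; `hNY` says that lowering an index commutes
  -- with ∇.
  set N : Matrix (Fin n) (Fin n) ℝ := Matrix.of fun a l =>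
    pd a (T l) y + ∑ m, christoffel G l a m y * T m y with hN
  set Y : Matrix (Fin n) (Fin n) ℝ := Matrix.of fun a b =>
    pd a (τ b) y - ∑ m, christoffel G m a b y * τ m y with hY
  have hNY : N * G y = Y := by
    ext a b
    have h1 : pd a (τ b) y = ∑ l, ((∑ m, (christoffel G m a b y * G y m l
        + christoffel G m a l y * G y b m)) * T l y + G y b l * pd a (T l) y) := by
      rw [pd_congr so (fun z hz => hτ z hz b) hy,
        pd_sum so _ (fun l _ => (h.smooth b l).mul (hT l)) hy]
      refine Finset.sum_congr rfl fun l _ => ?_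
      have h2 := congrFun (congrFun (h.mpd_metric hy a) b) l
      rw [pd_mul so (h.smooth b l) (hT l) hy]
      congr 2
      refine h2.trans ?_
      simp only [Matrix.add_apply, Matrix.mul_apply, Matrix.transpose_apply, gam, Matrix.of_apply,
        ← Finset.sum_add_distrib]
      exact Finset.sum_congr rfl fun m _ => by ring
    simp only [hY, hN, Matrix.mul_apply, Matrix.of_apply, h1, hτ y hy, add_mul,
      Finset.sum_add_distrib, Finset.sum_mul, Finset.mul_sum]
    have c1 : ∑ l, ∑ m, christoffel G m a b y * G y m l * T l y =
        ∑ m, ∑ l, christoffel G m a b y * (G y m l * T l y) := by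
      rw [Finset.sum_comm]
      exact Finset.sum_congr rfl fun m _ => Finset.sum_congr rfl fun l _ => by ring
    have c2 : ∑ l, ∑ m, christoffel G m a l y * G y b m * T l y =
        ∑ m, ∑ l, christoffel G m a l y * T l y * G y m b := by
      rw [Finset.sum_comm]
      refine Finset.sum_congr rfl fun m _ => Finset.sum_congr rfl fun l _ => ?_
      rw [h.apply_comm y b m]
      ring
    have c3 : ∑ l, pd a (T l) y * G y l b = ∑ l, G y b l * pd a (T l) y := by
      refine Finset.sum_congr rfl fun l _ => ?_
      rw [h.apply_comm y b l, mul_comm]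
    rw [c1, c2, c3]
    ring
  have hNH : N = Y * H := by
    rw [← hNY, Matrix.mul_assoc, h.mul_inv hy, Matrix.mul_one]
  have hD : ∀ a k, covDeriv3 G (dSchouten G) a i j k y =
      ∑ l, T l y * covDeriv4 G (weyl G) a i j k l y + ∑ l, N a l * weyl G i j k l y := by
    intro a k
    have h1 : pd a (dSchouten G i j k) y =
        ∑ l, (pd a (T l) y * weyl G i j k l y + T l y * pd a (weyl G i j k l) y) := by
      rw [pd_congr so (fun z hz => hC z hz i j k) hy,
        pd_sum so _ (fun l _ => (hT l).mul (h.smooth_weyl i j k l)) hy]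
      exact Finset.sum_congr rfl fun l _ => pd_mul so (hT l) (h.smooth_weyl i j k l) hy a
    have c1 : ∑ l, (∑ m, christoffel G l a m y * T m y) * weyl G i j k l y =
        ∑ l, T l y * ∑ m, christoffel G m a l y * weyl G i j k m y := by
      simp only [Finset.sum_mul, Finset.mul_sum]
      rw [Finset.sum_comm]
      exact Finset.sum_congr rfl fun m _ => Finset.sum_congr rfl fun l _ => by ring
    have c2 : ∑ m, (christoffel G m a i y * dSchouten G m j k y
        + christoffel G m a j y * dSchouten G i m k y + christoffel G m a k y * dSchouten G i j m y) =
        ∑ l, T l y * ∑ m, (christoffel G m a i y * weyl G m j k l y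
        + christoffel G m a j y * weyl G i m k l y + christoffel G m a k y * weyl G i j m l y) := by
      simp only [hC y hy, Finset.mul_sum, ← Finset.sum_add_distrib]
      rw [Finset.sum_comm]
      exact Finset.sum_congr rfl fun m _ => Finset.sum_congr rfl fun l _ => by ring
    simp only [hN, Matrix.of_apply, add_mul, Finset.sum_add_distrib (f := fun l => pd a (T l) y * _)]
    rw [c1, covDeriv3, h1, c2]
    simp only [covDeriv4, ← Finset.sum_add_distrib, ← Finset.sum_sub_distrib]
    refine Finset.sum_congr rfl fun l _ => ?_
    simp only [Finset.sum_add_distrib]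
    ring
  -- The divergence of W in its third slot is a multiple of d^∇𝔨, hence of W(·,·,·,T). A further
  -- contraction with T vanishes by skewness in the last pair.
  have hdiv : ∑ l, T l y * contr H (Matrix.of fun a k => covDeriv4 G (weyl G) a i j k l y) = 0 := by
    have h1 : ∀ l, contr H (Matrix.of fun a k => covDeriv4 G (weyl G) a i j k l y) =
        -((n : ℝ) - 3) * ∑ m, T m y * weyl G i j l m y := by
      intro l
      rw [← hC y hy, neg_mul, ← h.divWeyl_eq hn hy]
      have : (Matrix.of fun a k => covDeriv4 G (weyl G) a i j k l y) =
          -(Matrix.of fun a k => covDeriv4 G (weyl G) a i j l k y) := by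
        ext a k
        exact h.covDeriv4_weyl_swap34 hy a i j l k
      rw [this, contr_neg]
      rfl
    have h2 : ∑ l, ∑ m, T l y * (T m y * weyl G i j l m y) = 0 := by
      have h3 : ∑ l, ∑ m, T l y * (T m y * weyl G i j l m y) =
          -∑ l, ∑ m, T l y * (T m y * weyl G i j l m y) := by
        conv_lhs => rw [Finset.sum_comm]
        rw [← Finset.sum_neg_distrib]
        refine Finset.sum_congr rfl fun l _ => ?_
        rw [← Finset.sum_neg_distrib]
        refine Finset.sum_congr rfl fun m _ => ?_
        have := hW.swap34 i j l m
        rw [this]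
        ring
      linarith
    simp only [h1, Finset.mul_sum]
    calc ∑ l, ∑ m, T l y * (-((n : ℝ) - 3) * (T m y * weyl G i j l m y))
        = -((n : ℝ) - 3) * ∑ l, ∑ m, T l y * (T m y * weyl G i j l m y) := by
          simp only [Finset.mul_sum]
          exact Finset.sum_congr rfl fun l _ => Finset.sum_congr rfl fun m _ => by ring
      _ = 0 := by rw [h2, mul_zero]
  have hmain : contr (H * Y * H) w = 0 := by
    have h0 := h.div_dSchouten hn hy i j
    have h1 : (Matrix.of fun a k => covDeriv3 G (dSchouten G) a i j k y) =
        (∑ l, T l y • Matrix.of fun a k => covDeriv4 G (weyl G) a i j k l y) + N * wᵀ := by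
      ext a k
      rw [Matrix.of_apply, hD]
      simp only [Matrix.add_apply, Matrix.sum_apply, Matrix.smul_apply, Matrix.of_apply,
        smul_eq_mul, Matrix.mul_apply, Matrix.transpose_apply, hw]
    rw [h1, contr_add, contr_sum] at h0
    simp only [contr_smul] at h0
    rw [hdiv, zero_add, contr_eq_trace, Matrix.transpose_mul, Matrix.transpose_transpose, hNH,
      Matrix.transpose_mul, h.inv_transpose] at h0
    have hHs : Hᵀ = H := h.inv_transpose y
    rw [← h0, contr_eq_trace, ← Matrix.trace_transpose]
    simp only [Matrix.transpose_mul, Matrix.transpose_transpose, hHs, ← hH]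
    rw [← Matrix.mul_assoc, ← Matrix.mul_assoc, Matrix.trace_mul_comm, Matrix.mul_assoc w]
  have hwt : wᵀ = -w := by
    ext k l
    exact hW.swap34 i j k l
  -- By the symmetry of Γ, dτ is twice the skew part of ∇τ, and W is skew in the contracted pair.
  have hsplit : (Matrix.of fun a b => pd a (τ b) y - pd b (τ a) y) = Y - Yᵀ := by
    ext a b
    simp only [hY, Matrix.of_apply, Matrix.sub_apply, Matrix.transpose_apply,
      h.christoffel_comm _ a b]
    ring
  have ht : H * Yᵀ * H = (H * Y * H)ᵀ := by
    simp only [Matrix.transpose_mul, hH, h.inv_transpose, Matrix.mul_assoc]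
  have hsub : ∀ p q : Matrix (Fin n) (Fin n) ℝ, contr (p - q) w = contr p w - contr q w := by
    intro p q
    simp [contr_eq_trace, Matrix.sub_mul]
  rw [hsplit, Matrix.mul_sub, Matrix.sub_mul, hsub, ht, ← contr_left_transpose (H * Y * H)ᵀ,
    Matrix.transpose_transpose, hwt, contr_neg, hmain]
  ring

end CottonDivergence

/-! ## Curvature operators -/

section CurvatureOperator

variable {n : ℕ} {g h : Matrix (Fin n) (Fin n) ℝ} {A : Fin n → Fin n → Fin n → Fin n → ℝ}

theorem curvOp_eq (hh : hᵀ = h) (b : Matrix (Fin n) (Fin n) ℝ) (k l : Fin n) :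
    curvOp h A b k l = contr (h * b * h) (Matrix.of fun i j => A j k l i) := by
  have e : ∀ i j, (h * b * h) i j = ∑ a, ∑ c, b a c * h a i * h c j := by
    intro i j
    simp only [Matrix.mul_apply, Finset.sum_mul]
    rw [Finset.sum_comm]
    refine Finset.sum_congr rfl fun a _ => Finset.sum_congr rfl fun c _ => ?_
    rw [← congrFun (congrFun hh a) i, Matrix.transpose_apply]
    ring
  simp only [curvOp, contr, Matrix.of_apply, e, Finset.sum_mul]
  rw [Finset.sum_congr rfl fun a _ => Finset.sum_comm, Finset.sum_comm]
  refine Finset.sum_congr rfl fun i _ => ?_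
  rw [Finset.sum_congr rfl fun a _ => Finset.sum_comm, Finset.sum_comm]

theorem curvOp_add (b c : Matrix (Fin n) (Fin n) ℝ) :
    curvOp h A (b + c) = curvOp h A b + curvOp h A c := by
  ext k l
  simp only [curvOp, Matrix.of_apply, Matrix.add_apply, add_mul, Finset.sum_add_distrib]

theorem curvOp_smul (r : ℝ) (b : Matrix (Fin n) (Fin n) ℝ) :
    curvOp h A (r • b) = r • curvOp h A b := by
  ext k l
  simp only [curvOp, Matrix.of_apply, Matrix.smul_apply, smul_eq_mul, Finset.mul_sum, mul_assoc]

/-- The action of a curvature tensor on `(0,2)` tensors as a linear map. -/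
def curvOpLin (h : Matrix (Fin n) (Fin n) ℝ) (A : Fin n → Fin n → Fin n → Fin n → ℝ) :
    Matrix (Fin n) (Fin n) ℝ →ₗ[ℝ] Matrix (Fin n) (Fin n) ℝ where
  toFun := curvOp h A
  map_add' := curvOp_add
  map_smul' := curvOp_smul

theorem curvOp_sum {ι : Type*} (s : Finset ι) (c : ι → ℝ) (b : ι → Matrix (Fin n) (Fin n) ℝ) :
    curvOp h A (∑ m ∈ s, c m • b m) = ∑ m ∈ s, c m • curvOp h A (b m) := by
  have := map_sum (curvOpLin h A) (fun m => c m • b m) s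
  simp only [map_smul] at this
  exact this

/-- On two forms the cyclic identity replaces the crossed contraction in `curvOp` by the ordinary
curvature operator; this is the source of the factor 1/2. -/
theorem IsCurvTensor.curvOp_antisymm (hA : IsCurvTensor A) (hh : hᵀ = h)
    {b : Matrix (Fin n) (Fin n) ℝ} (hb : bᵀ = -b) (k l : Fin n) :
    curvOp h A b k l = (1 / 2) * contr (h * b * h) (Matrix.of fun i j => A i j k l) := by
  have hX : (h * b * h)ᵀ = -(h * b * h) := by
    simp only [Matrix.transpose_mul, hh, hb, Matrix.mul_assoc, Matrix.neg_mul, Matrix.mul_neg]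
  have e : (Matrix.of fun i j => A i j k l) =
      (Matrix.of fun i j => A j k l i) - (Matrix.of fun i j => A j k l i)ᵀ := by
    ext i j
    simp only [Matrix.of_apply, Matrix.sub_apply, Matrix.transpose_apply]
    have e1 := hA.pair l i j k
    have e2 := hA.pair l j i k
    have e3 := hA.bianchi l i j k
    have e4 := hA.swap34 l j i k
    have e5 := hA.swap34 i j k l
    have e6 := hA.swap12 j l i k
    linarith
  have e1 : contr (h * b * h) (Matrix.of fun i j => A j k l i)ᵀ =
      -contr (h * b * h) (Matrix.of fun i j => A j k l i) := by
    rw [← contr_left_transpose, hX, Matrix.transpose_transpose]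
    simp [contr_eq_trace]
  rw [e, contr_sub, e1, curvOp_eq hh]
  ring

theorem wedge_transpose (x z : Fin n → ℝ) : (wedge x z)ᵀ = -wedge x z := by
  simp [wedge, Matrix.transpose_sub, Matrix.transpose_vecMulVec]

theorem IsCurvTensor.curvOp_wedge (hA : IsCurvTensor A) (hh : hᵀ = h) (x z : Fin n → ℝ)
    (k l : Fin n) :
    curvOp h A (wedge x z) k l = ∑ i, ∑ j, (h *ᵥ x) i * (h *ᵥ z) j * A i j k l := by
  have e1 : h * wedge x z * h = wedge (h *ᵥ x) (h *ᵥ z) := by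
    simp only [wedge, Matrix.mul_sub, Matrix.sub_mul, Matrix.mul_vecMulVec, Matrix.vecMulVec_mul]
    rw [← Matrix.mulVec_transpose, ← Matrix.mulVec_transpose, hh]
  rw [hA.curvOp_antisymm hh (wedge_transpose x z), e1]
  have e2 : contr (wedge (h *ᵥ x) (h *ᵥ z)) (Matrix.of fun i j => A i j k l) =
      ∑ i, ∑ j, (h *ᵥ x) i * (h *ᵥ z) j * A i j k l
      - ∑ i, ∑ j, (h *ᵥ z) i * (h *ᵥ x) j * A i j k l := by
    simp only [contr, wedge, Matrix.sub_apply, Matrix.vecMulVec_apply, Matrix.of_apply, sub_mul,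
      Finset.sum_sub_distrib]
  have e3 : ∑ i, ∑ j, (h *ᵥ z) i * (h *ᵥ x) j * A i j k l =
      -∑ i, ∑ j, (h *ᵥ x) i * (h *ᵥ z) j * A i j k l := by
    rw [Finset.sum_comm, ← Finset.sum_neg_distrib]
    refine Finset.sum_congr rfl fun i _ => ?_
    rw [← Finset.sum_neg_distrib]
    refine Finset.sum_congr rfl fun j _ => ?_
    rw [hA.swap12 i j k l]
    ring
  rw [e2, e3]
  ring

theorem ricSq_mulVec (θ : Fin n → ℝ) (l : Fin n) :
    (ricSq h A *ᵥ θ) l = ∑ i, curvOp h A (curvOp h A (wedge (Pi.single i 1) θ)) i l := by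
  have hw : ∀ i, wedge (Pi.single i 1) θ =
      ∑ m, θ m • wedge (Pi.single i 1) (Pi.single m 1 : Fin n → ℝ) := by
    intro i
    ext k l
    simp [wedge, Matrix.sum_apply, Matrix.vecMulVec_apply, mul_sub, Finset.sum_sub_distrib,
      Pi.single_apply, mul_comm]
  simp only [hw, curvOp_sum, Matrix.sum_apply, Matrix.smul_apply, smul_eq_mul]
  rw [Finset.sum_comm]
  simp only [ricSq, Matrix.mulVec, dotProduct, Matrix.of_apply, Finset.sum_mul]
  exact Finset.sum_congr rfl fun m _ => Finset.sum_congr rfl fun i _ => mul_comm _ _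

theorem IsCurvTensor.curvOp_wedge_single (hA : IsCurvTensor A) (hh : hᵀ = h) (hg : h * g = 1)
    (V : Fin n → ℝ) (i k l : Fin n) :
    curvOp h A (wedge (Pi.single i 1) (g *ᵥ V)) k l = ∑ p, h p i * ∑ q, V q * A k l p q := by
  rw [hA.curvOp_wedge hh, Matrix.mulVec_mulVec, hg, Matrix.one_mulVec]
  refine Finset.sum_congr rfl fun p _ => ?_
  rw [Finset.mul_sum]
  refine Finset.sum_congr rfl fun q _ => ?_
  simp only [Matrix.mulVec_single_one, Matrix.col_apply, hA.pair k l p q]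
  ring

/-- If `δW = (n-3) W(·,·,·,V)`, then `∑ e ⌟ 𝒲(δW_e) = (n-3) 𝔴(V^*)`. -/
theorem IsCurvTensor.source_eq (hA : IsCurvTensor A) (hh : hᵀ = h) (hgs : gᵀ = g) (hg : h * g = 1)
    (r : ℝ) (V : Fin n → ℝ) {D : Fin n → Fin n → Fin n → ℝ}
    (hD : ∀ i j c, D i j c = r * ∑ q, V q * A i j c q) (l : Fin n) :
    ∑ c, ∑ d, h c d * curvOp h A (Matrix.of fun i j => D i j c) d l =
      r * (ricSq h A *ᵥ (g *ᵥ V)) l := by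
  have hgh : g * h = 1 := mul_eq_one_comm.mp hg
  -- This says δW_{∂_c} = r 𝒲(∂_c^* ∧ V^*), with ∂_c^* written in the basis dxⁱ. Tracing with `h`
  -- then cancels the metric and leaves 𝒲² as in 𝔴.
  have e : ∀ c, (Matrix.of fun i j => D i j c) =
      ∑ i, (r * g c i) • curvOp h A (wedge (Pi.single i 1) (g *ᵥ V)) := by
    intro c
    ext k l
    simp only [Matrix.of_apply, hD, Matrix.sum_apply, Matrix.smul_apply, smul_eq_mul,
      hA.curvOp_wedge_single hh hg, mul_assoc, ← Finset.mul_sum]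
    congr 1
    have : ∑ i, g c i * ∑ p, h p i * ∑ q, V q * A k l p q =
        ∑ p, (g * h) c p * ∑ q, V q * A k l p q := by
      simp only [Matrix.mul_apply, Finset.sum_mul]
      rw [Finset.sum_comm]
      refine Finset.sum_congr rfl fun i _ => ?_
      rw [Finset.mul_sum]
      refine Finset.sum_congr rfl fun p _ => ?_
      rw [← congrFun (congrFun hh p) i, Matrix.transpose_apply]
      ring
    rw [this, hgh]
    simp [Matrix.one_apply]
  simp only [e, curvOp_sum, Matrix.sum_apply, Matrix.smul_apply, smul_eq_mul, ricSq_mulVec]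
  have : ∀ F : Fin n → Matrix (Fin n) (Fin n) ℝ,
      ∑ c, ∑ d, h c d * ∑ i, r * g c i * F i d l = r * ∑ i, ∑ d, (g * h) i d * F i d l := by
    intro F
    simp only [Matrix.mul_apply, Finset.mul_sum, Finset.sum_mul]
    rw [Finset.sum_congr rfl fun c _ => Finset.sum_comm, Finset.sum_comm]
    refine Finset.sum_congr rfl fun i _ => ?_
    rw [Finset.sum_comm]
    refine Finset.sum_congr rfl fun d _ => Finset.sum_congr rfl fun c _ => ?_
    rw [← congrFun (congrFun hgs i) c, Matrix.transpose_apply]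
    ring
  rw [this, hgh]
  simp [Matrix.one_apply]

/-- The kernel of `𝔴` is the nullity of the curvature tensor. -/
theorem IsCurvTensor.eq_zero_of_ricSq (hA : IsCurvTensor A) (hgp : g.PosDef) (hg : h * g = 1)
    (hnull : ∀ v : Fin n → ℝ, (∀ j k l, ∑ i, v i * A i j k l = 0) → v = 0) {V : Fin n → ℝ}
    (hV : ricSq h A *ᵥ (g *ᵥ V) = 0) : V = 0 := by
  have hgh : g * h = 1 := mul_eq_one_comm.mp hg
  have hhp : h.PosDef := by
    rw [← Matrix.inv_eq_left_inv hg]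
    exact hgp.inv
  have hh : hᵀ = h := by
    simpa [Matrix.conjTranspose_eq_transpose_of_trivial] using hhp.1.eq
  set B : Fin n → Matrix (Fin n) (Fin n) ℝ := fun i => Matrix.of fun a b => ∑ q, V q * A a b i q
    with hB
  have hc : ∀ i, curvOp h A (wedge (Pi.single i 1) (g *ᵥ V)) = ∑ p, h p i • B p := by
    intro i
    ext k l
    simp only [hA.curvOp_wedge_single hh hg, Matrix.sum_apply, Matrix.smul_apply, smul_eq_mul, hB,
      Matrix.of_apply]
  have hBt : ∀ p, (B p)ᵀ = -B p := by
    intro p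
    ext k l
    simp only [hB, Matrix.transpose_apply, Matrix.neg_apply, Matrix.of_apply,
      ← Finset.sum_neg_distrib]
    refine Finset.sum_congr rfl fun q _ => ?_
    rw [hA.swap12 k l p q]
    ring
  have h0 : ∑ l, V l * (ricSq h A *ᵥ (g *ᵥ V)) l = 0 := by
    rw [hV]
    simp
  -- The pairing of 𝔴(V^*) with V is half the squared norm of A(·,·,·,V).
  have h1 : ∑ l, V l * (ricSq h A *ᵥ (g *ᵥ V)) l =
      (1 / 2) * ∑ i, ∑ p, h p i * contr (h * B p * h) (B i) := by
    simp only [ricSq_mulVec, hc, curvOp_sum, Matrix.sum_apply, Matrix.smul_apply, smul_eq_mul,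
      hA.curvOp_antisymm hh (hBt _)]
    have : ∀ p i, contr (h * B p * h) (B i) =
        ∑ l, V l * contr (h * B p * h) (Matrix.of fun a b => A a b i l) := by
      intro p i
      have : B i = ∑ l, V l • Matrix.of fun a b => A a b i l := by
        ext a b
        simp [hB, Matrix.sum_apply]
      rw [this, contr_sum]
      simp only [contr_smul]
    simp only [this, Finset.mul_sum]
    rw [Finset.sum_comm]
    refine Finset.sum_congr rfl fun i _ => ?_
    rw [Finset.sum_comm]
    exact Finset.sum_congr rfl fun p _ => Finset.sum_congr rfl fun l _ => by ring
  -- The components of A(·,·,·,V) form one vector, whose squared norm has Gram matrix h ⊗ h ⊗ h.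
  -- Positivity of the metric enters through this Kronecker product.
  set x : Fin n × (Fin n × Fin n) → ℝ := fun t => B t.1 t.2.1 t.2.2 with hx
  have hK : (Matrix.kroneckerMap (· * ·) h (Matrix.kroneckerMap (· * ·) h h)).PosDef :=
    hhp.kronecker (hhp.kronecker hhp)
  have hx0 : x = 0 := by
    by_contra hne
    have hpos := hK.dotProduct_mulVec_pos hne
    have : star x ⬝ᵥ Matrix.kroneckerMap (· * ·) h (Matrix.kroneckerMap (· * ·) h h) *ᵥ x =
        ∑ i, ∑ p, h p i * contr (h * B p * h) (B i) := by
      simp only [dotProduct, Matrix.mulVec, Fintype.sum_prod_type, Matrix.kroneckerMap_apply, hx,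
        star_trivial, contr, Matrix.mul_apply, Finset.mul_sum, Finset.sum_mul]
      refine Finset.sum_congr rfl fun i _ => ?_
      rw [Finset.sum_congr rfl fun a _ => Finset.sum_comm, Finset.sum_comm]
      refine Finset.sum_congr rfl fun p _ => Finset.sum_congr rfl fun a _ =>
        Finset.sum_congr rfl fun b _ => ?_
      rw [Finset.sum_comm]
      refine Finset.sum_congr rfl fun d _ => Finset.sum_congr rfl fun c _ => ?_
      rw [← congrFun (congrFun hh i) p, ← congrFun (congrFun hh b) d, Matrix.transpose_apply,
        Matrix.transpose_apply]
      ring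
    rw [this] at hpos
    rw [h1] at h0
    linarith
  apply hnull
  intro j k l
  have := congrFun hx0 (j, (k, l))
  simp only [hx, hB, Matrix.of_apply, Pi.zero_apply] at this
  rw [← neg_eq_zero, ← Finset.sum_neg_distrib, ← this]
  refine Finset.sum_congr rfl fun q _ => ?_
  rw [hA.pair k l j q |>.symm, hA.swap12 j q k l]
  ring

/-- An injective P is invertible and P⁻¹ satisfies the Moore-Penrose equations. So the choice in
`moorePenrose` is a genuine solution, and PBP = P forces B = P⁻¹. -/
theorem moorePenrose_mulVec {P : Matrix (Fin n) (Fin n) ℝ} (hh : hᵀ = h)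
    (hP : ∀ v, P *ᵥ v = 0 → v = 0) (v : Fin n → ℝ) : moorePenrose h P *ᵥ (P *ᵥ v) = v := by
  have hu : IsUnit P := by
    rw [← Matrix.mulVec_injective_iff_isUnit]
    intro v w hvw
    have := hP (v - w) (by rw [Matrix.mulVec_sub, sub_eq_zero]; exact hvw)
    exact sub_eq_zero.mp this
  have hd : IsUnit P.det := (Matrix.isUnit_iff_isUnit_det P).mp hu
  have hex : ∃ B, IsMoorePenrose h P B := by
    refine ⟨P⁻¹, ?_, ?_, ?_, ?_⟩
    · rw [Matrix.mul_nonsing_inv _ hd, Matrix.one_mul]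
    · rw [Matrix.nonsing_inv_mul _ hd, Matrix.one_mul]
    · rw [Matrix.mul_nonsing_inv _ hd, Matrix.mul_one, hh]
    · rw [Matrix.nonsing_inv_mul _ hd, Matrix.mul_one, hh]
  have hs : IsMoorePenrose h P (moorePenrose h P) := Classical.epsilon_spec hex
  have h1 := congrArg (fun X => P⁻¹ * X) hs.aba
  simp only [Matrix.mul_assoc] at h1
  rw [← Matrix.mul_assoc, Matrix.nonsing_inv_mul _ hd, Matrix.one_mul] at h1
  rw [Matrix.mulVec_mulVec, h1, Matrix.one_mulVec]

/-- The expansion in the basis dxᵏ ∧ dxˡ, k < l, in which `detCurvOp` is computed. -/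
theorem sum_smul_wedge {b : Matrix (Fin n) (Fin n) ℝ} (hb : bᵀ = -b) :
    ∑ Q : {q : Fin n × Fin n // q.1 < q.2},
      b Q.1.1 Q.1.2 • wedge (Pi.single Q.1.1 1) (Pi.single Q.1.2 1) = b := by
  have hba : ∀ i j, b j i = -b i j := fun i j => congrFun (congrFun hb i) j
  ext k l
  simp only [Matrix.sum_apply, Matrix.smul_apply, wedge, Matrix.sub_apply, Matrix.vecMulVec_apply,
    smul_eq_mul, Pi.single_apply]
  rcases lt_trichotomy k l with hkl | hkl | hkl
  · rw [Finset.sum_eq_single ⟨(k, l), hkl⟩]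
    · simp [hkl.ne]
    · rintro ⟨⟨p, q⟩, hpq⟩ _ hne
      simp only [ne_eq, Subtype.mk.injEq, Prod.mk.injEq, not_and] at hne hpq ⊢
      by_cases h1 : k = p
      · subst h1
        by_cases h2 : l = q
        · exact absurd h2.symm (hne rfl)
        · simp [h2, hpq.ne]
      · by_cases h2 : k = q
        · subst h2
          have : l ≠ p := fun h => by subst h; exact absurd hkl hpq.not_gt
          simp [h1, this]
        · simp [h1, h2]
    · intro h
      exact absurd (Finset.mem_univ _) h
  · subst hkl
    have h0 : b k k = 0 := by linarith [hba k k]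
    rw [h0]
    refine Finset.sum_eq_zero fun Q _ => ?_
    ring
  · rw [Finset.sum_eq_single ⟨(l, k), hkl⟩]
    · simp [hkl.ne, hba l k, hkl.ne']
    · rintro ⟨⟨p, q⟩, hpq⟩ _ hne
      simp only [ne_eq, Subtype.mk.injEq, Prod.mk.injEq, not_and] at hne hpq ⊢
      by_cases h1 : l = p
      · subst h1
        by_cases h2 : k = q
        · exact absurd h2.symm (hne rfl)
        · simp [h2, hpq.ne]
      · by_cases h2 : l = q
        · subst h2
          have : k ≠ p := fun h => by subst h; exact absurd hkl hpq.not_gt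
          simp [h1, this]
        · simp [h1, h2]
    · intro h
      exact absurd (Finset.mem_univ _) h

/-- Pair symmetry turns the hypothesis into 𝒜(b) = 0, so the coefficient vector of b lies in the
kernel of a matrix with nonzero determinant. -/
theorem IsCurvTensor.eq_zero_of_det (hA : IsCurvTensor A) (hh : hᵀ = h)
    (hdet : detCurvOp h A ≠ 0) {b : Matrix (Fin n) (Fin n) ℝ} (hb : bᵀ = -b)
    (h0 : ∀ i j, contr (h * b * h) (Matrix.of fun k l => A i j k l) = 0) : b = 0 := by
  have hop : curvOp h A b = 0 := by
    ext k l
    rw [hA.curvOp_antisymm hh hb]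
    simp only [← hA.pair _ _ k l, h0, mul_zero, Matrix.zero_apply]
  set v : {q : Fin n × Fin n // q.1 < q.2} → ℝ := fun Q => b Q.1.1 Q.1.2 with hv
  have hz : v = 0 := by
    refine Matrix.eq_zero_of_mulVec_eq_zero hdet ?_
    ext P
    have := congrFun (congrFun hop P.1.1) P.1.2
    rw [← sum_smul_wedge hb, curvOp_sum] at this
    simp only [Matrix.sum_apply, Matrix.smul_apply, smul_eq_mul] at this
    simp only [Matrix.mulVec, dotProduct, Matrix.of_apply, hv]
    rw [Pi.zero_apply, ← Matrix.zero_apply (m := Fin n) (n := Fin n) P.1.1 P.1.2, ← this]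
    exact Finset.sum_congr rfl fun Q _ => mul_comm _ _
  rw [← sum_smul_wedge hb]
  refine Finset.sum_eq_zero fun Q _ => ?_
  have := congrFun hz Q
  simp only [hv, Pi.zero_apply] at this
  rw [this, zero_smul]

end CurvatureOperator

/-! ## Coordinate frames on manifolds -/

section Charts

variable {n : ℕ} {M : Type*} [TopologicalSpace M] [ChartedSpace (Coord n) M]

local notation "χ" => extChartAt (𝓡 n)

theorem isOpen_target (p : M) : IsOpen (χ p).target := isOpen_extChartAt_target p

theorem center_mem (p : M) : center n p ∈ (χ p).target := mem_extChartAt_target p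

theorem symm_center (p : M) : (χ p).symm (center n p) = p := extChartAt_to_inv p

/-- The change of coordinates from the chart at `p` to the chart at `q`. -/
noncomputable def transition (n : ℕ) {M : Type*} [TopologicalSpace M] [ChartedSpace (Coord n) M]
    (p q : M) : Coord n → Coord n :=
  extChartAt (𝓡 n) q ∘ (extChartAt (𝓡 n) p).symm

/-- The domain of the change of coordinates. -/
def overlap (n : ℕ) {M : Type*} [TopologicalSpace M] [ChartedSpace (Coord n) M]
    (p q : M) : Set (Coord n) :=
  ((extChartAt (𝓡 n) p).symm ≫ extChartAt (𝓡 n) q).source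

theorem mem_overlap {p q : M} {y : Coord n} :
    y ∈ overlap n p q ↔ y ∈ (χ p).target ∧ (χ p).symm y ∈ (χ q).source := by
  simp [overlap, PartialEquiv.trans_source]

theorem isOpen_overlap (p q : M) : IsOpen (overlap n p q) := by
  have : overlap n p q = (χ p).target ∩ (χ p).symm ⁻¹' (χ q).source := by
    ext y
    rw [mem_overlap]
    rfl
  rw [this]
  exact (continuousOn_extChartAt_symm p).isOpen_inter_preimage (isOpen_target p)
    (isOpen_extChartAt_source q)

theorem symm_transition {p q : M} {y : Coord n} (hy : y ∈ overlap n p q) :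
    (χ q).symm (transition n p q y) = (χ p).symm y :=
  (χ q).left_inv (mem_overlap.1 hy).2

theorem transition_mem {p q : M} {y : Coord n} (hy : y ∈ overlap n p q) :
    transition n p q y ∈ overlap n q p := by
  rw [mem_overlap, symm_transition hy]
  exact ⟨(χ q).map_source (mem_overlap.1 hy).2, (χ p).map_target (mem_overlap.1 hy).1⟩

theorem transition_transition {p q : M} {y : Coord n} (hy : y ∈ overlap n p q) :
    transition n q p (transition n p q y) = y := by
  rw [transition, Function.comp_apply, symm_transition hy]
  exact (χ p).right_inv (mem_overlap.1 hy).1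

end Charts

/-! ### Coordinate frames as local frames of the tangent bundle -/

section Frames

variable {n : ℕ} {M : Type*} [TopologicalSpace M] [ChartedSpace (Coord n) M]
  [IsManifold (𝓡 n) ∞ M]

local notation "χ" => extChartAt (𝓡 n)

/-- The coordinate frame of the chart at `p`, at the point `x` of its domain. -/
noncomputable def frame (p : M) (i : Fin n) (x : M) : TangentSpace (𝓡 n) x :=
  (trivializationAt (Coord n) (TangentSpace (𝓡 n)) p).symmL ℝ x
    (EuclideanSpace.single i 1 : Coord n)

theorem mem_baseSet {p x : M} (hx : x ∈ (χ p).source) :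
    x ∈ (trivializationAt (Coord n) (TangentSpace (𝓡 n)) p).baseSet := by
  rwa [TangentBundle.trivializationAt_baseSet, ← extChartAt_source (𝓡 n)]

/-- The derivative of the inverse chart agrees with the bundle trivialization, from which smoothness
and linear independence of the frame are read off. -/
theorem coordFrame_eq (p : M) (i : Fin n) {y : Coord n} (hy : y ∈ (χ p).target) :
    coordFrame p i y = frame p i ((χ p).symm y) := by
  have hx : (χ p).symm y ∈ (chartAt (Coord n) p).source := by
    rw [← extChartAt_source (𝓡 n)]
    exact (χ p).map_target hy
  rw [frame, TangentBundle.symmL_trivializationAt hx, (χ p).right_inv hy,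
    ModelWithCorners.range_eq_univ, mfderivWithin_univ]
  rfl

/-- The space T_pM is modeled through the chart at p itself, so components at the center, such as
those in `vecT`, are already the vector. -/
theorem frame_self (p : M) (i : Fin n) : frame p i p = (EuclideanSpace.single i 1 : Coord n) := by
  rw [frame, TangentBundle.symmL_trivializationAt_eq_core (mem_chart_source _ p)]
  exact tangentCoordChange_self (I := 𝓡 n) (v := (EuclideanSpace.single i 1 : Coord n))
    (mem_extChartAt_source p)

theorem sum_smul_frame {p x : M} (w : Coord n) :
    (trivializationAt (Coord n) (TangentSpace (𝓡 n)) p).symmL ℝ x w =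
      ∑ a, w a • frame p a x := by
  conv_lhs => rw [← (EuclideanSpace.basisFun (Fin n) ℝ).sum_repr w]
  rw [map_sum]
  refine Finset.sum_congr rfl fun a _ => ?_
  rw [map_smul]
  simp [frame]

theorem eq_sum_frame {p x : M} (hx : x ∈ (χ p).source) (v : TangentSpace (𝓡 n) x) :
    v = ∑ a, ((trivializationAt (Coord n) (TangentSpace (𝓡 n)) p).continuousLinearMapAt ℝ x v) a •
      frame p a x := by
  rw [← sum_smul_frame, Bundle.Trivialization.symmL_continuousLinearMapAt _ (mem_baseSet hx)]

theorem contDiffOn_transition (p q : M) : ContDiffOn ℝ ∞ (transition n p q) (overlap n p q) :=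
  contDiffOn_ext_coord_change q p

theorem jac_apply_eq {p q : M} {y : Coord n} (hy : y ∈ overlap n p q) (a i : Fin n) :
    jac (transition n p q) y a i =
      fderiv ℝ (transition n p q) y (EuclideanSpace.single i 1 : Coord n) a := by
  have hd : DifferentiableAt ℝ (transition n p q) y :=
    ((contDiffOn_transition p q).contDiffAt ((isOpen_overlap p q).mem_nhds hy)).differentiableAt
      (by simp)
  have : HasFDerivAt (fun z => transition n p q z a)
      ((EuclideanSpace.proj (𝕜 := ℝ) a).comp (fderiv ℝ (transition n p q) y)) y :=
    (EuclideanSpace.proj (𝕜 := ℝ) a).hasFDerivAt.comp y hd.hasFDerivAt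
  rw [jac, Matrix.of_apply, pd, this.fderiv]
  rfl

/-- The cocycle rule for the changes of chart p → q → x; tangent vectors at x are read in the chart
at x. -/
theorem frame_change {p q x : M} (hp : x ∈ (χ p).source) (hq : x ∈ (χ q).source) (i : Fin n) :
    frame p i x = ∑ a, jac (transition n p q) (χ p x) a i • frame q a x := by
  have hy : χ p x ∈ overlap n p q := by
    rw [mem_overlap, (χ p).left_inv hp]
    exact ⟨(χ p).map_source hp, hq⟩
  have e : frame p i x = (trivializationAt (Coord n) (TangentSpace (𝓡 n)) q).symmL ℝ x
      (tangentCoordChange (𝓡 n) p q x (EuclideanSpace.single i 1 : Coord n)) := by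
    rw [frame, TangentBundle.symmL_trivializationAt_eq_core (by rwa [← extChartAt_source (𝓡 n)]),
      TangentBundle.symmL_trivializationAt_eq_core (by rwa [← extChartAt_source (𝓡 n)])]
    exact (tangentCoordChange_comp ⟨⟨hp, hq⟩, mem_extChartAt_source x⟩).symm
  rw [e, sum_smul_frame]
  refine Finset.sum_congr rfl fun a _ => ?_
  rw [jac_apply_eq hy, tangentCoordChange_def, ModelWithCorners.range_eq_univ, fderivWithin_univ]
  rfl

theorem contMDiffOn_frame (p : M) (i : Fin n) :
    ContMDiffOn (𝓡 n) (𝓡 n).tangent ∞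
      (fun x => (⟨x, frame p i x⟩ : TangentBundle (𝓡 n) M)) (χ p).source := by
  have h := (trivializationAt (Coord n) (TangentSpace (𝓡 n)) p).contMDiffOn_localFrame_baseSet
    (n := ∞) (I := 𝓡 n) (EuclideanSpace.basisFun (Fin n) ℝ).toBasis i
  rw [TangentBundle.trivializationAt_baseSet, ← extChartAt_source (𝓡 n)] at h
  refine h.congr fun x hx => ?_
  rw [Bundle.Trivialization.localFrame_apply_of_mem_baseSet _ _ (mem_baseSet hx)]
  simp only [frame, Bundle.Trivialization.basisAt, Module.Basis.map_apply,
    OrthonormalBasis.coe_toBasis, EuclideanSpace.basisFun_apply,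
    Bundle.Trivialization.symmL_apply _ (mem_baseSet hx)]
  rfl

end Frames

/-! ## Metrics and vector fields in charts -/

section MetricInCharts

variable {n : ℕ} {M : Type*} [TopologicalSpace M] [ChartedSpace (Coord n) M]
  [IsManifold (𝓡 n) ∞ M]

local notation "χ" => extChartAt (𝓡 n)

theorem contMDiffOn_inner (g : Metric n M) {X Y : ∀ q : M, TangentSpace (𝓡 n) q} {s : Set M}
    (hX : ContMDiffOn (𝓡 n) (𝓡 n).tangent ∞
      (fun x => (⟨x, X x⟩ : TangentBundle (𝓡 n) M)) s)
    (hY : ContMDiffOn (𝓡 n) (𝓡 n).tangent ∞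
      (fun x => (⟨x, Y x⟩ : TangentBundle (𝓡 n) M)) s) :
    ContMDiffOn (𝓡 n) 𝓘(ℝ, ℝ) ∞ (fun x => g.inner x (X x) (Y x)) s := by
  have : ContMDiffOn (𝓡 n) ((𝓡 n).prod 𝓘(ℝ)) ∞ (fun x =>
      Bundle.TotalSpace.mk' ℝ (E := Bundle.Trivial M ℝ) x (g.inner x (X x) (Y x))) s := by
    apply ContMDiffOn.clm_bundle_apply₂ (F₁ := Coord n) (F₂ := Coord n)
    · exact g.contMDiff.contMDiffOn
    · exact hX
    · exact hY
  intro x hx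
  have h := this x hx
  simp only [Bundle.contMDiffWithinAt_totalSpace] at h
  exact h.2

theorem contDiffOn_comp_symm {f : M → ℝ} (p : M)
    (hf : ContMDiffOn (𝓡 n) 𝓘(ℝ, ℝ) ∞ f (χ p).source) :
    ContDiffOn ℝ ∞ (fun y => f ((χ p).symm y)) (χ p).target := by
  rw [← contMDiffOn_iff_contDiffOn]
  exact hf.comp (contMDiffOn_extChartAt_symm p) fun y hy => (χ p).map_target hy

theorem localMetric_apply (g : Metric n M) (p : M) {y : Coord n} (hy : y ∈ (χ p).target)
    (i j : Fin n) : localMetric g p y i j =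
      g.inner ((χ p).symm y) (frame p i ((χ p).symm y)) (frame p j ((χ p).symm y)) := by
  rw [localMetric, Matrix.of_apply, coordFrame_eq p i hy, coordFrame_eq p j hy]

theorem localMetric_chart (g : Metric n M) {p x : M} (hx : x ∈ (χ p).source) (i j : Fin n) :
    localMetric g p (χ p x) i j = g.inner x (frame p i x) (frame p j x) := by
  have := localMetric_apply g p ((χ p).map_source hx) i j
  rwa [(χ p).left_inv hx] at this

theorem localDual_apply (g : Metric n M) (X : ∀ q : M, TangentSpace (𝓡 n) q) (p : M)
    {y : Coord n} (hy : y ∈ (χ p).target) (i : Fin n) : localDual g X p i y =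
      g.inner ((χ p).symm y) (X ((χ p).symm y)) (frame p i ((χ p).symm y)) := by
  rw [localDual, coordFrame_eq p i hy]

theorem localDual_chart (g : Metric n M) (X : ∀ q : M, TangentSpace (𝓡 n) q) {p x : M}
    (hx : x ∈ (χ p).source) (i : Fin n) :
    localDual g X p i (χ p x) = g.inner x (X x) (frame p i x) := by
  have := localDual_apply g X p ((χ p).map_source hx) i
  rwa [(χ p).left_inv hx] at this

theorem inner_sum_frame (g : Metric n M) (p x : M) (v w : Fin n → ℝ) :
    g.inner x (∑ i, v i • frame p i x) (∑ j, w j • frame p j x) =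
      ∑ i, ∑ j, v i * (w j * g.inner x (frame p i x) (frame p j x)) := by
  simp only [map_sum, map_smul, sum_apply, smul_apply,
    smul_eq_mul, Finset.mul_sum]
  rw [Finset.sum_comm]
  refine Finset.sum_congr rfl fun i _ => Finset.sum_congr rfl fun j _ => ?_
  ring

/-- The trivialization is injective on its fiber, so a nonzero coefficient vector gives a nonzero
tangent vector. -/
theorem posDef_localMetric (g : Metric n M) (p : M) {y : Coord n} (hy : y ∈ (χ p).target) :
    (localMetric g p y).PosDef := by
  refine Matrix.PosDef.of_dotProduct_mulVec_pos ?_ fun w hw => ?_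
  · ext i j
    simp only [Matrix.conjTranspose_apply, star_trivial]
    exact g.symm _ _ _
  · set x := (χ p).symm y with hx
    have hs : x ∈ (χ p).source := (χ p).map_target hy
    have hv : ∑ i, w i • frame p i x ≠ 0 := by
      intro h0
      have := sum_smul_frame (p := p) (x := x) (WithLp.toLp 2 w)
      simp only [h0] at this
      have h1 := Bundle.Trivialization.continuousLinearMapAt_symmL (R := ℝ)
        (trivializationAt (Coord n) (TangentSpace (𝓡 n)) p) (mem_baseSet hs)
        (WithLp.toLp 2 w : Coord n)
      rw [this, map_zero] at h1
      exact hw (by simpa using congrArg WithLp.ofLp h1.symm)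
    have := g.pos x _ hv
    rw [inner_sum_frame] at this
    simp only [dotProduct, Matrix.mulVec, star_trivial, Finset.mul_sum,
      localMetric_apply g p hy]
    refine this.trans_eq ?_
    refine Finset.sum_congr rfl fun i _ => Finset.sum_congr rfl fun j _ => ?_
    ring

theorem metricOn_localMetric (g : Metric n M) (p : M) :
    MetricOn (χ p).target (localMetric g p) where
  isOpen := isOpen_target p
  smooth i j := by
    refine (contDiffOn_comp_symm p (contMDiffOn_inner g (contMDiffOn_frame p i)
      (contMDiffOn_frame p j))).congr fun y hy => ?_
    exact localMetric_apply g p hy i j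
  symm y := by
    ext i j
    exact g.symm _ _ _
  det y hy := (posDef_localMetric g p hy).det_pos.ne'.isUnit

theorem contDiffOn_localDual (g : Metric n M) {X : ∀ q : M, TangentSpace (𝓡 n) q}
    (hX : ContMDiff (𝓡 n) ((𝓡 n).tangent) ∞ (fun q => (⟨q, X q⟩ : TangentBundle (𝓡 n) M)))
    (p : M) (i : Fin n) : ContDiffOn ℝ ∞ (localDual g X p i) (χ p).target := by
  refine (contDiffOn_comp_symm p (contMDiffOn_inner g hX.contMDiffOn
      (contMDiffOn_frame p i))).congr fun y hy => ?_
  exact localDual_apply g X p hy i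

/-- Through this lemma the coordinate transformation laws apply to M: a statement at the center of
one chart moves to the corresponding point of any other. -/
theorem isLocalIsom_transition (g : Metric n M) (p q : M) :
    IsLocalIsom (overlap n p q) (χ q).target (transition n p q)
      (localMetric g p) (localMetric g q) where
  left :=
    { isOpen := isOpen_overlap p q
      smooth := fun i j => ((metricOn_localMetric g p).smooth i j).mono
        fun y hy => (mem_overlap.1 hy).1
      symm := (metricOn_localMetric g p).symm
      det := fun y hy => (metricOn_localMetric g p).det y (mem_overlap.1 hy).1 }
  right := metricOn_localMetric g q
  smooth := contDiffOn_transition p q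
  mapsTo y hy := (mem_overlap.1 (transition_mem hy)).1
  pullback y hy := by
    obtain ⟨h1, h2⟩ := mem_overlap.1 hy
    have hs := (χ p).map_target h1
    ext i j
    rw [localMetric_apply g p h1, frame_change hs h2 i, frame_change hs h2 j, inner_sum_frame,
      (χ p).right_inv h1, Matrix.mul_apply]
    simp only [Matrix.mul_apply, Matrix.transpose_apply, Finset.sum_mul]
    rw [Finset.sum_comm]
    refine Finset.sum_congr rfl fun a _ => Finset.sum_congr rfl fun b _ => ?_
    have := localMetric_chart g h2 b a
    simp only [transition, Function.comp_apply] at this ⊢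
    rw [this]
    ring

theorem localDual_transition (g : Metric n M) (X : ∀ q : M, TangentSpace (𝓡 n) q) {p q : M}
    {y : Coord n} (hy : y ∈ overlap n p q) (i : Fin n) :
    localDual g X p i y =
      ∑ a, jac (transition n p q) y a i * localDual g X q a (transition n p q y) := by
  obtain ⟨h1, h2⟩ := mem_overlap.1 hy
  rw [localDual_apply g X p h1, frame_change ((χ p).map_target h1) h2, map_sum,
    (χ p).right_inv h1]
  refine Finset.sum_congr rfl fun a _ => ?_
  rw [map_smul, smul_eq_mul]
  exact congrArg _ (localDual_chart g X h2 a).symm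

/-- The components of a vector field in the chart at `p`. -/
noncomputable def upComp (g : Metric n M) (X : ∀ q : M, TangentSpace (𝓡 n) q) (p : M)
    (y : Coord n) : Fin n → ℝ :=
  invMetric (localMetric g p) y *ᵥ fun b => localDual g X p b y

theorem localMetric_mulVec_upComp (g : Metric n M) (X : ∀ q : M, TangentSpace (𝓡 n) q) (p : M)
    {y : Coord n} (hy : y ∈ (χ p).target) :
    localMetric g p y *ᵥ upComp g X p y = fun b => localDual g X p b y := by
  rw [upComp, Matrix.mulVec_mulVec, (metricOn_localMetric g p).mul_inv hy, Matrix.one_mulVec]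

theorem upComp_unique (g : Metric n M) (X : ∀ q : M, TangentSpace (𝓡 n) q) (p : M)
    {y : Coord n} (hy : y ∈ (χ p).target) {w : Fin n → ℝ}
    (hw : X ((χ p).symm y) = ∑ a, w a • frame p a ((χ p).symm y)) : upComp g X p y = w := by
  have : (fun b => localDual g X p b y) = localMetric g p y *ᵥ w := by
    funext b
    rw [localDual_apply g X p hy, hw, map_sum, sum_apply, Matrix.mulVec,
      dotProduct]
    refine Finset.sum_congr rfl fun a _ => ?_
    rw [map_smul, smul_apply, smul_eq_mul, localMetric_apply g p hy, mul_comm,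
      g.symm]
  rw [upComp, this, Matrix.mulVec_mulVec, (metricOn_localMetric g p).inv_mul hy,
    Matrix.one_mulVec]

theorem upComp_eq (g : Metric n M) (X : ∀ q : M, TangentSpace (𝓡 n) q) (p : M)
    {y : Coord n} (hy : y ∈ (χ p).target) :
    upComp g X p y = (trivializationAt (Coord n) (TangentSpace (𝓡 n)) p).continuousLinearMapAt ℝ
      ((χ p).symm y) (X ((χ p).symm y)) :=
  upComp_unique g X p hy (eq_sum_frame ((χ p).map_target hy) _)

theorem upComp_center (g : Metric n M) (X : ∀ q : M, TangentSpace (𝓡 n) q) (p : M) :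
    upComp g X p (center n p) = WithLp.ofLp (show Coord n from X p) := by
  refine upComp_unique g X p (center_mem p) ?_
  rw [symm_center]
  simp only [frame_self]
  exact ((EuclideanSpace.basisFun (Fin n) ℝ).sum_repr (show Coord n from X p)).symm.trans
    (by simp only [EuclideanSpace.basisFun_apply]; rfl)

/-- Lowering reduces the claim to the covector law `localDual_transition`; the transposed Jacobian
is then cancelled. -/
theorem upComp_transition (g : Metric n M) (X : ∀ q : M, TangentSpace (𝓡 n) q) {p q : M}
    {y : Coord n} (hy : y ∈ overlap n p q) :
    upComp g X q (transition n p q y) = jac (transition n p q) y *ᵥ upComp g X p y := by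
  have h := isLocalIsom_transition g p q
  have hq := h.mapsTo y hy
  have e : (localMetric g q (transition n p q y)) *ᵥ
      (jac (transition n p q) y *ᵥ upComp g X p y) =
      fun b => localDual g X q b (transition n p q y) := by
    have hJ : IsUnit ((jac (transition n p q) y)ᵀ).det := by
      rw [Matrix.det_transpose]
      exact h.det_jac hy
    have h1 := localMetric_mulVec_upComp g X p (mem_overlap.1 hy).1
    rw [h.pullback y hy, ← Matrix.mulVec_mulVec, ← Matrix.mulVec_mulVec] at h1
    have h2 : (fun b => localDual g X p b y) =
        (jac (transition n p q) y)ᵀ *ᵥ fun b => localDual g X q b (transition n p q y) := by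
      funext i
      exact localDual_transition g X hy i
    rw [h2] at h1
    exact Matrix.mulVec_injective_of_isUnit ((Matrix.isUnit_iff_isUnit_det _).2 hJ) h1
  rw [upComp, ← e, Matrix.mulVec_mulVec, (metricOn_localMetric g q).inv_mul hq, Matrix.one_mulVec]

/-- Raising the index with the smooth inverse metric gives the components in the trivialization at
p. -/
theorem contMDiff_of_localDual (g : Metric n M) {X : ∀ q : M, TangentSpace (𝓡 n) q}
    (h : ∀ p i, ContDiffOn ℝ ∞ (localDual g X p i) (χ p).target) :
    ContMDiff (𝓡 n) ((𝓡 n).tangent) ∞ (fun q => (⟨q, X q⟩ : TangentBundle (𝓡 n) M)) := by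
  intro p
  rw [Bundle.contMDiffAt_section]
  have hu : ∀ i, ContDiffOn ℝ ∞ (fun y => upComp g X p y i) (χ p).target := fun i =>
    smooth_sum Finset.univ fun b => ((metricOn_localMetric g p).smooth_inv i b).mul (h p b)
  have hv : ContDiffOn ℝ ∞ (fun y => (WithLp.toLp 2 (upComp g X p y) : Coord n)) (χ p).target :=
    contDiffOn_euclidean.2 hu
  have hw := (contMDiffOn_iff_contDiffOn.2 hv).comp (contMDiffOn_extChartAt (x := p)) fun x hx =>
    (χ p).map_source (by rwa [extChartAt_source])
  have hp : (chartAt (Coord n) p).source ∈ 𝓝 p := chart_source_mem_nhds _ p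
  refine (hw.contMDiffAt hp).congr_of_eventuallyEq ?_
  filter_upwards [hp] with x hx
  have hx' : x ∈ (χ p).source := by rwa [extChartAt_source]
  rw [Function.comp_apply, upComp_eq g X p ((χ p).map_source hx'), (χ p).left_inv hx']
  simp only [WithLp.toLp_ofLp]
  rw [Bundle.Trivialization.continuousLinearMapAt_apply,
    Bundle.Trivialization.coe_linearMapAt_of_mem _ (mem_baseSet hx')]

end MetricInCharts

/-! ## The nullity of the Weyl tensor -/

section Nullity

variable {n : ℕ}

/-- The kernel `{v | W(v, ·, ·, ·) = 0}` of the Weyl tensor of `G` at `y`. -/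
def weylKer (G : Coord n → Matrix (Fin n) (Fin n) ℝ) (y : Coord n) : Submodule ℝ (Fin n → ℝ) where
  carrier := {v | ∀ j k l, ∑ i, v i * weyl G i j k l y = 0}
  add_mem' := by
    intro v w hv hw j k l
    simp only [Pi.add_apply, add_mul, Finset.sum_add_distrib, hv j k l, hw j k l, add_zero]
  zero_mem' := by
    intro j k l
    simp
  smul_mem' := by
    intro c v hv j k l
    simp only [Pi.smul_apply, smul_eq_mul, mul_assoc, ← Finset.mul_sum, hv j k l, mul_zero]

theorem mem_weylKer {G : Coord n → Matrix (Fin n) (Fin n) ℝ} {y : Coord n} {v : Fin n → ℝ} :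
    v ∈ weylKer G y ↔ ∀ j k l, ∑ i, v i * weyl G i j k l y = 0 := Iff.rfl

/-- J⁻¹ carries the kernel at Φ(y) into the kernel at y. The reverse inequality comes from the
inverse change of charts. -/
theorem IsLocalIsom.finrank_weylKer_le (hn : 4 ≤ n) {U V : Set (Coord n)}
    {Φ : Coord n → Coord n} {G G' : Coord n → Matrix (Fin n) (Fin n) ℝ}
    (h : IsLocalIsom U V Φ G G') {y : Coord n} (hy : y ∈ U) :
    Module.finrank ℝ (weylKer G' (Φ y)) ≤ Module.finrank ℝ (weylKer G y) := by
  refine le_trans (Submodule.finrank_mono ?_)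
    (Submodule.finrank_map_le (Matrix.mulVecLin (jac Φ y)) (weylKer G y))
  intro w hw
  have hJ : jac Φ y *ᵥ ((jac Φ y)⁻¹ *ᵥ w) = w := by
    rw [Matrix.mulVec_mulVec, Matrix.mul_nonsing_inv _ (h.det_jac hy), Matrix.one_mulVec]
  refine ⟨(jac Φ y)⁻¹ *ᵥ w, fun j k l => ?_, hJ⟩
  rw [h.weyl_contract hn hy, hJ]
  simp only [mem_weylKer.1 hw, mul_zero, Finset.sum_const_zero]

/-- The contraction of the Weyl tensor with a vector, as a linear map. -/
noncomputable def weylMap (G : Coord n → Matrix (Fin n) (Fin n) ℝ) (y : Coord n) :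
    (Fin n → ℝ) →L[ℝ] (Fin n × Fin n × Fin n → ℝ) :=
  LinearMap.toContinuousLinearMap (Matrix.toLin' (Matrix.of fun (q : Fin n × Fin n × Fin n) i =>
    weyl G i q.1 q.2.1 q.2.2 y))

theorem ker_weylMap (G : Coord n → Matrix (Fin n) (Fin n) ℝ) (y : Coord n) :
    LinearMap.ker (weylMap G y : (Fin n → ℝ) →ₗ[ℝ] (Fin n × Fin n × Fin n → ℝ)) = weylKer G y := by
  ext v
  simp only [weylMap, LinearMap.coe_toContinuousLinearMap, LinearMap.mem_ker, Matrix.toLin'_apply,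
    funext_iff, mem_weylKer, Prod.forall, Matrix.mulVec, dotProduct, Matrix.of_apply,
    Pi.zero_apply, mul_comm]

/-- Linear maps of rank at least r form an open set and W depends continuously on the point, so by
rank-nullity the kernel cannot jump up nearby. -/
theorem MetricOn.eventually_finrank_weylKer_le {U : Set (Coord n)}
    {G : Coord n → Matrix (Fin n) (Fin n) ℝ} (h : MetricOn U G) {y : Coord n} (hy : y ∈ U) :
    ∀ᶠ z in 𝓝 y, Module.finrank ℝ (weylKer G z) ≤ Module.finrank ℝ (weylKer G y) := by
  have hc : ContinuousAt (weylMap G) y := by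
    let T : Matrix (Fin n × Fin n × Fin n) (Fin n) ℝ →ₗ[ℝ]
        ((Fin n → ℝ) →L[ℝ] (Fin n × Fin n × Fin n → ℝ)) :=
      LinearMap.toContinuousLinearMap.toLinearMap.comp Matrix.toLin'.toLinearMap
    have hT : Continuous T := T.continuous_of_finiteDimensional
    refine hT.continuousAt.comp (f := fun z => Matrix.of fun (q : Fin n × Fin n × Fin n) i =>
      weyl G i q.1 q.2.1 q.2.2 z) ?_
    refine continuousAt_pi.2 fun q => continuousAt_pi.2 fun i => ?_
    exact (h.smooth_weyl i q.1 q.2.1 q.2.2).continuousOn.continuousAt (h.isOpen.mem_nhds hy)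
  have hr := (isOpen_setOfPred_nat_le_rank (𝕜 := ℝ) (E := Fin n → ℝ)
    (F := Fin n × Fin n × Fin n → ℝ) (Module.finrank ℝ (LinearMap.range
      (weylMap G y : (Fin n → ℝ) →ₗ[ℝ] (Fin n × Fin n × Fin n → ℝ))))).mem_nhds
        (x := weylMap G y) (by rw [Set.mem_ofPred_eq, LinearMap.rank, Module.finrank_eq_rank])
  filter_upwards [hc.preimage_mem_nhds hr] with z hz
  rw [Set.mem_preimage, Set.mem_ofPred_eq, LinearMap.rank, ← Module.finrank_eq_rank,
    Nat.cast_le] at hz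
  have h1 := LinearMap.finrank_range_add_finrank_ker
    (weylMap G y : (Fin n → ℝ) →ₗ[ℝ] (Fin n × Fin n × Fin n → ℝ))
  have h2 := LinearMap.finrank_range_add_finrank_ker
    (weylMap G z : (Fin n → ℝ) →ₗ[ℝ] (Fin n × Fin n × Fin n → ℝ))
  rw [ker_weylMap] at h1 h2
  omega

end Nullity

/-! ### From chart centers and dense subsets to whole charts -/

section DenseSets

variable {n : ℕ} {M : Type*} [TopologicalSpace M] [ChartedSpace (Coord n) M]

local notation "χ" => extChartAt (𝓡 n)

/-- Each point of a chart is the center of its own preferred chart. This is how conditions stated at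
centers reach all points of a fixed chart. -/
theorem center_mem_overlap {p : M} {y : Coord n} (hy : y ∈ (χ p).target) :
    y ∈ overlap n p ((χ p).symm y) ∧
      transition n p ((χ p).symm y) y = center n ((χ p).symm y) :=
  ⟨mem_overlap.2 ⟨hy, mem_extChartAt_source _⟩, rfl⟩

theorem eq_zero_of_dense {D : Set M} (hD : Dense D) {p : M} {f : Coord n → ℝ}
    (hf : ContinuousOn f (χ p).target)
    (h0 : ∀ y ∈ (χ p).target, (χ p).symm y ∈ D → f y = 0) :
    ∀ y ∈ (χ p).target, f y = 0 := by
  intro y hy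
  by_contra hne
  have hW : IsOpen ((χ p).target ∩ f ⁻¹' {0}ᶜ) :=
    hf.isOpen_inter_preimage (isOpen_target p) isOpen_compl_singleton
  have hW' : IsOpen ((χ p).source ∩ χ p ⁻¹' ((χ p).target ∩ f ⁻¹' {0}ᶜ)) :=
    (continuousOn_extChartAt p).isOpen_inter_preimage (isOpen_extChartAt_source p) hW
  obtain ⟨x, ⟨hx1, hx2, hx3⟩, hxD⟩ := hD.inter_open_nonempty _ hW'
    ⟨(χ p).symm y, (χ p).map_target hy, by
      rw [Set.mem_preimage, (χ p).right_inv hy]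
      exact ⟨hy, hne⟩⟩
  exact hx3 (h0 _ hx2 (by rwa [(χ p).left_inv hx1]))

theorem isOpen_preimage_symm (p : M) {D : Set M} (hD : IsOpen D) :
    IsOpen ((χ p).target ∩ (χ p).symm ⁻¹' D) :=
  (continuousOn_extChartAt_symm p).isOpen_inter_preimage (isOpen_target p) hD

end DenseSets

/-! ### The regular set is open and dense -/

section RegularSet

variable {n : ℕ} {M : Type*} [TopologicalSpace M] [ChartedSpace (Coord n) M]
  [IsManifold (𝓡 n) ∞ M]

local notation "χ" => extChartAt (𝓡 n)

theorem rankE_le_finrank_weylKer (hn : 4 ≤ n) (g : Metric n M) {p : M} {y : Coord n}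
    (hy : y ∈ (χ p).target) :
    rankE g ((χ p).symm y) ≤ Module.finrank ℝ (weylKer (localMetric g p) y) :=
  (isLocalIsom_transition g p ((χ p).symm y)).finrank_weylKer_le hn (center_mem_overlap hy).1

theorem finrank_weylKer_le_rankE (hn : 4 ≤ n) (g : Metric n M) {p : M} {y : Coord n}
    (hy : y ∈ (χ p).target) :
    Module.finrank ℝ (weylKer (localMetric g p) y) ≤ rankE g ((χ p).symm y) := by
  obtain ⟨h1, h2⟩ := center_mem_overlap hy
  have := (isLocalIsom_transition g ((χ p).symm y) p).finrank_weylKer_le hn (transition_mem h1)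
  rwa [transition_transition h1, h2] at this

theorem isOpen_regularSet (g : Metric n M) : IsOpen (regularSet g) := by
  rw [isOpen_iff_eventually]
  intro p hp
  have hp' : ∀ᶠ q in 𝓝 p, rankE g q = rankE g p := hp
  filter_upwards [eventually_eventually_nhds.2 hp', hp'] with q hq hqp
  show ∀ᶠ r in 𝓝 q, rankE g r = rankE g q
  rwa [hqp]

theorem eventually_rankE_le (hn : 4 ≤ n) (g : Metric n M) (p : M) :
    ∀ᶠ q in 𝓝 p, rankE g q ≤ rankE g p := by
  have h1 := (metricOn_localMetric g p).eventually_finrank_weylKer_le (center_mem p)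
  have h2 := (continuousAt_extChartAt (I := 𝓡 n) p).eventually h1
  filter_upwards [h2, extChartAt_source_mem_nhds (I := 𝓡 n) p] with q hq hs
  have := rankE_le_finrank_weylKer hn g ((χ p).map_source hs)
  rw [(χ p).left_inv hs] at this
  exact this.trans hq

/-- In any nonempty open set the rank attains a minimum. Near a minimizing point, semicontinuity
bounds the rank from above and minimality bounds it from below. -/
theorem dense_regularSet (hn : 4 ≤ n) (g : Metric n M) : Dense (regularSet g) := by
  rw [dense_iff_inter_open]
  intro W hW hne
  obtain ⟨p, hp, hmin⟩ := Nat.sInf_mem (hne.image (rankE g))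
  refine ⟨p, hp, ?_⟩
  show ∀ᶠ q in 𝓝 p, rankE g q = rankE g p
  filter_upwards [eventually_rankE_le hn g p, hW.mem_nhds hp] with q h1 h2
  refine le_antisymm h1 ?_
  rw [hmin]
  exact Nat.sInf_le ⟨q, h2, rfl⟩

theorem weylKer_eq_bot (hn : 4 ≤ n) {g : Metric n M} (hE : ∀ p ∈ regularSet g, rankE g p = 0)
    {p : M} {y : Coord n} (hy : y ∈ (χ p).target) (hr : (χ p).symm y ∈ regularSet g)
    {v : Fin n → ℝ} (hv : ∀ j k l, ∑ i, v i * weyl (localMetric g p) i j k l y = 0) : v = 0 := by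
  have h1 := finrank_weylKer_le_rankE hn g hy
  rw [hE _ hr, Nat.le_zero, Submodule.finrank_eq_zero] at h1
  have : v ∈ weylKer (localMetric g p) y := hv
  rwa [h1, Submodule.mem_bot] at this

end RegularSet

/-! ## Potentials of closed one forms -/

section Gluing

variable {M : Type*} [TopologicalSpace M] {A : Type*} [AddCommGroup A] [TopologicalSpace A]
  [DiscreteTopology A]

/-- The fiber bundle of the functions that differ from the local functions `f p` by local
constants. -/
def glueCore (B : M → Set M) (hB : ∀ p, IsOpen (B p)) (hm : ∀ p, p ∈ B p) (f : M → M → A)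
    (hf : ∀ p q, ∀ x ∈ B p ∩ B q, ∀ᶠ z in 𝓝 x, f p z - f q z = f p x - f q x) :
    FiberBundleCore M M A where
  baseSet := B
  isOpen_baseSet := hB
  indexAt := id
  mem_baseSet_at := hm
  coordChange p q x v := v + (f p x - f q x)
  coordChange_self p x _ v := by rw [sub_self, add_zero]
  continuousOn_coordChange p q := by
    rintro ⟨x, v⟩ ⟨hx, -⟩
    refine ContinuousAt.continuousWithinAt ?_
    refine (continuousAt_const (y := v + (f p x - f q x))).congr ?_
    have h1 : ∀ᶠ w : M × A in 𝓝 (x, v), w.2 = v :=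
      continuous_snd.tendsto (x, v) ((isOpen_discrete {v}).mem_nhds rfl)
    have h2 : ∀ᶠ w : M × A in 𝓝 (x, v), f p w.1 - f q w.1 = f p x - f q x :=
      continuous_fst.tendsto (x, v) (hf p q x hx)
    filter_upwards [h1, h2] with w hw1 hw2
    rw [hw1, hw2]
  coordChange_comp p q r x _ v := by abel

/-- The differences f p - f q are locally constant, so they are continuous transition functions for
a bundle with discrete fiber, which is a covering. Simple connectedness lifts the identity of M to a
global section, and the section corrects the local functions to a global one. -/
theorem exists_glue [SimplyConnectedSpace M] [LocallyPathConnectedSpace M] (B : M → Set M)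
    (hB : ∀ p, IsOpen (B p)) (hm : ∀ p, p ∈ B p) (f : M → M → A)
    (hf : ∀ p q, ∀ x ∈ B p ∩ B q, ∀ᶠ z in 𝓝 x, f p z - f q z = f p x - f q x) :
    ∃ F : M → A, ∀ p, ∀ x ∈ B p, ∀ᶠ z in 𝓝 x, F z - f p z = F x - f p x := by
  let Z := glueCore B hB hm f hf
  have hcov : IsCoveringMap (Bundle.TotalSpace.proj : Z.TotalSpace → M) :=
    FiberBundle.isCoveringMap
  obtain ⟨x₀⟩ : Nonempty M := inferInstance
  obtain ⟨s, ⟨-, hs⟩, -⟩ := hcov.existsUnique_continuousMap_lifts (ContinuousMap.id M) x₀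
    (⟨x₀, (0 : A)⟩ : Z.TotalSpace) rfl
  have hs' : ∀ x, (s x).proj = x := fun x => congrFun hs x
  -- The fiber over x is read in the trivialization with index x. In the trivialization p the
  -- section becomes F - f p, continuous into a discrete space and hence locally constant.
  let F : M → A := fun x => f x x + (show A from (s x).2)
  have hF : ∀ p, ∀ x ∈ B p, F x - f p x = (Z.localTriv p (s x)).2 := by
    intro p x _
    have : (Z.localTriv p (s x)).2 =
        (show A from (s x).2) + (f (s x).proj (s x).proj - f p (s x).proj) := rfl
    rw [this, hs' x]
    simp only [F]
    abel
  refine ⟨F, fun p x hx => ?_⟩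
  have hc : ContinuousAt (fun z => (Z.localTriv p (s z)).2) x := by
    refine continuousAt_snd.comp (ContinuousAt.comp (f := s) (g := Z.localTriv p) ?_
      s.continuous.continuousAt)
    refine (Z.localTriv p).continuousOn.continuousAt ((Z.localTriv p).open_source.mem_nhds ?_)
    rw [(Z.localTriv p).mem_source]
    show (s x).proj ∈ B p
    rwa [hs' x]
  have he := hc.eventually ((isOpen_discrete {(Z.localTriv p (s x)).2}).mem_nhds rfl)
  filter_upwards [he, (hB p).mem_nhds hx] with z hz hzB
  rw [hF p z hzB, hF p x hx]
  exact hz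

end Gluing

/-! ### Poincaré lemma and global potentials -/

section Potential

variable {n : ℕ}

/-- The one form `∑ θᵢ dxⁱ`. -/
noncomputable def oneForm (θ : Fin n → Coord n → ℝ) (y : Coord n) : Coord n →L[ℝ] ℝ :=
  ∑ i, θ i y • EuclideanSpace.proj (𝕜 := ℝ) i

theorem oneForm_apply (θ : Fin n → Coord n → ℝ) (y v : Coord n) :
    oneForm θ y v = ∑ i, θ i y * v i := by
  simp [oneForm]

theorem oneForm_single (θ : Fin n → Coord n → ℝ) (y : Coord n) (i : Fin n) :
    oneForm θ y (EuclideanSpace.single i 1) = θ i y := by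
  simp [oneForm_apply]

theorem contDiffOn_oneForm {U : Set (Coord n)} {θ : Fin n → Coord n → ℝ}
    (hθ : ∀ i, ContDiffOn ℝ ∞ (θ i) U) : ContDiffOn ℝ ∞ (oneForm θ) U :=
  ContDiffOn.sum fun i _ => (hθ i).smul contDiffOn_const

/-- The Poincaré lemma on a convex set: closedness in coordinates is the symmetry of the derivative
of `oneForm θ`. -/
theorem exists_local_potential {U : Set (Coord n)} (hU : IsOpen U) (hc : Convex ℝ U)
    {θ : Fin n → Coord n → ℝ} (hθ : ∀ i, ContDiffOn ℝ ∞ (θ i) U)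
    (hd : ∀ y ∈ U, ∀ i j, pd i (θ j) y = pd j (θ i) y) :
    ∃ f : Coord n → ℝ, ∀ y ∈ U, HasFDerivAt f (oneForm θ y) y := by
  refine hc.exists_forall_hasFDerivAt_of_fderiv_symmetric hU
    ((contDiffOn_oneForm hθ).differentiableOn (by simp)) fun y hy u v => ?_
  have e : ∀ u v, fderiv ℝ (oneForm θ) y u v = ∑ i, ∑ a, u a * v i * pd a (θ i) y := by
    intro u v
    have h : HasFDerivAt (oneForm θ)
        (∑ i, (fderiv ℝ (θ i) y).smulRight (EuclideanSpace.proj (𝕜 := ℝ) i)) y := by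
      refine HasFDerivAt.fun_sum fun i _ => ?_
      exact (differentiableAt_of_smooth hU (hθ i) hy).hasFDerivAt.smul_const
        (EuclideanSpace.proj (𝕜 := ℝ) i)
    rw [h.fderiv]
    simp only [sum_apply, ContinuousLinearMap.smulRight_apply, smul_apply, smul_eq_mul,
      fderiv_apply_eq_sum, Finset.sum_mul]
    refine Finset.sum_congr rfl fun i _ => Finset.sum_congr rfl fun a _ => ?_
    rw [mul_right_comm]
    rfl
  rw [e, e, Finset.sum_comm]
  refine Finset.sum_congr rfl fun i _ => Finset.sum_congr rfl fun a _ => ?_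
  rw [hd y hy]
  ring

variable {M : Type*} [TopologicalSpace M] [ChartedSpace (Coord n) M] [IsManifold (𝓡 n) ∞ M]

local notation "χ" => extChartAt (𝓡 n)

theorem hasFDerivAt_comp_transition {θ : M → Fin n → Coord n → ℝ} {p q : M} {y : Coord n}
    (hy : y ∈ overlap n p q)
    (ht : ∀ i, θ p i y = ∑ a, jac (transition n p q) y a i * θ q a (transition n p q y))
    {f : Coord n → ℝ}
    (hf : HasFDerivAt f (oneForm (θ q) (transition n p q y)) (transition n p q y)) :
    HasFDerivAt (fun z => f (transition n p q z)) (oneForm (θ p) y) y := by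
  have hΦ : HasFDerivAt (transition n p q) (fderiv ℝ (transition n p q) y) y :=
    (((contDiffOn_transition p q).contDiffAt
      ((isOpen_overlap p q).mem_nhds hy)).differentiableAt (by simp)).hasFDerivAt
  refine (hf.comp y hΦ).congr_fderiv ?_
  refine ContinuousLinearMap.coe_injective
    ((EuclideanSpace.basisFun (Fin n) ℝ).toBasis.ext fun i => ?_)
  rw [ContinuousLinearMap.coe_coe, ContinuousLinearMap.coe_coe, OrthonormalBasis.coe_toBasis, EuclideanSpace.basisFun_apply, oneForm_single, ht,
    ContinuousLinearMap.comp_apply, oneForm_apply]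
  refine Finset.sum_congr rfl fun a _ => ?_
  rw [jac_apply_eq hy, mul_comm]

/-- Local potentials on chart balls differ by functions with zero derivative, hence by local
constants, so `exists_glue` applies. The glued function is smooth because its derivative is. -/
theorem exists_potential [SimplyConnectedSpace M] {θ : M → Fin n → Coord n → ℝ}
    (hθ : ∀ p i, ContDiffOn ℝ ∞ (θ p i) (χ p).target)
    (ht : ∀ p q, ∀ y ∈ overlap n p q, ∀ i,
      θ p i y = ∑ a, jac (transition n p q) y a i * θ q a (transition n p q y))
    (hd : ∀ p, ∀ y ∈ (χ p).target, ∀ i j, pd i (θ p j) y = pd j (θ p i) y) :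
    ∃ F : M → ℝ, ContMDiff (𝓡 n) 𝓘(ℝ, ℝ) ∞ F ∧
      ∀ p, ∀ y ∈ (χ p).target, ∀ i, pd i (fun z => F ((χ p).symm z)) y = θ p i y := by
  have : LocallyPathConnectedSpace M := ChartedSpace.locallyPathConnectedSpace (Coord n) M
  have hr : ∀ p : M, ∃ r > 0, Metric.ball (center n p) r ⊆ (χ p).target := fun p =>
    Metric.isOpen_iff.1 (isOpen_target p) _ (center_mem p)
  choose r hr0 hrt using hr
  have hf : ∀ p : M, ∃ f : Coord n → ℝ, ∀ y ∈ Metric.ball (center n p) (r p),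
      HasFDerivAt f (oneForm (θ p) y) y := fun p =>
    exists_local_potential Metric.isOpen_ball (convex_ball _ _)
      (fun i => (hθ p i).mono (hrt p)) fun y hy => hd p y (hrt p hy)
  choose f hf using hf
  -- The domains are shrunk to preimages of balls, since the Poincaré lemma needs convex images.
  let B : M → Set M := fun p => (χ p).source ∩ χ p ⁻¹' Metric.ball (center n p) (r p)
  have hB : ∀ p, IsOpen (B p) := fun p =>
    (continuousOn_extChartAt p).isOpen_inter_preimage (isOpen_extChartAt_source p)
      Metric.isOpen_ball
  have hm : ∀ p, p ∈ B p := fun p =>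
    ⟨mem_extChartAt_source p, Metric.mem_ball_self (hr0 p)⟩
  have hloc : ∀ p q, ∀ x ∈ B p ∩ B q, ∀ᶠ z in 𝓝 x,
      f p (χ p z) - f q (χ q z) = f p (χ p x) - f q (χ q x) := by
    rintro p q x ⟨⟨hp, hpb⟩, hq, hqb⟩
    let O : Set (Coord n) := (overlap n p q ∩ transition n p q ⁻¹'
      Metric.ball (center n q) (r q)) ∩ Metric.ball (center n p) (r p)
    have hO : IsOpen O := ((contDiffOn_transition p q).continuousOn.isOpen_inter_preimage
      (isOpen_overlap p q) Metric.isOpen_ball).inter Metric.isOpen_ball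
    have hxO : χ p x ∈ O := by
      refine ⟨⟨mem_overlap.2 ⟨(χ p).map_source hp, by rwa [(χ p).left_inv hp]⟩, ?_⟩, hpb⟩
      rw [Set.mem_preimage, transition, Function.comp_apply, (χ p).left_inv hp]
      exact hqb
    have hder : ∀ z ∈ O, HasFDerivAt (fun z => f p z - f q (transition n p q z))
        (0 : Coord n →L[ℝ] ℝ) z := by
      rintro z ⟨⟨hz1, hz2⟩, hz3⟩
      rw [← sub_self (oneForm (θ p) z)]
      exact (hf p z hz3).sub (hasFDerivAt_comp_transition hz1 (ht p q z hz1) (hf q _ hz2))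
    obtain ⟨ε, hε, hεO⟩ := Metric.isOpen_iff.1 hO _ hxO
    have hmem : ∀ᶠ z in 𝓝 x, χ p z ∈ Metric.ball (χ p x) ε :=
      (continuousAt_extChartAt' hp).eventually (Metric.ball_mem_nhds _ hε)
    filter_upwards [hmem, (isOpen_extChartAt_source p).mem_nhds hp] with z hz hzp
    have := (convex_ball (χ p x) ε).is_const_of_fderivWithin_eq_zero (𝕜 := ℝ)
      (f := fun z => f p z - f q (transition n p q z))
      (fun w hw => (hder w (hεO hw)).differentiableAt.differentiableWithinAt)
      (fun w hw => by
        rw [fderivWithin_of_isOpen Metric.isOpen_ball hw]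
        exact (hder w (hεO hw)).fderiv) hz (Metric.mem_ball_self hε)
    simpa only [transition, Function.comp_apply, (χ p).left_inv hzp, (χ p).left_inv hp] using this
  -- Here ℝ serves as the group of additive constants and carries the discrete topology ⊥, not its
  -- usual one.
  obtain ⟨F, hF⟩ := @exists_glue M _ ℝ _ ⊥ (@DiscreteTopology.mk ℝ ⊥ rfl) _ _ B hB hm (fun p x => f p (χ p x)) hloc
  have hFd : ∀ p, ∀ y ∈ (χ p).target,
      HasFDerivAt (fun z => F ((χ p).symm z)) (oneForm (θ p) y) y := by
    intro p y hy
    obtain ⟨h1, h2⟩ := center_mem_overlap hy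
    set x := (χ p).symm y with hx
    have hcomp := hasFDerivAt_comp_transition h1 (ht p x y h1)
      (hf x _ (by rw [h2]; exact Metric.mem_ball_self (hr0 x)))
    refine (hcomp.const_add (F x - f x (χ x x))).congr_of_eventuallyEq ?_
    have hev := (continuousAt_extChartAt_symm'' hy).eventually (hF x x (hm x))
    filter_upwards [hev] with z hz
    rw [← hz]
    simp [transition]
  refine ⟨F, fun x => ?_, fun p y hy i => ?_⟩
  · have hs : ContDiffOn ℝ ∞ (fun z => F ((χ x).symm z)) (χ x).target := by
      rw [contDiffOn_infty_iff_fderiv_of_isOpen (isOpen_target x)]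
      refine ⟨fun y hy => (hFd x y hy).differentiableAt.differentiableWithinAt,
        (contDiffOn_oneForm (hθ x)).congr fun y hy => (hFd x y hy).fderiv⟩
    have hw := (contMDiffOn_iff_contDiffOn.2 hs).comp (contMDiffOn_extChartAt (x := x))
      fun z hz => (χ x).map_source (by rwa [extChartAt_source])
    refine (hw.contMDiffAt (chart_source_mem_nhds _ x)).congr_of_eventuallyEq ?_
    filter_upwards [extChartAt_source_mem_nhds (I := 𝓡 n) x] with z hz
    rw [Function.comp_apply, (χ x).left_inv hz]
  · rw [pd, (hFd p y hy).fderiv, oneForm_single]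

end Potential

/-! ## The vector field `𝕋` -/

section VectorT

variable {n : ℕ} {M : Type*} [TopologicalSpace M] [ChartedSpace (Coord n) M]
  [IsManifold (𝓡 n) ∞ M]

local notation "χ" => extChartAt (𝓡 n)

theorem natCast_sub_three_ne_zero (hn : 4 ≤ n) : (n : ℝ) - 3 ≠ 0 := by
  have : (4 : ℝ) ≤ n := by exact_mod_cast hn
  linarith

/-- If the Weyl tensor has no kernel at `p`, then `𝕋` is the only vector `V` with
`d^∇ 𝔨 = W(·, ·, ·, V)`. -/
theorem compT_eq (hn : 4 ≤ n) (g : Metric n M) {p : M} (hp : rankE g p = 0) {V : Fin n → ℝ}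
    (hV : ∀ i j k, dSchouten (localMetric g p) i j k (center n p) =
      ∑ l, V l * weylAt g p i j k l) : compT g p = V := by
  have hG := metricOn_localMetric g p
  have hc : center n p ∈ (χ p).target := center_mem p
  have hA : IsCurvTensor (weylAt g p) := hG.isCurvTensor_weyl hc
  have hh : (invMetricAt g p)ᵀ = invMetricAt g p := hG.inv_transpose _
  have hhg : invMetricAt g p * localMetric g p (center n p) = 1 := hG.inv_mul hc
  have hgh : localMetric g p (center n p) * invMetricAt g p = 1 := hG.mul_inv hc
  have hnull : ∀ v : Fin n → ℝ, (∀ j k l, ∑ i, v i * weylAt g p i j k l = 0) → v = 0 := by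
    intro v hv
    have h0 : nullity g p = ⊥ := Submodule.finrank_eq_zero.1 hp
    have : v ∈ nullity g p := hv
    rwa [h0, Submodule.mem_bot] at this
  -- Zero nullity makes 𝔴 injective, so its Moore-Penrose inverse recovers V from the source
  -- covector (n-3) 𝔴(V^*).
  have hinj : ∀ v, ricSq (invMetricAt g p) (weylAt g p) *ᵥ v = 0 → v = 0 := by
    intro v hv
    have e : v = localMetric g p (center n p) *ᵥ (invMetricAt g p *ᵥ v) := by
      rw [Matrix.mulVec_mulVec, hgh, Matrix.one_mulVec]
    rw [e] at hv
    rw [e, hA.eq_zero_of_ricSq (posDef_localMetric g p hc) hhg hnull hv, Matrix.mulVec_zero]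
  have hs : sourceCovector g p = ((n : ℝ) - 3) • (ricSq (invMetricAt g p) (weylAt g p) *ᵥ
      (localMetric g p (center n p) *ᵥ V)) := by
    funext l
    refine hA.source_eq hh (hG.symm _) hhg ((n : ℝ) - 3) V (D := divWeylAt g p) ?_ l
    intro i j c
    rw [divWeylAt, hG.divWeyl_eq hn hc, hV]
  rw [compT, covectorT, hs, Matrix.mulVec_smul _ ((n : ℝ) - 3), moorePenrose_mulVec hh hinj,
    smul_smul, one_div, inv_mul_cancel₀ (natCast_sub_three_ne_zero hn), one_smul, Matrix.mulVec_mulVec, hhg,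
    Matrix.one_mulVec]

theorem harmonicWeyl_iff (hn : 4 ≤ n) (g : Metric n M) :
    HarmonicWeyl g ↔ ∀ p i j k, dSchouten (localMetric g p) i j k (center n p) = 0 := by
  refine forall_congr' fun p => forall_congr' fun i => forall_congr' fun j =>
    forall_congr' fun k => ?_
  rw [divWeylAt, (metricOn_localMetric g p).divWeyl_eq hn (center_mem p),
    mul_eq_zero, or_iff_right (natCast_sub_three_ne_zero hn)]

/-- The local formula with f = -F. With F = log ψ the factor exp(-2F) is ψ⁻², so harmonicity becomes
an equation for grad F. -/
theorem dSchouten_conformal (hn : 4 ≤ n) {g gbar : Metric n M} {F : M → ℝ}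
    (hF : ContMDiff (𝓡 n) 𝓘(ℝ, ℝ) ∞ F)
    (hg : ∀ (p : M) (v w : TangentSpace (𝓡 n) p),
      gbar.inner p v w = Real.exp (2 * -F p) * g.inner p v w)
    (p : M) (i j k : Fin n) :
    dSchouten (localMetric gbar p) i j k (center n p) =
      dSchouten (localMetric g p) i j k (center n p) -
        ∑ l, gradComp (localMetric g p) (fun z => F ((χ p).symm z)) (center n p) l *
          weylAt g p i j k l := by
  have hf := contDiffOn_comp_symm p hF.contMDiffOn
  have h := (metricOn_localMetric g p).dSchouten_conformal hn (metricOn_localMetric gbar p) hf.neg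
    (fun z _ => by ext a b; exact hg _ _ _) (center_mem p) i j k
  have e : gradComp (localMetric g p) (-fun z => F ((χ p).symm z)) (center n p) =
      -gradComp (localMetric g p) (fun z => F ((χ p).symm z)) (center n p) := by
    rw [gradComp, gradComp, ← Matrix.mulVec_neg]
    congr 1
    funext a
    exact pd_neg ..
  erw [e] at h
  rw [h]
  simp only [Pi.neg_apply, neg_mul, Finset.sum_neg_distrib, ← sub_eq_add_neg]
  rfl

theorem pd_comp_symm {F : M → ℝ} (hF : ContMDiff (𝓡 n) 𝓘(ℝ, ℝ) ∞ F) {p q : M} {y : Coord n}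
    (hy : y ∈ overlap n p q) (i : Fin n) :
    pd i (fun z => F ((χ p).symm z)) y = ∑ a, jac (transition n p q) y a i *
      pd a (fun z => F ((χ q).symm z)) (transition n p q y) := by
  rw [pd_congr (isOpen_overlap p q) (f' := fun z => F ((χ q).symm (transition n p q z)))
    (fun z hz => by rw [symm_transition hz]) hy]
  exact pd_comp (isOpen_overlap p q) (isOpen_target q) (contDiffOn_transition p q)
    (fun z hz => (mem_overlap.1 (transition_mem hz)).1) (contDiffOn_comp_symm q hF.contMDiffOn) hy i

/-- Derivatives depend on germs only. Thus 𝕋 may be replaced on the open set M_𝓔 by a smooth field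
that agrees with it. -/
theorem dDual_congr (g : Metric n M) {X Y : ∀ q : M, TangentSpace (𝓡 n) q} {D : Set M}
    (hD : IsOpen D) (h : ∀ q ∈ D, X q = Y q) {p : M} (hp : p ∈ D) (i j : Fin n) :
    dDual g X p i j = dDual g Y p i j := by
  have hc : center n p ∈ (χ p).target ∩ (χ p).symm ⁻¹' D :=
    ⟨center_mem p, by rwa [Set.mem_preimage, symm_center]⟩
  have e : ∀ i, ∀ z ∈ (χ p).target ∩ (χ p).symm ⁻¹' D, localDual g X p i z =
      localDual g Y p i z := by
    intro i z hz
    rw [localDual, localDual, h _ hz.2]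
  rw [dDual, dDual, pd_congr (isOpen_preimage_symm p hD) (e j) hc,
    pd_congr (isOpen_preimage_symm p hD) (e i) hc]

/-- The gradient of `F`. -/
noncomputable def gradField (g : Metric n M) (F : M → ℝ) (p : M) : TangentSpace (𝓡 n) p :=
  (WithLp.toLp 2 (gradComp (localMetric g p) (fun z => F ((χ p).symm z)) (center n p)) : Coord n)

/-- The gradient is defined at each point in the chart of that point. Both sides transform as
covectors, so agreement at centers gives agreement throughout a chart. -/
theorem localDual_gradField (g : Metric n M) {F : M → ℝ} (hF : ContMDiff (𝓡 n) 𝓘(ℝ, ℝ) ∞ F)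
    {p : M} {y : Coord n} (hy : y ∈ (χ p).target) (i : Fin n) :
    localDual g (gradField g F) p i y = pd i (fun z => F ((χ p).symm z)) y := by
  have hc : ∀ (q : M) a, localDual g (gradField g F) q a (center n q) =
      pd a (fun z => F ((χ q).symm z)) (center n q) := by
    intro q a
    have h := congrFun (localMetric_mulVec_upComp g (gradField g F) q (center_mem q)) a
    rw [← h, upComp_center]
    exact (metricOn_localMetric g q).metric_mul_gradComp (center_mem q) a
  obtain ⟨h1, h2⟩ := center_mem_overlap hy
  rw [localDual_transition g _ h1, pd_comp_symm hF h1]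
  simp only [h2, hc]

/-- The equation `d^∇ 𝔨 = W(·, ·, ·, X)` in an arbitrary chart. -/
theorem dSchouten_eq_upComp (hn : 4 ≤ n) (g : Metric n M) (X : ∀ q : M, TangentSpace (𝓡 n) q)
    {p : M} {y : Coord n} (hy : y ∈ (χ p).target)
    (hX : X ((χ p).symm y) = vecT g ((χ p).symm y))
    (hC : ∀ i j k, cottonT g ((χ p).symm y) i j k = 0) (i j k : Fin n) :
    dSchouten (localMetric g p) i j k y =
      ∑ l, upComp g X p y l * weyl (localMetric g p) i j k l y := by
  obtain ⟨h1, h2⟩ := center_mem_overlap hy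
  refine (isLocalIsom_transition g p ((χ p).symm y)).dSchouten_eq_weyl hn h1
    (upComp_transition g X h1) (fun a b c => ?_) i j k
  rw [h2, upComp_center, hX]
  exact sub_eq_zero.1 (hC a b c)

theorem MetricOn.smooth_dSchouten {U : Set (Coord n)} {G : Coord n → Matrix (Fin n) (Fin n) ℝ}
    (h : MetricOn U G) (i j k : Fin n) : ContDiffOn ℝ ∞ (dSchouten G i j k) U := by
  refine ((h.smooth_cov2 h.smooth_schM i j k).sub (h.smooth_cov2 h.smooth_schM j i k)).congr
    fun y _ => ?_
  exact dSchouten_eq i j k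

/-- The metric `exp (-2 F) g`. -/
noncomputable def conformalMetric (g : Metric n M) (F : M → ℝ)
    (hF : ContMDiff (𝓡 n) 𝓘(ℝ, ℝ) ∞ F) : Metric n M where
  inner p := Real.exp (2 * -F p) • g.inner p
  symm p v w := by
    rw [smul_apply, smul_apply, smul_apply, smul_apply, g.symm]
  pos p v hv := by
    rw [smul_apply, smul_apply, smul_eq_mul]
    exact mul_pos (Real.exp_pos _) (g.pos p v hv)
  isVonNBounded p := by
    -- The unit ball of exp(-2F) g is the unit ball of g dilated by exp F.
    refine ((g.isVonNBounded p).image (Real.exp (F p) •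
      ContinuousLinearMap.id ℝ (TangentSpace (𝓡 n) p))).subset fun v hv => ?_
    refine ⟨Real.exp (-F p) • v, ?_, ?_⟩
    · rw [Set.mem_ofPred_eq] at hv ⊢
      rw [smul_apply, smul_apply, smul_eq_mul, two_mul, Real.exp_add] at hv
      rwa [map_smul, map_smul, smul_apply, smul_eq_mul, smul_eq_mul, ← mul_assoc]
    · rw [smul_apply, ContinuousLinearMap.id_apply, smul_smul, ← Real.exp_add, add_neg_cancel,
        Real.exp_zero, one_smul]
  contMDiff := by
    refine ContMDiff.smul_section ?_ g.contMDiff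
    exact Real.contDiff_exp.contMDiff.comp (contMDiff_const.mul hF.neg)

/-- A vector field that solves `d^∇ 𝔨 = W(·, ·, ·, T)` is smooth if the Weyl tensor has no
kernel. -/
theorem MetricOn.smooth_of_dSchouten_eq {U : Set (Coord n)}
    {G : Coord n → Matrix (Fin n) (Fin n) ℝ} (h : MetricOn U G) {T : Fin n → Coord n → ℝ}
    (hC : ∀ z ∈ U, ∀ i j k, dSchouten G i j k z = ∑ l, T l z * weyl G i j k l z)
    (hnull : ∀ z ∈ U, ∀ v : Fin n → ℝ, (∀ j k l, ∑ i, v i * weyl G i j k l z = 0) → v = 0)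
    (l : Fin n) : ContDiffOn ℝ ∞ (T l) U := by
  -- Normal equations for the overdetermined system d^∇𝔨 = W(·,·,·,T): the Gram matrix `N` of W in
  -- its last slot satisfies N T = s. It is invertible because W has no kernel, so T = N⁻¹ s is
  -- smooth. The Euclidean sums over indices suffice, as no invariance is needed.
  let N : Coord n → Matrix (Fin n) (Fin n) ℝ := fun z => Matrix.of fun l m =>
    ∑ i, ∑ j, ∑ k, weyl G i j k l z * weyl G i j k m z
  let s : Fin n → Coord n → ℝ := fun l z => ∑ i, ∑ j, ∑ k, weyl G i j k l z * dSchouten G i j k z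
  have sN : SmoothMat U N := fun l m =>
    smooth_sum Finset.univ fun i => smooth_sum Finset.univ fun j => smooth_sum Finset.univ fun k =>
      (h.smooth_weyl i j k l).mul (h.smooth_weyl i j k m)
  have ss : ∀ l, ContDiffOn ℝ ∞ (s l) U := fun l =>
    smooth_sum _ fun i => smooth_sum _ fun j => smooth_sum _ fun k =>
      (h.smooth_weyl i j k l).mul (h.smooth_dSchouten i j k)
  have hN : ∀ z (v : Fin n → ℝ) l, (N z *ᵥ v) l =
      ∑ i, ∑ j, ∑ k, weyl G i j k l z * ∑ m, v m * weyl G i j k m z := by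
    intro z v l
    simp only [N, Matrix.mulVec, dotProduct, Matrix.of_apply, Finset.sum_mul, Finset.mul_sum]
    rw [Finset.sum_comm]
    refine Finset.sum_congr rfl fun i _ => ?_
    rw [Finset.sum_comm]
    refine Finset.sum_congr rfl fun j _ => ?_
    rw [Finset.sum_comm]
    refine Finset.sum_congr rfl fun k _ => Finset.sum_congr rfl fun m _ => ?_
    ring
  have hdet : ∀ z ∈ U, IsUnit (N z).det := by
    intro z hz
    rw [isUnit_iff_ne_zero]
    intro h0
    obtain ⟨v, hv0, hv⟩ := Matrix.exists_mulVec_eq_zero_iff.2 h0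
    refine hv0 (hnull z hz v ?_)
    have hq : ∑ i, ∑ j, ∑ k, (∑ m, v m * weyl G i j k m z) ^ 2 = 0 := by
      have : v ⬝ᵥ (N z *ᵥ v) = 0 := by rw [hv, dotProduct_zero]
      rw [← this]
      simp only [dotProduct, hN]
      conv_rhs =>
        enter [2, l]
        rw [Finset.mul_sum]
      conv_rhs => rw [Finset.sum_comm]
      refine Finset.sum_congr rfl fun i _ => ?_
      conv_rhs =>
        enter [2, l]
        rw [Finset.mul_sum]
      conv_rhs => rw [Finset.sum_comm]
      refine Finset.sum_congr rfl fun j _ => ?_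
      conv_rhs =>
        enter [2, l]
        rw [Finset.mul_sum]
      conv_rhs => rw [Finset.sum_comm]
      refine Finset.sum_congr rfl fun k _ => ?_
      rw [sq, Finset.sum_mul]
      exact Finset.sum_congr rfl fun l _ => mul_assoc _ _ _
    have hz0 : ∀ i j k, ∑ m, v m * weyl G i j k m z = 0 := by
      intro i j k
      have h1 := (Finset.sum_eq_zero_iff_of_nonneg fun i _ => Finset.sum_nonneg fun j _ =>
        Finset.sum_nonneg fun k _ => sq_nonneg _).1 hq i (Finset.mem_univ _)
      have h2 := (Finset.sum_eq_zero_iff_of_nonneg fun j _ =>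
        Finset.sum_nonneg fun k _ => sq_nonneg _).1 h1 j (Finset.mem_univ _)
      have h3 := (Finset.sum_eq_zero_iff_of_nonneg fun k _ => sq_nonneg _).1 h2 k
        (Finset.mem_univ _)
      exact pow_eq_zero_iff two_ne_zero |>.1 h3
    intro j k l
    have hA := h.isCurvTensor_weyl hz
    have e : ∀ i, weyl G i j k l z = -weyl G k l j i z := fun i => by
      rw [← hA.swap34 k l j i]
      exact (hA.pair ..).symm
    simp only [e, mul_neg, Finset.sum_neg_distrib, hz0, neg_zero]
  have hT : ∀ z ∈ U, (fun l => T l z) = (N z)⁻¹ *ᵥ fun l => s l z := by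
    intro z hz
    have : (fun l => s l z) = N z *ᵥ fun l => T l z := by
      funext l
      rw [hN]
      simp only [s, hC z hz]
    rw [this, Matrix.mulVec_mulVec, Matrix.nonsing_inv_mul _ (hdet z hz), Matrix.one_mulVec]
  refine (smooth_sum Finset.univ fun m => (sN.inv hdet l m).mul (ss m)).congr fun z hz => ?_
  exact congrFun (hT z hz) l

theorem MetricOn.mono {U V : Set (Coord n)} {G : Coord n → Matrix (Fin n) (Fin n) ℝ}
    (h : MetricOn U G) (hV : IsOpen V) (hVU : V ⊆ U) : MetricOn V G where
  isOpen := hV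
  smooth i j := (h.smooth i j).mono hVU
  symm := h.symm
  det y hy := h.det y (hVU hy)

/-- The field 𝕋 is only defined pointwise, so its smoothness near p is first extracted from the
equation C_𝕋 = 0. Then W annihilates d𝕋^*, and the determinant condition at p removes it. -/
theorem dDual_eq_zero_of_det (hn : 4 ≤ n) (g : Metric n M)
    (hE : ∀ p ∈ regularSet g, rankE g p = 0)
    (hC : ∀ p ∈ regularSet g, ∀ i j k, cottonT g p i j k = 0) {p : M} (hp : p ∈ regularSet g)
    (hdet : detWeylAt g p ≠ 0) (i j : Fin n) : dDual g (vecT g) p i j = 0 := by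
  have hD := isOpen_regularSet g
  set U := (χ p).target ∩ (χ p).symm ⁻¹' regularSet g with hUdef
  have hU : IsOpen U := isOpen_preimage_symm p hD
  have hc : center n p ∈ U := ⟨center_mem p, by rwa [Set.mem_preimage, symm_center]⟩
  have hG : MetricOn U (localMetric g p) :=
    (metricOn_localMetric g p).mono hU Set.inter_subset_left
  have hT : ∀ z ∈ U, ∀ i j k, dSchouten (localMetric g p) i j k z =
      ∑ l, upComp g (vecT g) p z l * weyl (localMetric g p) i j k l z := fun z hz =>
    dSchouten_eq_upComp hn g (vecT g) hz.1 rfl (hC _ hz.2)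
  have hs := hG.smooth_of_dSchouten_eq (T := fun l z => upComp g (vecT g) p z l) hT
    fun z hz v hv => weylKer_eq_bot hn hE hz.1 hz.2 hv
  have h0 := hG.weyl_exterior_eq_zero hn (τ := localDual g (vecT g) p) hs hT
    (fun z hz b => (congrFun (localMetric_mulVec_upComp g (vecT g) p hz.1) b).symm) hc
  have hA : IsCurvTensor (weylAt g p) := hG.isCurvTensor_weyl hc
  have hb := hA.eq_zero_of_det (hG.inv_transpose _) hdet (b := Matrix.of fun a b =>
    pd a (localDual g (vecT g) p b) (center n p) - pd b (localDual g (vecT g) p a) (center n p))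
    (by ext a b; simp) h0
  exact congrFun (congrFun hb i) j

end VectorT

/-! ### The two directions of the equivalence -/

section Conformal

variable {n : ℕ} {M : Type*} [TopologicalSpace M] [ChartedSpace (Coord n) M]
  [IsManifold (𝓡 n) ∞ M]

local notation "χ" => extChartAt (𝓡 n)

/-- With F = log ψ, grad F solves the equation for 𝕋 on all of M and equals 𝕋 on M_𝓔 by uniqueness.
Hence d𝕋^* = ddF = 0, and grad F is itself the smooth extension. -/
theorem conditions_of_conformal (hn : 4 ≤ n) (g : Metric n M)
    (hE : ∀ p ∈ regularSet g, rankE g p = 0) {gbar : Metric n M} (hconf : IsConformalTo g gbar)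
    (hharm : HarmonicWeyl gbar) :
    (∀ p ∈ regularSet g, ∀ i j, dDual g (vecT g) p i j = 0) ∧
      (∀ p ∈ regularSet g, ∀ i j k, cottonT g p i j k = 0) ∧
      ExtendsSmoothly (regularSet g) (vecT g) := by
  obtain ⟨ψ, hψ, hpos, hg⟩ := hconf
  let F : M → ℝ := fun p => Real.log (ψ p)
  have hF : ContMDiff (𝓡 n) 𝓘(ℝ, ℝ) ∞ F := fun p =>
    (Real.contDiffAt_log.2 (hpos p).ne').contMDiffAt.comp p (hψ p)
  have hgF : ∀ (p : M) (v w : TangentSpace (𝓡 n) p),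
      gbar.inner p v w = Real.exp (2 * -F p) * g.inner p v w := by
    intro p v w
    rw [hg, mul_neg, Real.exp_neg, two_mul, Real.exp_add, Real.exp_log (hpos p), sq]
  have hcot : ∀ p i j k, dSchouten (localMetric g p) i j k (center n p) =
      ∑ l, gradComp (localMetric g p) (fun z => F ((χ p).symm z)) (center n p) l *
        weylAt g p i j k l := by
    intro p i j k
    rw [← sub_eq_zero, ← dSchouten_conformal hn hF hgF]
    exact (harmonicWeyl_iff hn gbar).1 hharm p i j k
  have hcomp : ∀ p ∈ regularSet g, compT g p =
      gradComp (localMetric g p) (fun z => F ((χ p).symm z)) (center n p) := fun p hp =>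
    compT_eq hn g (hE p hp) (hcot p)
  have hvec : ∀ p ∈ regularSet g, vecT g p = gradField g F p := fun p hp => by
    rw [vecT, hcomp p hp, gradField]
  have hs : ∀ (p : M) i, ContDiffOn ℝ ∞ (pd i fun z => F ((χ p).symm z)) (χ p).target :=
    fun p i => smooth_pd (isOpen_target p) (contDiffOn_comp_symm p hF.contMDiffOn) i
  refine ⟨fun p hp i j => ?_, fun p hp i j k => ?_, gradField g F, ?_, fun p hp => (hvec p hp).symm⟩
  · rw [dDual_congr g (isOpen_regularSet g) hvec hp, dDual,
      pd_congr (isOpen_target p) (fun z hz => localDual_gradField g hF hz j) (center_mem p),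
      pd_congr (isOpen_target p) (fun z hz => localDual_gradField g hF hz i) (center_mem p),
      sub_eq_zero]
    exact pd_comm (isOpen_target p) (contDiffOn_comp_symm p hF.contMDiffOn) (center_mem p) i j
  · rw [cottonT, hcomp p hp, hcot, sub_self]
  · refine contMDiff_of_localDual g fun p i => ?_
    exact (hs p i).congr fun y hy => localDual_gradField g hF hy i

/-- For the extension X, both dX^* = 0 and d^∇𝔨 = W(·,·,·,X) are equalities of continuous functions
in charts, so they spread from the dense set M_𝓔 to M. A potential F of X^* then gives ψ = exp F. -/
theorem exists_conformal_of_conditions [SimplyConnectedSpace M] (hn : 4 ≤ n) (g : Metric n M)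
    (hd : ∀ p ∈ regularSet g, ∀ i j, dDual g (vecT g) p i j = 0)
    (hC : ∀ p ∈ regularSet g, ∀ i j k, cottonT g p i j k = 0)
    (hX : ExtendsSmoothly (regularSet g) (vecT g)) :
    ∃ gbar : Metric n M, IsConformalTo g gbar ∧ HarmonicWeyl gbar := by
  obtain ⟨X, hXs, hXT⟩ := hX
  have hD := isOpen_regularSet g
  have hdense := dense_regularSet hn g
  have hθ : ∀ p i, ContDiffOn ℝ ∞ (localDual g X p i) (χ p).target := contDiffOn_localDual g hXs
  have hclosed : ∀ p, ∀ y ∈ (χ p).target, ∀ i j,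
      pd i (localDual g X p j) y = pd j (localDual g X p i) y := by
    intro p y hy i j
    refine sub_eq_zero.1 (eq_zero_of_dense (p := p) hdense
      (f := fun y => pd i (localDual g X p j) y - pd j (localDual g X p i) y)
      ((smooth_pd (isOpen_target p) (hθ p j) i).sub
        (smooth_pd (isOpen_target p) (hθ p i) j)).continuousOn (fun z hz hr => ?_) y hy)
    obtain ⟨h1, h2⟩ := center_mem_overlap hz
    have h := isLocalIsom_transition g p ((χ p).symm z)
    rw [pd_pullback_sub h.left.isOpen h.right.isOpen h.smooth h.mapsTo h1 (hθ _)
      (fun w hw i => localDual_transition g X hw i), h2]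
    refine Finset.sum_eq_zero fun a _ => Finset.sum_eq_zero fun b _ => ?_
    have := hd _ hr a b
    rw [← dDual_congr g hD hXT hr, dDual] at this
    rw [this, mul_zero]
  have hcot : ∀ p, ∀ y ∈ (χ p).target, ∀ i j k, dSchouten (localMetric g p) i j k y =
      ∑ l, upComp g X p y l * weyl (localMetric g p) i j k l y := by
    intro p y hy i j k
    have hG := metricOn_localMetric g p
    have hu : ∀ l, ContDiffOn ℝ ∞ (fun y => upComp g X p y l) (χ p).target := fun l =>
      smooth_sum Finset.univ fun b => (hG.smooth_inv l b).mul (hθ p b)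
    refine sub_eq_zero.1 (eq_zero_of_dense (p := p) hdense
      (f := fun y => dSchouten (localMetric g p) i j k y -
        ∑ l, upComp g X p y l * weyl (localMetric g p) i j k l y)
      ((hG.smooth_dSchouten i j k).sub (smooth_sum Finset.univ fun l =>
        (hu l).mul (hG.smooth_weyl i j k l))).continuousOn (fun z hz hr => ?_) y hy)
    exact sub_eq_zero.2 (dSchouten_eq_upComp hn g X hz (hXT _ hr) (hC _ hr) i j k)
  obtain ⟨F, hF, hFX⟩ := exists_potential hθ (fun p q y hy i => localDual_transition g X hy i)
    hclosed
  refine ⟨conformalMetric g F hF, ⟨fun p => Real.exp (F p),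
    Real.contDiff_exp.contMDiff.comp hF, fun p => Real.exp_pos _, fun p v w => ?_⟩, ?_⟩
  · rw [← Real.exp_nat_mul, ← Real.exp_neg, Nat.cast_ofNat, ← mul_neg]
    rfl
  · rw [harmonicWeyl_iff hn]
    intro p i j k
    have e : gradComp (localMetric g p) (fun z => F ((χ p).symm z)) (center n p) =
        upComp g X p (center n p) := by
      rw [gradComp, upComp]
      congr 1
      funext b
      exact hFX p _ (center_mem p) b
    rw [dSchouten_conformal hn hF (fun p v w => rfl), e, hcot p _ (center_mem p), sub_eq_zero]
    rfl

end Conformal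

end ConfWeyl

theorem mainTheorem4 {n : ℕ} (hn : 4 ≤ n) {M : Type*} [TopologicalSpace M] [T2Space M]
    [ChartedSpace (ConfWeyl.Coord n) M] [IsManifold (𝓡 n) ∞ M] [SimplyConnectedSpace M]
    (g : ConfWeyl.Metric n M)
    (hE : ∀ p ∈ ConfWeyl.regularSet g, ConfWeyl.rankE g p = 0) :
    ((∃ gbar : ConfWeyl.Metric n M,
        ConfWeyl.IsConformalTo g gbar ∧ ConfWeyl.HarmonicWeyl gbar) ↔
      ((∀ p ∈ ConfWeyl.regularSet g, ∀ i j, ConfWeyl.dDual g (ConfWeyl.vecT g) p i j = 0) ∧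
       (∀ p ∈ ConfWeyl.regularSet g, ∀ i j k, ConfWeyl.cottonT g p i j k = 0) ∧
       ConfWeyl.ExtendsSmoothly (ConfWeyl.regularSet g) (ConfWeyl.vecT g))) ∧
    ((∀ p ∈ ConfWeyl.regularSet g, ConfWeyl.detWeylAt g p ≠ 0) →
      (∀ p ∈ ConfWeyl.regularSet g, ∀ i j k, ConfWeyl.cottonT g p i j k = 0) →
      ∀ p ∈ ConfWeyl.regularSet g, ∀ i j, ConfWeyl.dDual g (ConfWeyl.vecT g) p i j = 0) := by
  refine ⟨⟨?_, ?_⟩, fun hdet hC p hp i j =>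
    ConfWeyl.dDual_eq_zero_of_det hn g hE hC hp (hdet p hp) i j⟩
  · rintro ⟨gbar, hconf, hharm⟩
    exact ConfWeyl.conditions_of_conformal hn g hE hconf hharm
  · rintro ⟨hd, hC, hY⟩
    exact ConfWeyl.exists_conformal_of_conditions hn g hd hC hY
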